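/- Notation. $^*$ is transposition, $E$ is expectation, $O(\cdot)$ for matrices is meant entrywise. For $i=1,2,3,4$ let $\Gamma_i,M_i\in\mathbb R^{d_i\times d_i}$, $\Sigma_i\in\mathbb R^{d_i\times q_i}$ and $C_i\in\mathbb R^{q\times d_i}$ ($i=1,2$), $C_i\in\mathbb R^{r\times d_i}$ ($i=3,4$) be constant matrices such that all eigenvalues of $\Gamma_i$ have positive real part, $M_i=M_i^*>0$ and $\Gamma_iM_i+M_i\Gamma_i^*=\Sigma_i\Sigma_i^*$. Let $\alpha_1,\dots,\alpha_4\in\{0,1\}$. The memory function is $$\kappa(t)=\sum_{i=1,2}\alpha_iC_ie^{-\Gamma_i|t|}M_iC_i^*,\qquad t\in\mathbb R.$$ The noise is $\xi_t=\alpha_3C_3\beta^3_t+\alpha_4C_4\beta^4_t$, $t\ge0$, where $\beta^3,\beta^4$ are independent and $d\beta^j_t=-\Gamma_j\beta^j_t\,dt+\Sigma_j\,dW^{(q_j)}_t$, $\beta^j_0\sim N(0,M_j)$ is independent of the Wiener process $W^{(q_j)}$, and $W^{(q_3)},W^{(q_4)}$ are independent. Its covariance function is $R=\alpha_3R_3+\alpha_4R_4$,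 where $R_j(t)=C_je^{-\Gamma_jt}M_jC_j^*$ for $t\ge0$ and $R_j(-t)=R_j(t)^*$. Put $\mathcal S_j(\omega)=\int_{\mathbb R}R_j(t)e^{-i\omega t}\,dt$ and $\mathcal S=\alpha_3\mathcal S_3+\alpha_4\mathcal S_4$. For $n\in\mathbb Z$ let $K_i^{(n)}=C_i\Gamma_i^{-n}M_iC_i^*$ ($i=1,2$) and $L_j^{(n)}=C_j\Gamma_j^{-n}M_jC_j^*$ ($j=3,4$). Assume that $K_1^{(1)}$ and $L_3^{(1)}$ are invertible and $K_2^{(1)}=0$, $L_4^{(1)}=0$. Let $m>0$, let $\gamma_0\in\mathbb R^{d\times d}$, $\sigma_0\in\mathbb R^{d\times k}$, $g\in\mathbb R^{d\times q}$, $h\in\mathbb R^{q\times d}$, $\sigma\in\mathbb R^{d\times r}$ be constant matrices, and let $v$ solve $$m\,dv(t)=-\gamma_0v(t)\,dt-g\Big(\int_0^t\kappa(t-s)\,h\,v(s)\,ds\Big)dt+\sigma_0\,dW^{(k)}(t)+\sigma\,\xi(t)\,dt,$$ where $W^{(k)}$ is a $k$-dimensional Wiener process, $v(0)$ is square integrable,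 and $v(0)$, $\xi$, $W^{(k)}$ are pairwise independent. Let $x(t)=\int_0^tv(s)\,ds$. **Proposition.** (i) $\mathcal S_3(\omega)=O(1)$ as $\omega\to0$. If $k\ge3$ is odd, $L_4^{(n)}=0$ for all odd $n$ with $0<n<k$, and $L_4^{(k)}\ne0$, then $\mathcal S_4(\omega)=O(\omega^{k-1})$ as $\omega\to0$. If there is a real $h>0$ with $\mathcal S(\omega)=O(1/\omega^{2h+1})$ as $\omega\to\infty$, then $\xi$ is $n$ times mean-square differentiable on $[0,\infty)$ for every integer $0\le n<h$. (ii) Let $\hat\kappa(z)=\int_0^\infty\kappa(t)e^{-zt}\,dt$ and $\mathcal E=\frac12mE[v(0)v(0)^*]$. Assume that $r=q$, that $R(t)=\kappa(t)$ for all $t\in\mathbb R$, and that $\sigma\kappa(t)\sigma^*=h^*\kappa^*(t)g^*$. Then there is a continuously differentiable $H:[0,\infty)\to\mathbb R^{d\times d}$ whose Laplace transform is, on some right half-plane, $\hat H(z)=z\hat F(z)$ with $$\hat F(z)=\big(z^2(mzI+\gamma_0+g\hat\kappa(z)h)\big)^{-1},$$ and for every such $H$ and every $t\ge0$, $x(t)$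 is square integrable and $$E[x(t)x^*(t)]=\tfrac12\big(A(t)+A(t)^*\big),$$ where $$A(t)=2\int_0^tH(s)\,ds+2m\Big(H(t)\mathcal EH^*(t)-\int_0^tH(u)\dot H^*(u)\,du\Big)+\int_0^tH(u)(\sigma_0\sigma_0^*-2\gamma_0^*)H^*(u)\,du .$$ In particular $E[x(t)x^*(t)]=A(t)$ whenever $A(t)$ is symmetric (for instance if $d=1$), and $E|x(t)|^2=\operatorname{tr}A(t)$ always. In (iii) and (iv) assume $q=r=d$, $\gamma_0=\sigma_0\sigma_0^*/2$, $g=h^*=\sigma$ with $\sigma$ symmetric positive definite, and $R(t)=\kappa(t)=\kappa^*(t)$ for all $t\in\mathbb R$. (iii) If $\alpha_1=\alpha_3=1$, then $x(t)$ is square integrable for all $t\ge0$ and $E[x(t)x^*(t)]=O(t)$ as $t\to\infty$ (normal diffusion). (iv) If $\alpha_1=0$, $\alpha_2=1$, $\gamma_0=0$ and $\sigma_0=0$, then $x(t)$ is square integrable for all $t\ge0$ and $E[x(t)x^*(t)]=O(t^2)$ as $t\to\infty$ (ballistic diffusion). -/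

import Mathlib

open MeasureTheory ProbabilityTheory Filter Topology Matrix Asymptotics
open scoped NNReal

noncomputable section

namespace GLE

/-! ### Matrix-valued functions of a real variable -/

/-- Entrywise integral `∫ₐᵇ F(u) du`. -/
def matIntegral {p q : ℕ} (a b : ℝ) (F : ℝ → Matrix (Fin p) (Fin q) ℝ) :
    Matrix (Fin p) (Fin q) ℝ :=
  Matrix.of fun i j => ∫ u in a..b, F u i j

/-- Entrywise derivative on `[0, ∞)` (one-sided at `0`). -/
def matDeriv {p q : ℕ} (F : ℝ → Matrix (Fin p) (Fin q) ℝ) (u : ℝ) :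
    Matrix (Fin p) (Fin q) ℝ :=
  Matrix.of fun i j => derivWithin (fun s => F s i j) (Set.Ici 0) u

/-- A real matrix regarded as a complex matrix. -/
def toC {p q : ℕ} (A : Matrix (Fin p) (Fin q) ℝ) : Matrix (Fin p) (Fin q) ℂ :=
  A.map (algebraMap ℝ ℂ)

/-- Entrywise Laplace transform `∫₀^∞ F(t) e^{-zt} dt`. -/
def laplace {p q : ℕ} (F : ℝ → Matrix (Fin p) (Fin q) ℝ) (z : ℂ) :
    Matrix (Fin p) (Fin q) ℂ :=
  Matrix.of fun i j => ∫ t in Set.Ioi (0 : ℝ), (F t i j : ℂ) * Complex.exp (-(z * t))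

/-- Absolute convergence of the Laplace integral at `z`. -/
def LaplaceConverges {p q : ℕ} (F : ℝ → Matrix (Fin p) (Fin q) ℝ) (z : ℂ) : Prop :=
  ∀ i j, IntegrableOn (fun t : ℝ => (F t i j : ℂ) * Complex.exp (-(z * t))) (Set.Ioi 0)

/-- Entrywise Fourier transform `∫ F(t) e^{-iωt} dt` over the real line. -/
def fourierMat {p q : ℕ} (F : ℝ → Matrix (Fin p) (Fin q) ℝ) (w : ℝ) :
    Matrix (Fin p) (Fin q) ℂ :=
  Matrix.of fun i j => ∫ t : ℝ, (F t i j : ℂ) * Complex.exp (-(Complex.I * w * t))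

/-! ### Realizations by constant matrices -/

/-- The matrices `Γ, M ∈ ℝ^{n×n}`, `Σ ∈ ℝ^{n×p}`, `C ∈ ℝ^{r×n}`. -/
structure Realization (n p r : ℕ) where
  Γ : Matrix (Fin n) (Fin n) ℝ
  M : Matrix (Fin n) (Fin n) ℝ
  S : Matrix (Fin n) (Fin p) ℝ
  C : Matrix (Fin r) (Fin n) ℝ

namespace Realization

variable {n p r : ℕ} (A : Realization n p r)

/-- `Γ` is positive stable, `M` is symmetric positive definite, and the Lyapunov equation
`Γ M + M Γ* = Σ Σ*` holds. -/
structure Admissible : Prop where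
  posStable : ∀ μ ∈ spectrum ℂ (toC A.Γ), 0 < μ.re
  posDef : A.M.PosDef
  lyapunov : A.Γ * A.M + A.M * A.Γᵀ = A.S * A.Sᵀ

/-- `C e^{-Γ|t|} M C*`. -/
def kernel (t : ℝ) : Matrix (Fin r) (Fin r) ℝ :=
  A.C * NormedSpace.exp (-(|t| • A.Γ)) * A.M * A.Cᵀ

/-- The stationary covariance function `E[C β_t (C β_0)*]`: it is `C e^{-Γt} M C*` for `t ≥ 0`, and
`R(-t) = R(t)*`. -/
def cov (t : ℝ) : Matrix (Fin r) (Fin r) ℝ :=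
  if 0 ≤ t then A.kernel t else (A.kernel t)ᵀ

/-- The `n`-th order effective constant `C Γ^{-n} M C*`. -/
def effConst (n : ℤ) : Matrix (Fin r) (Fin r) ℝ :=
  A.C * A.Γ ^ (-n) * A.M * A.Cᵀ

end Realization

/-- The constants behind the memory function (systems 1, 2) and the noise (systems 3, 4), with the
switches `α₁, …, α₄`. -/
structure Model (q r : ℕ) where
  (d₁ d₂ d₃ d₄ q₁ q₂ q₃ q₄ : ℕ)
  sys₁ : Realization d₁ q₁ q
  sys₂ : Realization d₂ q₂ q
  sys₃ : Realization d₃ q₃ r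
  sys₄ : Realization d₄ q₄ r
  (α₁ α₂ α₃ α₄ : ℝ)

namespace Model

variable {q r : ℕ} (D : Model q r)

/-- The standing assumptions on the constants. -/
structure Standing : Prop where
  adm₁ : D.sys₁.Admissible
  adm₂ : D.sys₂.Admissible
  adm₃ : D.sys₃.Admissible
  adm₄ : D.sys₄.Admissible
  switch₁ : D.α₁ = 0 ∨ D.α₁ = 1
  switch₂ : D.α₂ = 0 ∨ D.α₂ = 1
  switch₃ : D.α₃ = 0 ∨ D.α₃ = 1
  switch₄ : D.α₄ = 0 ∨ D.α₄ = 1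
  damping₁ : IsUnit (D.sys₁.effConst 1)
  damping₂ : D.sys₂.effConst 1 = 0
  diffusion₃ : IsUnit (D.sys₃.effConst 1)
  diffusion₄ : D.sys₄.effConst 1 = 0

/-- The memory function `κ(t)`. -/
def κ (t : ℝ) : Matrix (Fin q) (Fin q) ℝ := D.α₁ • D.sys₁.kernel t + D.α₂ • D.sys₂.kernel t

/-- The covariance function `R(t)` of the noise. -/
def R (t : ℝ) : Matrix (Fin r) (Fin r) ℝ := D.α₃ • D.sys₃.cov t + D.α₄ • D.sys₄.cov t

/-- The spectral density `S₃(ω)`, the Fourier transform of `R₃(t)`. -/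
def spec₃ (w : ℝ) : Matrix (Fin r) (Fin r) ℂ := fourierMat D.sys₃.cov w

/-- The spectral density `S₄(ω)`, the Fourier transform of `R₄(t)`. -/
def spec₄ (w : ℝ) : Matrix (Fin r) (Fin r) ℂ := fourierMat D.sys₄.cov w

/-- The noise spectral density `S(ω) = α₃ S₃(ω) + α₄ S₄(ω)`. -/
def spec (w : ℝ) : Matrix (Fin r) (Fin r) ℂ :=
  (D.α₃ : ℂ) • D.spec₃ w + (D.α₄ : ℂ) • D.spec₄ w

end Model

/-! ### Stochastic processes on `[0, ∞)`

Wiener processes are indexed by `ℝ≥0`. The other processes are indexed by `ℝ`; only their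
values at times `t ≥ 0` are used. -/

section Processes

variable {Ω : Type*} [MeasurableSpace Ω]

/-- The path of a process on `[0, ∞)`, as a random element of the product space. -/
def path {E : Type*} (X : ℝ → Ω → E) : Ω → ℝ≥0 → E := fun ω t => X t ω

/-- An `n`-dimensional Wiener process: the coordinates are independent real Brownian motions. -/
structure IsWiener {n : ℕ} (P : Measure Ω) (W : ℝ≥0 → Ω → Fin n → ℝ) : Prop where
  brownian : ∀ i, IsBrownianReal (fun t ω => W t ω i) P
  indep : iIndepFun (fun i ω (t : ℝ≥0) => W t ω i) P

/-- `β` solves `dβ = -Γ β dt + Σ dW`, with `β₀ ∼ N(0, M)` independent of the Wiener process `W`.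
The noise is additive, so the equation is the pathwise integral equation. -/
structure IsOU {n p r : ℕ} (A : Realization n p r) (P : Measure Ω)
    (W : ℝ≥0 → Ω → Fin p → ℝ) (β : ℝ → Ω → Fin n → ℝ) : Prop where
  wiener : IsWiener P W
  aemeasurable : ∀ t, 0 ≤ t → AEMeasurable (β t) P
  law_zero : HasLaw (fun ω => WithLp.toLp 2 (β 0 ω)) (multivariateGaussian 0 A.M) P
  indep : IndepFun (β 0) (fun ω t => W t ω) P
  continuous : ∀ᵐ ω ∂P, ContinuousOn (fun t => β t ω) (Set.Ici 0)
  sde : ∀ᵐ ω ∂P, ∀ t : ℝ≥0,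
    β t ω = β 0 ω - (∫ s in (0 : ℝ)..t, A.Γ *ᵥ β s ω) + A.S *ᵥ W t ω

/-- `ξ_t = α₃ C₃ β³_t + α₄ C₄ β⁴_t` for `t ≥ 0`, with independent Ornstein-Uhlenbeck processes
`β³`, `β⁴` driven by independent Wiener processes. -/
def IsNoise {q r : ℕ} (D : Model q r) (P : Measure Ω) (ξ : ℝ → Ω → Fin r → ℝ) : Prop :=
  ∃ (W₃ : ℝ≥0 → Ω → Fin D.q₃ → ℝ) (W₄ : ℝ≥0 → Ω → Fin D.q₄ → ℝ)
    (β₃ : ℝ → Ω → Fin D.d₃ → ℝ) (β₄ : ℝ → Ω → Fin D.d₄ → ℝ),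
    IsOU D.sys₃ P W₃ β₃ ∧ IsOU D.sys₄ P W₄ β₄ ∧
    IndepFun (path β₃) (path β₄) P ∧
    IndepFun (fun ω t => W₃ t ω) (fun ω t => W₄ t ω) P ∧
    ∀ t, 0 ≤ t → ∀ ω,
      ξ t ω = D.α₃ • (D.sys₃.C *ᵥ β₃ t ω) + D.α₄ • (D.sys₄.C *ᵥ β₄ t ω)

/-- `Y` is the mean-square derivative of `X` on `[0, ∞)` (one-sided at `0`). -/
def IsMSDeriv {r : ℕ} (P : Measure Ω) (X Y : ℝ → Ω → Fin r → ℝ) : Prop :=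
  ∀ t, 0 ≤ t →
    Tendsto (fun δ : ℝ => eLpNorm (fun ω => δ⁻¹ • (X (t + δ) ω - X t ω) - Y t ω) 2 P)
      (𝓝[{δ : ℝ | δ ≠ 0 ∧ 0 ≤ t + δ}] 0) (𝓝 0)

/-- `X` is a square-integrable process on `[0, ∞)` that is `n` times mean-square differentiable,
with successive square-integrable derivatives `Y 1, …, Y n`. -/
def IsMSDifferentiable {r : ℕ} (P : Measure Ω) (n : ℕ) (X : ℝ → Ω → Fin r → ℝ) : Prop :=
  ∃ Y : ℕ → ℝ → Ω → Fin r → ℝ, Y 0 = X ∧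
    (∀ j ≤ n, ∀ t, 0 ≤ t → MemLp (Y j t) 2 P) ∧
    ∀ j < n, IsMSDeriv P (Y j) (Y (j + 1))

/-- The matrix `E[X X*]`. -/
def secondMoment {d : ℕ} (P : Measure Ω) (X : Ω → Fin d → ℝ) : Matrix (Fin d) (Fin d) ℝ :=
  Matrix.of fun i j => ∫ ω, X ω i * X ω j ∂P

end Processes

/-! ### The generalized Langevin equation with constant coefficients -/

/-- Mass and constant coefficients. -/
structure Coeff (d q r k : ℕ) where
  m : ℝ
  γ₀ : Matrix (Fin d) (Fin d) ℝ
  σ₀ : Matrix (Fin d) (Fin k) ℝ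
  g : Matrix (Fin d) (Fin q) ℝ
  h : Matrix (Fin q) (Fin d) ℝ
  σ : Matrix (Fin d) (Fin r) ℝ
  m_pos : 0 < m

section Solution

variable {Ω : Type*} [MeasurableSpace Ω] {d q r k : ℕ}

/-- `v` solves
`m dv = -γ₀ v dt - g (∫₀ᵗ κ(t-s) h v(s) ds) dt + σ₀ dW + σ ξ dt`
on `[0, ∞)`, with `v(0)`, `ξ` and the Wiener process `W` pairwise independent. -/
structure IsSolution (G : Coeff d q r k) (κ : ℝ → Matrix (Fin q) (Fin q) ℝ) (P : Measure Ω)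
    (ξ : ℝ → Ω → Fin r → ℝ) (W : ℝ≥0 → Ω → Fin k → ℝ) (v : ℝ → Ω → Fin d → ℝ) : Prop where
  wiener : IsWiener P W
  aemeasurable : ∀ t, 0 ≤ t → AEMeasurable (v t) P
  indep_noise_wiener : IndepFun (path ξ) (fun ω t => W t ω) P
  indep_zero_noise : IndepFun (v 0) (path ξ) P
  indep_zero_wiener : IndepFun (v 0) (fun ω t => W t ω) P
  continuous : ∀ᵐ ω ∂P, ContinuousOn (fun t => v t ω) (Set.Ici 0)
  eq : ∀ᵐ ω ∂P, ∀ t : ℝ≥0,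
    G.m • v t ω = G.m • v 0 ω - (∫ s in (0 : ℝ)..t, G.γ₀ *ᵥ v s ω)
      - (∫ s in (0 : ℝ)..t, G.g *ᵥ (∫ u in (0 : ℝ)..s, κ (s - u) *ᵥ (G.h *ᵥ v u ω)))
      + G.σ₀ *ᵥ W t ω + (∫ s in (0 : ℝ)..t, G.σ *ᵥ ξ s ω)

/-- The position `x(t) = ∫₀ᵗ v(s) ds`. -/
def position (v : ℝ → Ω → Fin d → ℝ) (t : ℝ) (ω : Ω) : Fin d → ℝ := ∫ s in (0 : ℝ)..t, v s ω

/-- The initial average kinetic energy matrix `½ m E[v v*]`, `v = v(0)`. -/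
def kineticEnergy (G : Coeff d q r k) (P : Measure Ω) (v : ℝ → Ω → Fin d → ℝ) :
    Matrix (Fin d) (Fin d) ℝ :=
  (1 / 2 * G.m) • secondMoment P (v 0)

end Solution

section Response

variable {d q r k : ℕ}

/-- `m z I + γ₀ + g κ̂(z) h`. -/
def symbol (G : Coeff d q r k) (κ : ℝ → Matrix (Fin q) (Fin q) ℝ) (z : ℂ) :
    Matrix (Fin d) (Fin d) ℂ :=
  ((G.m : ℂ) * z) • (1 : Matrix (Fin d) (Fin d) ℂ) + toC G.γ₀ + toC G.g * laplace κ z * toC G.h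

/-- `F̂(z) = (z² (m z I + γ₀ + g κ̂(z) h))⁻¹`. -/
def Fhat (G : Coeff d q r k) (κ : ℝ → Matrix (Fin q) (Fin q) ℝ) (z : ℂ) :
    Matrix (Fin d) (Fin d) ℂ :=
  (z ^ 2 • symbol G κ z)⁻¹

/-- `H` is continuously differentiable on `[0, ∞)` and, on some right half-plane, its Laplace
transform converges and equals `z F̂(z)`. -/
def IsResponse (G : Coeff d q r k) (κ : ℝ → Matrix (Fin q) (Fin q) ℝ)
    (H : ℝ → Matrix (Fin d) (Fin d) ℝ) : Prop :=
  (∀ i j, ContDiffOn ℝ 1 (fun t => H t i j) (Set.Ici 0)) ∧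
  ∃ c : ℝ, 0 ≤ c ∧ ∀ z : ℂ, c < z.re →
    LaplaceConverges κ z ∧ IsUnit (symbol G κ z) ∧
    LaplaceConverges H z ∧ laplace H z = z • Fhat G κ z

/-- `2 ∫₀ᵗ H + 2m (H(t) 𝓔 H*(t) - ∫₀ᵗ H(u) Ḣ*(u) du) + ∫₀ᵗ H(u) (σ₀ σ₀* - 2 γ₀*) H*(u) du`. -/
def msdExpr (G : Coeff d q r k) (H : ℝ → Matrix (Fin d) (Fin d) ℝ)
    (KE : Matrix (Fin d) (Fin d) ℝ) (t : ℝ) : Matrix (Fin d) (Fin d) ℝ :=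
  (2 : ℝ) • matIntegral 0 t H
    + (2 * G.m) • (H t * KE * (H t)ᵀ - matIntegral 0 t fun u => H u * (matDeriv H u)ᵀ)
    + matIntegral 0 t fun u => H u * (G.σ₀ * G.σ₀ᵀ - (2 : ℝ) • G.γ₀ᵀ) * (H u)ᵀ

/-- The fluctuation-dissipation relations:
`γ₀ = σ₀ σ₀* / 2`, `g = h* = σ > 0`, and `R(t) = κ(t) = κ*(t)`. -/
structure FluctuationDissipation (D : Model d d) (G : Coeff d d d k) : Prop where
  damping : G.γ₀ = (1 / 2 : ℝ) • (G.σ₀ * G.σ₀ᵀ)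
  g_eq : G.g = G.σ
  h_eq : G.hᵀ = G.σ
  posDef : G.σ.PosDef
  cov_eq : ∀ t, D.R t = D.κ t
  symm : ∀ t, (D.κ t)ᵀ = D.κ t

end Response

end GLE

end

set_option linter.unusedSectionVars false

/-! ### The matrix exponential, entrywise -/

section MatrixExp

variable {ι : Type*} [Fintype ι] [DecidableEq ι]

/-! Noise. Let `T(ω) = C (Γ + iω)⁻¹ Σ` be the transfer function of a realization. The Lyapunov
equation, placed between a resolvent and its adjoint, says that the spectral density is `T(ω) T(ω)*`
(`fourier_cov`). Everything in (i) beyond boundedness is read off from `T`. Near `ω = 0` the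
resolvent is expanded in powers of `Γ⁻¹`. If the effective constants of odd order below `k` vanish,
the Lyapunov equation lets inverses of `Γ` pass through `M` up to sign and yields `C Γ⁻ᵃ Σ = 0` for
`1 ≤ a ≤ (k-1)/2` (`mul_inv_pow_mul_eq_zero`). Hence `T = O(ω^((k-1)/2))`, and the density is of
twice that order. Near infinity, a diagonal entry of the density is a sum of squares of entries of
`T`, so decay of the density gives decay of `T`, and this forces the Markov parameters `C Γᵃ Σ` to
vanish for `a < h - 1/2` (`mul_pow_mul_eq_zero_of_decay`). When `C Γᵃ Σ = 0`, no Wiener term enters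
the equation of `C Γᵃ β`, which is therefore the primitive of `-C Γᵃ⁺¹ β`; iteration gives the
mean-square derivatives.

Displacement. The memory kernel is `C e^{-Γt} M C*` with block-diagonal data, so the memory integral
is `C y` for an auxiliary variable with `y' = -Γ y + M C* h v`. The triple `(x, v, y)` solves a
linear equation with constant generator and additive forcing. Variation of constants gives `x(t) = m
H(t) v(0) + ∫ H(t-s) σ₀ dW + ∫ H(t-s) σ ξ ds`, where `m H` is the position-velocity block of the
exponential of the generator (`IsSolution.eq_apply`). Since `H` is smooth, the stochastic integral
is defined by integration by parts, and its isometry uses only `E[W_s W_r] = min(s, r)`. The three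
terms are mutually orthogonal. The noise term yields a double integral against `R(u - s)`; it is
split along the diagonal, and the Volterra equation `m H' + H γ₀ + H ∗ (g κ h) = I` evaluates each
inner integral (`memory_double_integral`). The two triangles are transposes of each other, whence
the symmetrization of `A(t)`. Injectivity of the Laplace transform shows that every admissible `H`
is this one.

Growth. For the system without noise the energy `m|v|² + y·M⁻¹y` is nonincreasing, because the
coupling terms cancel when `h = g*`. Hence `H'` is bounded, `H = O(t)`, and the formula for `A(t)`
gives `O(t²)`. If `α₁ = 1`, the static friction `K = C Γ⁻¹ M C*` equals `K₁⁽¹⁾`; it is symmetric,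
positive semidefinite and invertible, so `γ₀ + g K g*` is invertible. Then a velocity impulse is, up
to a shift of position, the image of some vector under the generator, so `H` itself is a velocity up
to a constant, hence bounded (`exists_abs_response_le`), and the displacement is `O(t)`. -/

lemma hasDerivAt_exp_smul_apply (B : Matrix ι ι ℝ) (t : ℝ) (i j : ι) :
    HasDerivAt (fun s : ℝ => NormedSpace.exp (s • B) i j) ((NormedSpace.exp (t • B) * B) i j) t := by
  let _ := Matrix.linftyOpNormedRing (n := ι) (α := ℝ)
  let _ := Matrix.linftyOpNormedAlgebra (n := ι) (R := ℝ) (α := ℝ)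
  have h := hasDerivAt_exp_smul_const (𝕂 := ℝ) B t
  have L : Matrix ι ι ℝ →L[ℝ] ℝ := LinearMap.toContinuousLinearMap (Matrix.entryLinearMap ℝ ℝ i j)
  exact (LinearMap.toContinuousLinearMap (Matrix.entryLinearMap ℝ ℝ i j)).hasFDerivAt.comp_hasDerivAt t h

lemma hasDerivAt_exp_smul_apply' (B : Matrix ι ι ℝ) (t : ℝ) (i j : ι) :
    HasDerivAt (fun s : ℝ => NormedSpace.exp (s • B) i j) ((B * NormedSpace.exp (t • B)) i j) t := by
  let _ := Matrix.linftyOpNormedRing (n := ι) (α := ℝ)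
  let _ := Matrix.linftyOpNormedAlgebra (n := ι) (R := ℝ) (α := ℝ)
  have h := hasDerivAt_exp_smul_const' (𝕂 := ℝ) B t
  exact (LinearMap.toContinuousLinearMap (Matrix.entryLinearMap ℝ ℝ i j)).hasFDerivAt.comp_hasDerivAt t h

lemma exp_add_smul (B : Matrix ι ι ℝ) (s t : ℝ) :
    NormedSpace.exp ((s + t) • B) = NormedSpace.exp (s • B) * NormedSpace.exp (t • B) := by
  rw [add_smul]
  exact Matrix.exp_add_of_commute _ _ (((Commute.refl B).smul_left s).smul_right t)

lemma continuous_exp_smul_apply (B : Matrix ι ι ℝ) (i j : ι) :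
    Continuous fun s : ℝ => NormedSpace.exp (s • B) i j :=
  continuous_iff_continuousAt.2 fun t => (hasDerivAt_exp_smul_apply B t i j).continuousAt

lemma exp_mulVec_of_eigenvector (A : Matrix ι ι ℂ) (x : ι → ℂ) (l : ℂ) (h : A *ᵥ x = l • x) :
    NormedSpace.exp A *ᵥ x = Complex.exp l • x := by
  let _ := Matrix.linftyOpNormedRing (n := ι) (α := ℂ)
  let _ := Matrix.linftyOpNormedAlgebra (n := ι) (R := ℂ) (α := ℂ)
  have hp : ∀ n : ℕ, (A ^ n) *ᵥ x = l ^ n • x := by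
    intro n
    induction n with
    | zero => simp
    | succ n ih => rw [pow_succ, ← Matrix.mulVec_mulVec, h, Matrix.mulVec_smul, ih, smul_smul, pow_succ, mul_comm]
  have h1 := NormedSpace.exp_series_hasSum_exp' (𝕂 := ℂ) A
  have h2 := NormedSpace.exp_series_hasSum_exp' (𝕂 := ℂ) l
  let L : Matrix ι ι ℂ →L[ℂ] (ι → ℂ) :=
    LinearMap.toContinuousLinearMap ((Matrix.mulVecBilin ℂ ℂ).flip x)
  have h3 := h1.mapL L
  have h4 := h2.smul_const x
  have h5 : (fun n : ℕ => L ((n.factorial⁻¹ : ℂ) • A ^ n)) = fun n : ℕ => ((n.factorial⁻¹ : ℂ) • l ^ n) • x := by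
    funext n
    change ((n.factorial⁻¹ : ℂ) • A ^ n) *ᵥ x = _
    rw [Matrix.smul_mulVec, hp, smul_assoc]
  rw [h5] at h3
  rw [Complex.exp_eq_exp_ℂ]
  exact h3.unique h4

/-- Half of the spectral mapping theorem: an eigenspace of `e^A` is invariant under `A`, which
commutes with `e^A`, so it contains an eigenvector of `A`. -/
lemma spectrum_exp_subset (A : Matrix ι ι ℂ) (μ : ℂ) (hμ : μ ∈ spectrum ℂ (NormedSpace.exp A)) :
    ∃ l ∈ spectrum ℂ A, μ = Complex.exp l := by
  let f : Module.End ℂ (ι → ℂ) := Matrix.toLin' (NormedSpace.exp A)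
  let g : Module.End ℂ (ι → ℂ) := Matrix.toLin' A
  have hf : f.HasEigenvalue μ := by
    rw [Module.End.hasEigenvalue_iff_mem_spectrum]
    have : spectrum ℂ f = spectrum ℂ (NormedSpace.exp A) := Matrix.spectrum_toLin' _
    rwa [this]
  have hc : Commute (NormedSpace.exp A) A := by
    let _ := Matrix.linftyOpNormedRing (n := ι) (α := ℂ)
    let _ := Matrix.linftyOpNormedAlgebra (n := ι) (R := ℂ) (α := ℂ)
    exact (Commute.refl A).exp_left
  have hfg : Commute f g := by
    change f * g = g * f
    have := congrArg Matrix.toLin' hc.eq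
    rwa [Matrix.toLin'_mul, Matrix.toLin'_mul] at this
  have hm : ∀ x ∈ f.eigenspace μ, g x ∈ f.eigenspace μ :=
    Module.End.mapsTo_genEigenspace_of_comm hfg μ 1
  have : Nontrivial (f.eigenspace μ) := Submodule.nontrivial_iff_ne_bot.2 hf
  obtain ⟨l, hl⟩ := Module.End.exists_eigenvalue (g.restrict hm)
  obtain ⟨x, hx⟩ := hl.exists_hasEigenvector
  have hx1 : g x.1 = l • x.1 := congrArg Subtype.val hx.apply_eq_smul
  have hx0 : x.1 ≠ 0 := fun h => hx.2 (Subtype.ext h)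
  refine ⟨l, ?_, ?_⟩
  · rw [← Matrix.spectrum_toLin' A, ← Module.End.hasEigenvalue_iff_mem_spectrum]
    exact Module.End.hasEigenvalue_of_hasEigenvector ⟨Module.End.mem_eigenspace_iff.2 hx1, hx0⟩
  · have h1 := exp_mulVec_of_eigenvector A x.1 l hx1
    have h2 : NormedSpace.exp A *ᵥ x.1 = μ • x.1 := Module.End.mem_eigenspace_iff.1 x.2
    rw [h2] at h1
    exact smul_left_injective ℂ hx0 h1

lemma exp_map_ofReal (B : Matrix ι ι ℝ) :
    (NormedSpace.exp B).map (algebraMap ℝ ℂ) = NormedSpace.exp (B.map (algebraMap ℝ ℂ)) := by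
  let _ := Matrix.linftyOpNormedRing (n := ι) (α := ℂ)
  let _ := Matrix.linftyOpNormedAlgebra (n := ι) (R := ℂ) (α := ℂ)
  let _ := Matrix.linftyOpNormedRing (n := ι) (α := ℝ)
  let _ := Matrix.linftyOpNormedAlgebra (n := ι) (R := ℝ) (α := ℝ)
  let _ := NormedAlgebra.restrictScalars ℚ ℝ (Matrix ι ι ℝ)
  exact NormedSpace.map_exp ((algebraMap ℝ ℂ).mapMatrix) (Continuous.matrix_map continuous_id Complex.continuous_ofReal) B

/-- Exponential growth bound for `e^{tB}` by any `c` exceeding the spectral abscissa. -/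
lemma exists_abs_exp_smul_apply_le (B : Matrix ι ι ℝ) (c : ℝ)
    (hc : ∀ μ ∈ spectrum ℂ (B.map (algebraMap ℝ ℂ)), μ.re < c) :
    ∃ K : ℝ, ∀ t, 0 ≤ t → ∀ i j, |NormedSpace.exp (t • B) i j| ≤ K * Real.exp (c * t) := by
  cases isEmpty_or_nonempty ι with
  | inl h => exact ⟨0, fun t _ i => h.elim i⟩
  | inr h => ?_
  let _ := Matrix.linftyOpNormedRing (n := ι) (α := ℂ)
  let _ := Matrix.linftyOpNormedAlgebra (n := ι) (R := ℂ) (α := ℂ)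
  set a := NormedSpace.exp (B.map (algebraMap ℝ ℂ)) with ha
  -- Every eigenvalue of `a` is `e^l` with `Re l < c`; Gelfand's formula then gives `‖aⁿ‖ ≤ e^{cn}`
  -- for large `n`.
  have hr : spectralRadius ℂ a < (Real.toNNReal (Real.exp c) : NNReal) := by
    refine spectrum.spectralRadius_lt_of_forall_lt a fun μ hμ => ?_
    obtain ⟨l, hl, rfl⟩ := spectrum_exp_subset _ _ hμ
    rw [← NNReal.coe_lt_coe, coe_nnnorm, Complex.norm_exp, Real.coe_toNNReal _ (Real.exp_pos c).le]
    exact Real.exp_lt_exp.2 (hc l hl)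
  have h1 := spectrum.pow_nnnorm_pow_one_div_tendsto_nhds_spectralRadius a
  have h2 : ∀ᶠ n : ℕ in atTop, ‖a ^ n‖ ≤ Real.exp (c * n) := by
    filter_upwards [h1.eventually_lt_const hr, eventually_gt_atTop 0] with n hn hn0
    have hn' : (n : ℝ) ≠ 0 := by positivity
    have h3 := ENNReal.rpow_lt_rpow hn (show (0 : ℝ) < n by positivity)
    rw [← ENNReal.rpow_mul, one_div, inv_mul_cancel₀ hn', ENNReal.rpow_one, ENNReal.rpow_natCast] at h3
    have h4 : ‖a ^ n‖₊ < (Real.toNNReal (Real.exp c)) ^ n := by exact_mod_cast h3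
    rw [← NNReal.coe_lt_coe] at h4
    push_cast at h4
    rw [Real.coe_toNNReal _ (Real.exp_pos c).le, ← Real.exp_nat_mul, mul_comm] at h4
    exact h4.le
  obtain ⟨n₀, hn₀⟩ := eventually_atTop.1 h2
  obtain ⟨K, hK0, hK⟩ : ∃ K : ℝ, 0 ≤ K ∧ ∀ n : ℕ, ‖a ^ n‖ ≤ K * Real.exp (c * n) := by
    -- The finitely many exponents below `n₀` are absorbed into the constant.
    refine ⟨1 + ∑ n ∈ Finset.range n₀, ‖a ^ n‖ / Real.exp (c * n), by positivity, fun n => ?_⟩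
    rcases lt_or_ge n n₀ with h | h
    · have := Finset.single_le_sum (f := fun n : ℕ => ‖a ^ n‖ / Real.exp (c * n)) (fun i _ => by positivity) (Finset.mem_range.2 h)
      rw [← div_le_iff₀ (Real.exp_pos _)]
      linarith
    · have h5 : 0 ≤ ∑ n ∈ Finset.range n₀, ‖a ^ n‖ / Real.exp (c * n) := by positivity
      nlinarith [hn₀ n h, Real.exp_pos (c * n)]
  have hentry : ∀ (n : ℕ) (i j : ι), |NormedSpace.exp ((n : ℝ) • B) i j| ≤ K * Real.exp (c * n) := by
    intro n i j
    refine le_trans ?_ (hK n)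
    have h6 : (a ^ n) i j = ((NormedSpace.exp ((n : ℝ) • B) i j : ℝ) : ℂ) := by
      rw [ha, ← Matrix.exp_nsmul, Nat.cast_smul_eq_nsmul ℝ]
      have : n • B.map (algebraMap ℝ ℂ) = (n • B).map (algebraMap ℝ ℂ) := by
        ext; simp [Matrix.smul_apply, -nsmul_eq_mul]; simp
      rw [this, ← exp_map_ofReal]
      rfl
    have h7 : ‖(a ^ n) i j‖ ≤ ‖a ^ n‖ := by
      rw [Matrix.linfty_opNorm_def, ← coe_nnnorm, NNReal.coe_le_coe]
      exact (Finset.single_le_sum (f := fun j => ‖(a ^ n) i j‖₊) (fun _ _ => zero_le) (Finset.mem_univ j)).trans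
        (Finset.le_sup (f := fun i => ∑ j, ‖(a ^ n) i j‖₊) (Finset.mem_univ i))
    rwa [h6, Complex.norm_real] at h7
  obtain ⟨M, hM⟩ : ∃ M : ℝ, ∀ s ∈ Set.Icc (0 : ℝ) 1, ∀ i j, |NormedSpace.exp (s • B) i j| ≤ M := by
    have h8 : ∀ p : ι × ι, ∃ M : ℝ, ∀ s ∈ Set.Icc (0 : ℝ) 1, |NormedSpace.exp (s • B) p.1 p.2| ≤ M := fun p =>
      isCompact_Icc.exists_bound_of_continuousOn (continuous_exp_smul_apply B p.1 p.2).continuousOn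
    choose M hM using h8
    exact ⟨∑ p, |M p|, fun s hs i j => ((hM (i, j) s hs).trans (le_abs_self _)).trans
      (Finset.single_le_sum (f := fun p => |M p|) (fun _ _ => abs_nonneg _) (Finset.mem_univ (i, j)))⟩
  -- Split `t` into its integer and fractional parts: the powers of `a` control the first,
  -- compactness of `[0, 1]` the second. The factor `e^{|c|}` replaces `e^{cn}` by `e^{ct}` whatever
  -- the sign of `c`, and the cardinality counts the terms of the matrix product.
  refine ⟨Fintype.card ι * (K * Real.exp |c| * M), fun t ht i j => ?_⟩
  have hM0 : 0 ≤ M := (abs_nonneg _).trans (hM 0 (by simp) i j)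
  set n := ⌊t⌋₊
  have hn1 : (n : ℝ) ≤ t := Nat.floor_le ht
  have hn2 : t < n + 1 := Nat.lt_floor_add_one t
  have ht' : t = n + (t - n) := by ring
  have h9 : Real.exp (c * n) ≤ Real.exp |c| * Real.exp (c * t) := by
    rw [← Real.exp_add]
    apply Real.exp_le_exp.2
    nlinarith [abs_nonneg c, neg_abs_le c, le_abs_self c]
  conv_lhs => rw [ht', exp_add_smul, Matrix.mul_apply]
  refine (Finset.abs_sum_le_sum_abs _ _).trans ?_
  calc ∑ k, |NormedSpace.exp ((n : ℝ) • B) i k * NormedSpace.exp ((t - n) • B) k j|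
      ≤ ∑ k : ι, (K * Real.exp |c| * M) * Real.exp (c * t) := by
        refine Finset.sum_le_sum fun k _ => ?_
        rw [abs_mul]
        calc _ ≤ (K * Real.exp (c * n)) * M := by
              gcongr
              · exact hentry n i k
              · exact hM _ ⟨by linarith, by linarith⟩ _ _
          _ ≤ (K * (Real.exp |c| * Real.exp (c * t))) * M := by gcongr
          _ = _ := by ring
    _ = _ := by simp; ring

lemma exists_abs_exp_smul_apply_le_of_large (B : Matrix ι ι ℝ) :
    ∃ c K : ℝ, 0 ≤ c ∧ ∀ t, 0 ≤ t → ∀ i j, |NormedSpace.exp (t • B) i j| ≤ K * Real.exp (c * t) := by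
  have hfin : (spectrum ℂ (B.map (algebraMap ℝ ℂ))).Finite := Matrix.finite_spectrum _
  obtain ⟨c, hc⟩ := (hfin.image Complex.re).bddAbove
  obtain ⟨K, hK⟩ := exists_abs_exp_smul_apply_le B (|c| + 1) fun μ hμ => by
    have := hc (Set.mem_image_of_mem _ hμ)
    linarith [le_abs_self c]
  exact ⟨|c| + 1, K, by positivity, hK⟩

/-- The spectrum is finite, so its real parts stay above half of the smallest one, which leaves room
for a strict inequality with a negative rate. -/
lemma exists_abs_exp_neg_smul_apply_le (Γ : Matrix ι ι ℝ)
    (h : ∀ μ ∈ spectrum ℂ (Γ.map (algebraMap ℝ ℂ)), 0 < μ.re) :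
    ∃ c K : ℝ, c < 0 ∧ ∀ t, 0 ≤ t → ∀ i j, |NormedSpace.exp (t • -Γ) i j| ≤ K * Real.exp (c * t) := by
  have hfin : (spectrum ℂ (Γ.map (algebraMap ℝ ℂ))).Finite := Matrix.finite_spectrum _
  obtain ⟨c, hc0, hc⟩ : ∃ c : ℝ, 0 < c ∧ ∀ μ ∈ spectrum ℂ (Γ.map (algebraMap ℝ ℂ)), c < μ.re := by
    rcases (spectrum ℂ (Γ.map (algebraMap ℝ ℂ))).eq_empty_or_nonempty with he | hne
    · exact ⟨1, one_pos, fun μ hμ => absurd (he ▸ hμ) (Set.notMem_empty _)⟩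
    · obtain ⟨μ₀, h0, hmin⟩ := hfin.exists_minimalFor Complex.re _ hne
      refine ⟨μ₀.re / 2, by linarith [h _ h0], fun μ hμ => ?_⟩
      have h1 := h _ h0
      rcases le_total μ.re μ₀.re with h2 | h2
      · linarith [hmin hμ h2]
      · linarith
  obtain ⟨K, hK⟩ := exists_abs_exp_smul_apply_le (-Γ) (-c) fun μ hμ => by
    have h1 : (-Γ).map (algebraMap ℝ ℂ) = -(Γ.map (algebraMap ℝ ℂ)) := by ext; simp
    rw [h1, ← spectrum.neg_eq, Set.mem_neg] at hμ
    have := hc _ hμ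
    simp at this
    linarith
  exact ⟨-c, K, by linarith, hK⟩

/-- The Laplace transform of `e^{tB}` is `(z - B)⁻¹`. -/
lemma laplace_exp_mul (B : Matrix ι ι ℝ) (c K : ℝ)
    (hK : ∀ t, 0 ≤ t → ∀ i j, |NormedSpace.exp (t • B) i j| ≤ K * Real.exp (c * t))
    (z : ℂ) (hz : c < z.re) :
    (∀ i j, IntegrableOn (fun t : ℝ => (NormedSpace.exp (t • B) i j : ℂ) * Complex.exp (-(z * t))) (Set.Ioi 0)) ∧
    (Matrix.of fun i j => ∫ t in Set.Ioi (0 : ℝ), (NormedSpace.exp (t • B) i j : ℂ) * Complex.exp (-(z * t)))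
      * (z • 1 - B.map (algebraMap ℝ ℂ)) = 1 := by
  have hcont : ∀ i j, Continuous (fun t : ℝ => (NormedSpace.exp (t • B) i j : ℂ) * Complex.exp (-(z * t))) := fun i j =>
    (Complex.continuous_ofReal.comp (continuous_exp_smul_apply B i j)).mul (by fun_prop)
  have hbd : ∀ i j, ∀ t : ℝ, 0 ≤ t → ‖(NormedSpace.exp (t • B) i j : ℂ) * Complex.exp (-(z * t))‖ ≤ K * Real.exp (-(z.re - c) * t) := by
    intro i j t ht
    rw [norm_mul, Complex.norm_real, Complex.norm_exp]
    have : (-(z * t)).re = -(z.re * t) := by simp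
    rw [this]
    calc _ ≤ K * Real.exp (c * t) * Real.exp (-(z.re * t)) := by gcongr; exact hK t ht i j
      _ = _ := by rw [mul_assoc, ← Real.exp_add]; congr 2; ring
  have hexp : IntegrableOn (fun t => K * Real.exp (-(z.re - c) * t)) (Set.Ioi 0) :=
    (exp_neg_integrableOn_Ioi 0 (by linarith)).const_mul K
  have hint : ∀ i j, IntegrableOn (fun t : ℝ => (NormedSpace.exp (t • B) i j : ℂ) * Complex.exp (-(z * t))) (Set.Ioi 0) := by
    intro i j
    refine Integrable.mono' hexp (hcont i j).aestronglyMeasurable ?_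
    filter_upwards [ae_restrict_mem measurableSet_Ioi] with t ht using hbd i j t (le_of_lt ht)
  refine ⟨hint, ?_⟩
  ext i k
  -- The derivative of `e^{tB} e^{-zt}` is `-e^{tB} e^{-zt} (z - B)`; integrating it over the
  -- half-line leaves only the value `1` at `t = 0`.
  have hderiv : ∀ t : ℝ, HasDerivAt (fun t : ℝ => (NormedSpace.exp (t • B) i k : ℂ) * Complex.exp (-(z * t)))
      (∑ j, -((NormedSpace.exp (t • B) i j : ℂ) * Complex.exp (-(z * t)) * (z • (1 : Matrix ι ι ℂ) - B.map (algebraMap ℝ ℂ)) j k)) t := by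
    intro t
    have h1 := (hasDerivAt_exp_smul_apply B t i k).ofReal_comp
    have h2 : HasDerivAt (fun t : ℝ => Complex.exp (-(z * t))) (Complex.exp (-(z * t)) * (-z)) t := by
      have h3 : HasDerivAt (fun t : ℝ => -(z * (t : ℂ))) (-z) t := by
        simpa using ((hasDerivAt_id t).ofReal_comp.const_mul z).fun_neg
      exact h3.cexp
    refine (h1.fun_mul h2).congr_deriv ?_
    have h4 : (((NormedSpace.exp (t • B) * B) i k : ℝ) : ℂ)
        = ∑ j, (NormedSpace.exp (t • B) i j : ℂ) * (B j k : ℂ) := by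
      rw [Matrix.mul_apply]; push_cast; rfl
    have h5 : ∑ j, (NormedSpace.exp (t • B) i j : ℂ) * (1 : Matrix ι ι ℂ) j k = (NormedSpace.exp (t • B) i k : ℂ) := by
      simp [Matrix.one_apply]
    rw [h4, ← h5, Finset.sum_mul, Finset.sum_mul, ← Finset.sum_add_distrib]
    refine Finset.sum_congr rfl fun j _ => ?_
    simp only [Matrix.sub_apply, Matrix.smul_apply, Matrix.map_apply, smul_eq_mul, Complex.coe_algebraMap]
    ring
  have hlim : Tendsto (fun t : ℝ => (NormedSpace.exp (t • B) i k : ℂ) * Complex.exp (-(z * t))) atTop (𝓝 0) := by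
    refine squeeze_zero_norm' (a := fun t => K * Real.exp (-(z.re - c) * t)) ?_ ?_
    · filter_upwards [eventually_ge_atTop 0] with t ht using hbd i k t ht
    · rw [← mul_zero K]
      refine Tendsto.const_mul K (Real.tendsto_exp_atBot.comp ?_)
      exact tendsto_id.const_mul_atTop_of_neg (by linarith)
  have hI : ∀ j ∈ Finset.univ, IntegrableOn (fun t : ℝ => -((NormedSpace.exp (t • B) i j : ℂ) * Complex.exp (-(z * t)) * (z • (1 : Matrix ι ι ℂ) - B.map (algebraMap ℝ ℂ)) j k)) (Set.Ioi 0) :=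
    fun j _ => ((hint i j).mul_const _).neg
  have hftc := integral_Ioi_of_hasDerivAt_of_tendsto' (a := 0) (fun t _ => hderiv t) (integrable_finsetSum _ hI) hlim
  rw [integral_finsetSum _ hI] at hftc
  simp_rw [integral_neg, integral_mul_const] at hftc
  rw [Finset.sum_neg_distrib] at hftc
  rw [Matrix.mul_apply]
  have h0 : (NormedSpace.exp ((0 : ℝ) • B) i k : ℂ) = (1 : Matrix ι ι ℂ) i k := by
    rw [zero_smul, NormedSpace.exp_zero, Matrix.one_apply, Matrix.one_apply]; split_ifs <;> simp
  rw [h0] at hftc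
  simp only [Matrix.of_apply]
  simpa using hftc

end MatrixExp

/-! ### Spectral densities -/

namespace GLE

section toC

variable {n p q : ℕ}

@[simp] lemma toC_apply (A : Matrix (Fin n) (Fin p) ℝ) (i j) : toC A i j = (A i j : ℂ) := rfl

lemma toC_mul (A : Matrix (Fin n) (Fin p) ℝ) (B : Matrix (Fin p) (Fin q) ℝ) :
    toC (A * B) = toC A * toC B := Matrix.map_mul

lemma toC_transpose (A : Matrix (Fin n) (Fin p) ℝ) : toC Aᵀ = (toC A)ᵀ := rfl

lemma toC_conjTranspose (A : Matrix (Fin n) (Fin p) ℝ) : (toC A)ᴴ = (toC A)ᵀ := by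
  ext i j; simp [Matrix.conjTranspose_apply]

lemma toC_one : toC (1 : Matrix (Fin n) (Fin n) ℝ) = 1 := by
  ext i j; simp [Matrix.one_apply]; split_ifs <;> simp

lemma toC_add (A B : Matrix (Fin n) (Fin p) ℝ) : toC (A + B) = toC A + toC B := by
  ext i j; simp

lemma toC_zero : toC (0 : Matrix (Fin n) (Fin p) ℝ) = 0 := by
  ext i j; simp

lemma toC_injective : Function.Injective (toC : Matrix (Fin n) (Fin p) ℝ → _) := fun A B h => by
  ext i j
  have := congrFun (congrFun h i) j
  simpa using this

end toC

/-- The oscillating factor has modulus one, so the `L¹` norm bounds the transform uniformly in `ω`.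
If the entry is not integrable, both integrals take the default value `0` and the bound persists. -/
lemma fourierMat_isBigO_one {p q : ℕ} (F : ℝ → Matrix (Fin p) (Fin q) ℝ) (i j) (l : Filter ℝ) :
    (fun w : ℝ => fourierMat F w i j) =O[l] (fun _ => (1 : ℝ)) := by
  refine IsBigO.of_bound (∫ t, ‖(F t i j : ℂ)‖) (Eventually.of_forall fun w => ?_)
  rw [norm_one, mul_one]
  refine (norm_integral_le_integral_norm _).trans_eq ?_
  refine integral_congr_ae (Eventually.of_forall fun t => ?_)
  simp [Complex.norm_exp]

/-! ### Transfer functions and factorization of the spectral density -/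

namespace Realization

variable {n p r : ℕ} (A : Realization n p r)

/-- `∫₀^∞ e^{-Γt} e^{-iωt} dt`. -/
noncomputable def resolv (w : ℝ) : Matrix (Fin n) (Fin n) ℂ :=
  Matrix.of fun i j => ∫ t in Set.Ioi (0 : ℝ),
    (NormedSpace.exp (t • -A.Γ) i j : ℂ) * Complex.exp (-(Complex.I * w * t))

/-- The transfer function `C (Γ + iω)⁻¹ Σ`. -/
noncomputable def transfer (w : ℝ) : Matrix (Fin r) (Fin p) ℂ :=
  toC A.C * A.resolv w * toC A.S

variable {A}

lemma Admissible.integrableOn_exp (h : A.Admissible) (w : ℝ) (i j) :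
    IntegrableOn (fun t : ℝ => (NormedSpace.exp (t • -A.Γ) i j : ℂ) *
      Complex.exp (-(Complex.I * w * t))) (Set.Ioi 0) := by
  obtain ⟨c, K, hc, hK⟩ := exists_abs_exp_neg_smul_apply_le A.Γ h.posStable
  exact (laplace_exp_mul (-A.Γ) c K hK (Complex.I * w) (by simpa using hc)).1 i j

lemma Admissible.resolv_mul (h : A.Admissible) (w : ℝ) :
    A.resolv w * ((Complex.I * w) • 1 + toC A.Γ) = 1 := by
  obtain ⟨c, K, hc, hK⟩ := exists_abs_exp_neg_smul_apply_le A.Γ h.posStable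
  have h1 := (laplace_exp_mul (-A.Γ) c K hK (Complex.I * w) (by simpa using hc)).2
  have h2 : (-A.Γ).map (algebraMap ℝ ℂ) = -toC A.Γ := by ext; simp
  rw [h2, sub_neg_eq_add] at h1
  exact h1

lemma Admissible.mul_resolv (h : A.Admissible) (w : ℝ) :
    ((Complex.I * w) • 1 + toC A.Γ) * A.resolv w = 1 :=
  mul_eq_one_comm.1 (h.resolv_mul w)

/-- At `ω = 0` the resolvent identity reads `Γ ∫₀^∞ e^{-Γt} dt = 1`. -/
lemma Admissible.isUnit_det (h : A.Admissible) : IsUnit A.Γ.det := by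
  have h1 := h.mul_resolv 0
  simp only [Complex.ofReal_zero, mul_zero, zero_smul, zero_add] at h1
  have h2 : IsUnit (toC A.Γ) := IsUnit.of_mul_eq_one _ h1
  rw [Matrix.isUnit_iff_isUnit_det] at h2
  have h3 : (toC A.Γ).det = (A.Γ.det : ℂ) := ((algebraMap ℝ ℂ).map_det A.Γ).symm
  rw [h3] at h2
  simpa using h2

lemma exists_norm_resolv_le (A : Realization n p r) : ∃ K, 0 ≤ K ∧ ∀ w i j, ‖A.resolv w i j‖ ≤ K := by
  have h0 : ∀ i j, 0 ≤ ∫ t in Set.Ioi (0 : ℝ), ‖(NormedSpace.exp (t • -A.Γ) i j : ℂ)‖ := fun i j =>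
    integral_nonneg fun t => norm_nonneg _
  refine ⟨∑ i, ∑ j, ∫ t in Set.Ioi (0 : ℝ), ‖(NormedSpace.exp (t • -A.Γ) i j : ℂ)‖, Finset.sum_nonneg fun i _ => Finset.sum_nonneg fun j _ => h0 i j,
    fun w i j => ?_⟩
  refine le_trans ?_ (Finset.single_le_sum (f := fun i => ∑ j, ∫ t in Set.Ioi (0 : ℝ), ‖(NormedSpace.exp (t • -A.Γ) i j : ℂ)‖)
    (fun i _ => Finset.sum_nonneg fun j _ => h0 i j) (Finset.mem_univ i))
  refine le_trans ?_ (Finset.single_le_sum (f := fun j => ∫ t in Set.Ioi (0 : ℝ), ‖(NormedSpace.exp (t • -A.Γ) i j : ℂ)‖)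
    (fun j _ => h0 i j) (Finset.mem_univ j))
  refine (norm_integral_le_integral_norm _).trans_eq ?_
  refine integral_congr_ae (Eventually.of_forall fun t => ?_)
  simp [Complex.norm_exp]

lemma norm_mul_resolv_mul_le (A : Realization n p r) {a b : ℕ} (X : Matrix (Fin a) (Fin n) ℂ)
    (Y : Matrix (Fin n) (Fin b) ℂ) : ∃ K, 0 ≤ K ∧ ∀ w i j, ‖(X * A.resolv w * Y) i j‖ ≤ K := by
  obtain ⟨K, hK0, hK⟩ := A.exists_norm_resolv_le
  refine ⟨∑ i, ∑ j, ∑ l, ∑ k, ‖X i k‖ * K * ‖Y l j‖, by positivity, fun w i j => ?_⟩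
  have h1 : ‖(X * A.resolv w * Y) i j‖ ≤ ∑ l, ∑ k, ‖X i k‖ * K * ‖Y l j‖ := by
    simp only [Matrix.mul_apply]
    refine (norm_sum_le _ _).trans (Finset.sum_le_sum fun l _ => ?_)
    rw [norm_mul, ← Finset.sum_mul]
    gcongr
    refine (norm_sum_le _ _).trans (Finset.sum_le_sum fun k _ => ?_)
    rw [norm_mul]
    gcongr
    exact hK w k l
  refine h1.trans ?_
  refine le_trans ?_ (Finset.single_le_sum (f := fun i => ∑ j, ∑ l, ∑ k, ‖X i k‖ * K * ‖Y l j‖) (fun i _ => by positivity) (Finset.mem_univ i))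
  exact Finset.single_le_sum (f := fun j => ∑ l, ∑ k, ‖X i k‖ * K * ‖Y l j‖) (fun i _ => by positivity) (Finset.mem_univ j)

lemma kernel_of_nonneg (A : Realization n p r) {t : ℝ} (ht : 0 ≤ t) :
    A.kernel t = A.C * NormedSpace.exp (t • -A.Γ) * A.M * A.Cᵀ := by
  rw [kernel, abs_of_nonneg ht, smul_neg]

lemma kernel_neg (A : Realization n p r) (t : ℝ) : A.kernel (-t) = A.kernel t := by
  simp [kernel]

lemma fourier_kernel (h : A.Admissible) (w : ℝ) (i j) :
    IntegrableOn (fun t : ℝ => (A.kernel t i j : ℂ) * Complex.exp (-(Complex.I * w * t))) (Set.Ioi 0) ∧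
    ∫ t in Set.Ioi (0 : ℝ), (A.kernel t i j : ℂ) * Complex.exp (-(Complex.I * w * t))
      = (toC A.C * A.resolv w * toC (A.M * A.Cᵀ)) i j := by
  have h1 : ∀ t : ℝ, 0 ≤ t → (A.kernel t i j : ℂ) * Complex.exp (-(Complex.I * w * t)) =
      ∑ l, ∑ k, (A.C i k : ℂ) * ((NormedSpace.exp (t • -A.Γ) k l : ℂ) * Complex.exp (-(Complex.I * w * t))) * ((A.M * A.Cᵀ) l j : ℂ) := by
    intro t ht
    rw [A.kernel_of_nonneg ht, Matrix.mul_assoc, Matrix.mul_apply]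
    push_cast [Matrix.mul_apply (M := A.C)]
    simp only [Finset.sum_mul]
    refine Finset.sum_congr rfl fun l _ => Finset.sum_congr rfl fun k _ => ?_
    ring
  have h2 : ∀ l k, IntegrableOn (fun t : ℝ => (A.C i k : ℂ) * ((NormedSpace.exp (t • -A.Γ) k l : ℂ) * Complex.exp (-(Complex.I * w * t))) * ((A.M * A.Cᵀ) l j : ℂ)) (Set.Ioi 0) :=
    fun l k => ((h.integrableOn_exp w k l).const_mul _).mul_const _
  have h3 : ∀ᵐ t ∂(volume.restrict (Set.Ioi (0:ℝ))), (A.kernel t i j : ℂ) * Complex.exp (-(Complex.I * w * t)) =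
      ∑ l, ∑ k, (A.C i k : ℂ) * ((NormedSpace.exp (t • -A.Γ) k l : ℂ) * Complex.exp (-(Complex.I * w * t))) * ((A.M * A.Cᵀ) l j : ℂ) := by
    filter_upwards [ae_restrict_mem measurableSet_Ioi] with t ht using h1 t (le_of_lt ht)
  constructor
  · exact (integrable_finsetSum _ fun l _ => integrable_finsetSum _ fun k _ => h2 l k).congr (h3.mono fun t ht => ht.symm)
  · rw [integral_congr_ae h3, integral_finsetSum _ fun l _ => integrable_finsetSum _ fun k _ => h2 l k,
      Matrix.mul_apply]
    refine Finset.sum_congr rfl fun l _ => ?_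
    rw [integral_finsetSum _ fun k _ => h2 l k, Matrix.mul_apply (M := toC A.C), Finset.sum_mul]
    refine Finset.sum_congr rfl fun k _ => ?_
    rw [integral_mul_const, integral_const_mul]
    rfl

/-- The positive half-line contributes `C Φ M C*` with `Φ = (Γ + iω)⁻¹`, the negative one its
adjoint. Since `ΓM + MΓ* = (Γ + iω)M + M(Γ* - iω)`, the Lyapunov equation gives `ΦM + MΦ* = Φ Σ Σ*
Φ*`. -/
lemma Admissible.fourier_cov (h : A.Admissible) (w : ℝ) :
    fourierMat A.cov w = A.transfer w * (A.transfer w)ᴴ := by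
  set X := toC A.C * A.resolv w * toC (A.M * A.Cᵀ) with hX
  have hsum : fourierMat A.cov w = X + Xᴴ := by
    ext i j
    have hp := fourier_kernel h w i j
    have hn := fourier_kernel h w j i
    have e1 : ∀ t ∈ Set.Ioi (0 : ℝ), (A.kernel t i j : ℂ) * Complex.exp (-(Complex.I * w * t)) = (A.cov t i j : ℂ) * Complex.exp (-(Complex.I * w * t)) := by
      intro t ht
      rw [cov, if_pos (le_of_lt ht)]
    -- Reflection `t ↦ -t` transposes the covariance, and conjugation restores the sign of the
    -- frequency.
    have e2 : ∀ t ∈ Set.Ioi (0 : ℝ), (starRingEnd ℂ) ((A.kernel t j i : ℂ) * Complex.exp (-(Complex.I * w * t))) = (A.cov (-t) i j : ℂ) * Complex.exp (-(Complex.I * w * (-t : ℝ))) := by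
      intro t ht
      have : ¬ (0 ≤ -t) := by simpa using ht
      rw [cov, if_neg this, kernel_neg, map_mul, Complex.conj_ofReal, ← Complex.exp_conj]
      simp
    have i1 : IntegrableOn (fun t : ℝ => (A.cov t i j : ℂ) * Complex.exp (-(Complex.I * w * t))) (Set.Ioi 0) :=
      hp.1.congr_fun e1 measurableSet_Ioi
    have i2 : IntegrableOn (fun t : ℝ => (A.cov t i j : ℂ) * Complex.exp (-(Complex.I * w * t))) (Set.Iic 0) := by
      have h3 : IntegrableOn (fun t : ℝ => (starRingEnd ℂ) ((A.kernel t j i : ℂ) * Complex.exp (-(Complex.I * w * t)))) (Set.Ioi 0) :=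
        (RCLike.conjCLE (K := ℂ)).integrable_comp_iff.2 hn.1
      have h4 := h3.congr_fun e2 measurableSet_Ioi
      have h5 := (MeasurePreserving.integrableOn_comp_preimage (Measure.measurePreserving_neg (volume : Measure ℝ))
        (Homeomorph.neg ℝ).measurableEmbedding (s := Set.Iio 0)
        (f := fun t : ℝ => (A.cov t i j : ℂ) * Complex.exp (-(Complex.I * w * t)))).1 (by simpa [Function.comp_def] using h4)
      exact (integrableOn_Iic_iff_integrableOn_Iio (by simp)).2 h5
    rw [fourierMat, Matrix.of_apply, ← intervalIntegral.integral_Iic_add_Ioi i2 i1, add_comm, Matrix.add_apply]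
    congr 1
    · refine Eq.trans ?_ hp.2
      exact setIntegral_congr_fun measurableSet_Ioi fun t ht => (e1 t ht).symm
    · rw [Matrix.conjTranspose_apply, hX, ← hn.2]
      have h6 := integral_comp_neg_Ioi (0 : ℝ) (fun t : ℝ => (A.cov t i j : ℂ) * Complex.exp (-(Complex.I * w * t)))
      rw [neg_zero] at h6
      rw [← h6]
      change _ = (starRingEnd ℂ) _
      rw [← integral_conj]
      exact setIntegral_congr_fun measurableSet_Ioi fun t ht => (e2 t ht).symm
  have hM : (toC A.M)ᴴ = toC A.M := by
    rw [toC_conjTranspose, ← toC_transpose]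
    congr 1
    have := h.posDef.1
    rwa [Matrix.IsHermitian, Matrix.conjTranspose_eq_transpose_of_trivial] at this
  have hR := h.resolv_mul w
  have hRH : ((-(Complex.I * w)) • 1 + toC A.Γᵀ) * (A.resolv w)ᴴ = 1 := by
    have := congrArg Matrix.conjTranspose hR
    rw [Matrix.conjTranspose_mul, Matrix.conjTranspose_add, Matrix.conjTranspose_smul, toC_conjTranspose] at this
    simpa [toC_transpose] using this
  -- The shifts `±iω` cancel in the Lyapunov equation, so it may be multiplied by the resolvent on
  -- the left and by its adjoint on the right.
  have key : A.resolv w * toC A.M + toC A.M * (A.resolv w)ᴴ = A.resolv w * (toC A.S * (toC A.S)ᴴ) * (A.resolv w)ᴴ := by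
    have hl : toC A.S * (toC A.S)ᴴ = ((Complex.I * w) • 1 + toC A.Γ) * toC A.M + toC A.M * ((-(Complex.I * w)) • 1 + toC A.Γᵀ) := by
      rw [toC_conjTranspose, ← toC_transpose, ← toC_mul, ← h.lyapunov, toC_add, toC_mul, toC_mul]
      rw [Matrix.add_mul, Matrix.mul_add, Matrix.smul_mul, Matrix.mul_smul, Matrix.one_mul, Matrix.mul_one, neg_smul]
      abel
    rw [hl, mul_add, add_mul, ← Matrix.mul_assoc (A.resolv w), hR, Matrix.one_mul]
    conv_rhs => rw [Matrix.mul_assoc, Matrix.mul_assoc (toC A.M), hRH, Matrix.mul_one]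
    rw [add_comm]
  have hG : A.transfer w * (A.transfer w)ᴴ = toC A.C * (A.resolv w * (toC A.S * (toC A.S)ᴴ) * (A.resolv w)ᴴ) * (toC A.C)ᴴ := by
    simp only [transfer, Matrix.conjTranspose_mul, Matrix.mul_assoc]
  rw [hsum, hG, ← key, hX]
  simp only [toC_mul, Matrix.conjTranspose_mul, hM, toC_transpose, Matrix.mul_add, Matrix.add_mul, Matrix.mul_assoc, toC_conjTranspose]
  congr 1
  rw [← toC_conjTranspose, Matrix.conjTranspose_conjTranspose]

lemma effConst_natCast (A : Realization n p r) (k : ℕ) : A.effConst k = A.C * A.Γ⁻¹ ^ k * A.M * A.Cᵀ := by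
  rw [effConst, Matrix.zpow_neg_natCast, Matrix.inv_pow']

/-- If the effective constants of odd order at most `2 j - 1` vanish, then so do `C Γ⁻ᵃ Σ` for `1 ≤ a ≤ j`. -/
lemma Admissible.mul_inv_pow_mul_eq_zero (h : A.Admissible) (j : ℕ)
    (hL : ∀ b, b < j → A.effConst ((2 * b + 1 : ℕ) : ℤ) = 0) :
    ∀ a, 1 ≤ a → a ≤ j → A.C * A.Γ⁻¹ ^ a * A.S = 0 := by
  have hM : A.Mᵀ = A.M := by
    have := h.posDef.1
    rwa [Matrix.IsHermitian, Matrix.conjTranspose_eq_transpose_of_trivial] at this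
  have hN : A.Γ⁻¹ * A.Γ = 1 := Matrix.nonsing_inv_mul _ h.isUnit_det
  have hNT : A.Γᵀ * A.Γ⁻¹ᵀ = 1 := by rw [← Matrix.transpose_mul, hN, Matrix.transpose_one]
  set N := A.Γ⁻¹ with hNdef
  induction j with
  | zero => intro a h1 h2; omega
  | succ j ih =>
    have ih' := ih fun b hb => hL b (by omega)
    intro a h1 h2
    rcases Nat.lt_or_ge j a with h3 | h3
    swap
    · exact ih' a h1 h3
    obtain rfl : a = j + 1 := by omega
    -- Since `C Γ⁻⁽ᵇ⁺¹⁾ Σ Σ* = 0` is already known for these orders, the Lyapunov equation moves one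
    -- inverse of `Γ` across `M` at the price of a sign.
    have hcomm : ∀ b, b ≤ j → A.C * N ^ b * A.M = (-1 : ℝ) ^ b • (A.C * A.M * Nᵀ ^ b) := by
      intro b
      induction b with
      | zero => intro _; simp
      | succ b ihb =>
        intro hb
        have h4 : A.C * N ^ (b + 1) * (A.S * A.Sᵀ) * Nᵀ = 0 := by
          rw [← Matrix.mul_assoc _ A.S, ih' (b + 1) (by omega) hb]; simp
        rw [← h.lyapunov, Matrix.mul_add, Matrix.add_mul] at h4
        have h5 : A.C * N ^ (b + 1) * (A.Γ * A.M) * Nᵀ = A.C * N ^ b * A.M * Nᵀ := by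
          rw [pow_succ]
          simp only [← Matrix.mul_assoc]
          rw [Matrix.mul_assoc (A.C * N ^ b) N, hN, Matrix.mul_one]
        have h6 : A.C * N ^ (b + 1) * (A.M * A.Γᵀ) * Nᵀ = A.C * N ^ (b + 1) * A.M := by
          rw [Matrix.mul_assoc, Matrix.mul_assoc A.M, hNT, Matrix.mul_one]
        rw [h5, h6, ihb (by omega)] at h4
        rw [eq_neg_of_add_eq_zero_right h4, pow_succ, pow_succ Nᵀ, Matrix.smul_mul, ← Matrix.mul_assoc]
        simp
    -- The transpose of the effective constant of order `2j + 1` has all inverses to the right of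
    -- `M`; `j` of them are moved back to the left.
    have hX : A.C * N ^ j * A.M * Nᵀ ^ (j + 1) * A.Cᵀ = 0 := by
      have h7 := congrArg Matrix.transpose (hL j (by omega))
      rw [effConst_natCast, Matrix.transpose_mul, Matrix.transpose_mul, Matrix.transpose_mul, Matrix.transpose_transpose,
        hM, Matrix.transpose_pow, ← hNdef, Matrix.transpose_zero, show 2 * j + 1 = j + (j + 1) by ring, pow_add] at h7
      rw [hcomm j le_rfl, Matrix.smul_mul, Matrix.smul_mul]
      have : A.C * A.M * Nᵀ ^ j * Nᵀ ^ (j + 1) * A.Cᵀ = 0 := by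
        rw [← h7]; simp only [Matrix.mul_assoc]
      rw [this, smul_zero]
    -- A real matrix vanishes if its product with its own transpose does. By the Lyapunov equation
    -- that product is a sum of two mutually transposed matrices, the first of which is the
    -- expression in `hX`.
    rw [← Matrix.self_mul_conjTranspose_eq_zero, Matrix.conjTranspose_eq_transpose_of_trivial]
    have h8 : A.C * N ^ (j + 1) * A.S * (A.C * N ^ (j + 1) * A.S)ᵀ = A.C * N ^ (j + 1) * (A.S * A.Sᵀ) * (Nᵀ ^ (j + 1) * A.Cᵀ) := by
      simp only [Matrix.transpose_mul, Matrix.transpose_pow, Matrix.mul_assoc]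
    have h9 : A.C * N ^ (j + 1) * (A.Γ * A.M) * (Nᵀ ^ (j + 1) * A.Cᵀ) = 0 := by
      rw [← hX, pow_succ]
      simp only [← Matrix.mul_assoc]
      rw [Matrix.mul_assoc (A.C * N ^ j) N, hN, Matrix.mul_one]
    have h10 : A.C * N ^ (j + 1) * (A.M * A.Γᵀ) * (Nᵀ ^ (j + 1) * A.Cᵀ) = 0 := by
      rw [← Matrix.transpose_eq_zero, ← h9]
      simp only [Matrix.transpose_mul, Matrix.transpose_pow, Matrix.transpose_transpose, hM, Matrix.mul_assoc]
    rw [h8, ← h.lyapunov, Matrix.mul_add, Matrix.add_mul, h9, h10, add_zero]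

/-- Iterate `Φ = Γ⁻¹ - iω Γ⁻¹ Φ`; each vanishing coefficient `C Γ⁻ᵃ Σ` removes the first term and
leaves one more factor `-iω`. -/
lemma Admissible.transfer_eq_of_low (h : A.Admissible) (w : ℝ) (j : ℕ)
    (hS : ∀ a, 1 ≤ a → a ≤ j → A.C * A.Γ⁻¹ ^ a * A.S = 0) :
    A.transfer w = (-(Complex.I * w)) ^ j • (toC (A.C * A.Γ⁻¹ ^ j) * A.resolv w * toC A.S) := by
  have hP : A.resolv w = toC A.Γ⁻¹ - (Complex.I * w) • (toC A.Γ⁻¹ * A.resolv w) := by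
    have h1 : toC A.Γ⁻¹ * (((Complex.I * w) • 1 + toC A.Γ) * A.resolv w) = toC A.Γ⁻¹ * 1 := by rw [h.mul_resolv w]
    have h2 : toC A.Γ⁻¹ * toC A.Γ = 1 := by
      rw [← toC_mul, Matrix.nonsing_inv_mul _ h.isUnit_det, toC_one]
    rw [← Matrix.mul_assoc, Matrix.mul_add, Matrix.add_mul, h2, Matrix.mul_smul, Matrix.mul_one, Matrix.one_mul, Matrix.smul_mul] at h1
    exact eq_sub_of_add_eq' h1
  induction j with
  | zero => simp [transfer]
  | succ j ih =>
    rw [ih fun a h1 h2 => hS a h1 (by omega)]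
    conv_lhs => rw [hP]
    have h3 : toC (A.C * A.Γ⁻¹ ^ j) * toC A.Γ⁻¹ * toC A.S = 0 := by
      rw [← toC_mul, ← toC_mul, Matrix.mul_assoc A.C, ← pow_succ, hS (j + 1) (by omega) le_rfl, toC_zero]
    rw [Matrix.mul_sub, Matrix.sub_mul, h3, zero_sub, Matrix.mul_smul, Matrix.smul_mul, ← neg_smul, smul_smul, ← pow_succ,
      ← Matrix.mul_assoc, ← toC_mul, Matrix.mul_assoc A.C, ← pow_succ]

/-- With `k = 2a + 1`, the transfer function and its adjoint each carry a factor of modulus `|ω|ᵃ`,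
times a bounded matrix. -/
lemma Admissible.fourier_cov_isBigO_pow (h : A.Admissible) (k : ℕ) (hk : Odd k)
    (hL : ∀ n : ℕ, 0 < n → n < k → Odd n → A.effConst n = 0) (i j) :
    (fun w : ℝ => fourierMat A.cov w i j) =O[𝓝 0] (fun w : ℝ => w ^ (k - 1)) := by
  obtain ⟨a, rfl⟩ := hk
  have hS := h.mul_inv_pow_mul_eq_zero a fun b hb => hL _ (by omega) (by omega) ⟨b, rfl⟩
  obtain ⟨K, hK0, hK⟩ := A.norm_mul_resolv_mul_le (toC (A.C * A.Γ⁻¹ ^ a)) (toC A.S)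
  refine IsBigO.of_bound (∑ _l : Fin p, K * K) (Eventually.of_forall fun w => ?_)
  rw [h.fourier_cov, Matrix.mul_apply, Finset.sum_mul]
  refine (norm_sum_le _ _).trans (Finset.sum_le_sum fun l _ => ?_)
  rw [Matrix.conjTranspose_apply, norm_mul, norm_star, h.transfer_eq_of_low w a hS, Matrix.smul_apply, Matrix.smul_apply,
    norm_smul, norm_smul]
  have h1 : ‖(-(Complex.I * (w : ℂ))) ^ a‖ = ‖w‖ ^ a := by simp
  rw [h1, norm_pow, Nat.add_sub_cancel, two_mul, pow_add]
  calc _ ≤ ‖w‖ ^ a * K * (‖w‖ ^ a * K) := by gcongr <;> exact hK _ _ _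
    _ = _ := by ring

/-- Decay of the transfer function at infinity forces the Markov parameters `C Γᵃ Σ` to vanish. -/
lemma Admissible.mul_pow_mul_eq_zero_of_decay (h : A.Admissible) (s : ℝ)
    (hG : ∀ i j, (fun w : ℝ => A.transfer w i j) =O[atTop] (fun w : ℝ => w ^ (-s))) :
    ∀ a : ℕ, (a : ℝ) + 1 < s → A.C * A.Γ ^ a * A.S = 0 := by
  have hP : ∀ w : ℝ, (Complex.I * w) • A.resolv w = 1 - toC A.Γ * A.resolv w := fun w => by
    have := h.mul_resolv w
    rw [Matrix.add_mul, Matrix.smul_mul, Matrix.one_mul] at this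
    exact eq_sub_of_add_eq this
  -- Expansion at infinity: `iω Φ = 1 - Γ Φ`, placed between `C Γᵃ` and `Σ`.
  have hstep : ∀ (a : ℕ) (w : ℝ), toC (A.C * A.Γ ^ a) * toC A.S = (Complex.I * w) • (toC (A.C * A.Γ ^ a) * A.resolv w * toC A.S) + toC (A.C * A.Γ ^ (a + 1)) * A.resolv w * toC A.S := by
    intro a w
    rw [← Matrix.smul_mul, ← Matrix.mul_smul, hP, Matrix.mul_sub, Matrix.mul_one, Matrix.sub_mul, ← Matrix.mul_assoc, ← toC_mul (A.C * A.Γ ^ a) A.Γ,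
      Matrix.mul_assoc A.C (A.Γ ^ a) A.Γ, ← pow_succ]
    abel
  -- In `hstep` everything except the term with the factor `iω` is bounded, so `C Γᵃ Φ Σ = O(1/ω)`
  -- without any decay hypothesis.
  have hsmall : ∀ (a : ℕ) i j, Tendsto (fun w : ℝ => (toC (A.C * A.Γ ^ a) * A.resolv w * toC A.S) i j) atTop (𝓝 0) := by
    intro a i j
    obtain ⟨K, hK0, hK⟩ := A.norm_mul_resolv_mul_le (toC (A.C * A.Γ ^ (a + 1))) (toC A.S)
    set c := ‖(toC (A.C * A.Γ ^ a) * toC A.S) i j‖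
    refine squeeze_zero_norm' (a := fun w : ℝ => (c + K) / w) ?_ (tendsto_const_nhds.div_atTop tendsto_id)
    filter_upwards [eventually_gt_atTop 0] with w hw
    rw [le_div_iff₀ hw]
    have h1 := congrFun (congrFun (hstep a w) i) j
    rw [Matrix.add_apply, Matrix.smul_apply] at h1
    have h2 : ‖(Complex.I * w) • (toC (A.C * A.Γ ^ a) * A.resolv w * toC A.S) i j‖ ≤ c + K := by
      rw [eq_sub_of_add_eq h1.symm]
      exact (norm_sub_le _ _).trans (add_le_add le_rfl (hK _ _ _))
    rw [norm_smul, norm_mul, Complex.norm_I, one_mul, Complex.norm_real, Real.norm_of_nonneg hw.le] at h2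
    linarith
  intro a
  induction a using Nat.strong_induction_on with
  | _ a ih =>
    intro ha
    have htr : ∀ b, b ≤ a → ∀ w, toC (A.C * A.Γ ^ b) * A.resolv w * toC A.S = (-(Complex.I * w)) ^ b • A.transfer w := by
      intro b
      induction b with
      | zero => intro _ w; simp [transfer]
      | succ b ihb =>
        intro hb w
        have h1 := hstep b w
        rw [← toC_mul, ih b (by omega) (by have : (b : ℝ) + 1 ≤ a := by exact_mod_cast hb
                                           linarith), toC_zero, ihb (by omega)] at h1
        rw [eq_neg_of_add_eq_zero_right h1.symm, smul_smul, ← neg_smul, pow_succ]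
        congr 1; ring
    apply toC_injective
    rw [toC_zero, toC_mul]
    ext i j
    -- The constant `C Γᵃ Σ` equals `iω (-iω)ᵃ T(ω)` plus a null term, and the first summand is
    -- `O(ω^(a+1-s))` with `a + 1 < s`.
    have hlim : Tendsto (fun w : ℝ => (toC (A.C * A.Γ ^ a) * toC A.S) i j) atTop (𝓝 (0 + 0)) := by
      have h1 : (fun w : ℝ => (toC (A.C * A.Γ ^ a) * toC A.S) i j) = fun w : ℝ => ((Complex.I * w) * (-(Complex.I * w)) ^ a) * A.transfer w i j
          + (toC (A.C * A.Γ ^ (a + 1)) * A.resolv w * toC A.S) i j := by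
        funext w
        rw [hstep a w, htr a le_rfl, Matrix.add_apply, smul_smul]
        rfl
      rw [h1]
      refine Tendsto.add ?_ (hsmall _ i j)
      have h2 : (fun w : ℝ => ((Complex.I * w) * (-(Complex.I * w)) ^ a) * A.transfer w i j) =O[atTop] fun w : ℝ => w ^ ((a : ℝ) + 1) * w ^ (-s) := by
        refine IsBigO.mul (IsBigO.of_bound 1 ?_) (hG i j)
        filter_upwards [eventually_gt_atTop 0] with w hw
        rw [Real.rpow_add hw, Real.rpow_one, Real.rpow_natCast]
        simp [mul_comm]
      refine h2.trans_tendsto ?_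
      have h3 : (fun w : ℝ => w ^ ((a : ℝ) + 1) * w ^ (-s)) =ᶠ[atTop] fun w => w ^ (-(s - (a + 1))) := by
        filter_upwards [eventually_gt_atTop 0] with w hw
        rw [← Real.rpow_add hw]; congr 1; ring
      exact (tendsto_rpow_neg_atTop (by linarith)).congr' h3.symm
    rw [add_zero] at hlim
    exact tendsto_nhds_unique tendsto_const_nhds hlim

end Realization

/-- Decay of the spectral density of the noise forces the Markov parameters of every active system to vanish. -/
lemma Model.Standing.mul_pow_mul_eq_zero {q r : ℕ} {D : Model q r} (hD : D.Standing) (h : ℝ)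
    (hS : ∀ i j, (fun w : ℝ => D.spec w i j) =O[atTop] (fun w : ℝ => 1 / w ^ (2 * h + 1))) :
    (∀ a : ℕ, (a : ℝ) < h - 1 / 2 → D.α₃ • (D.sys₃.C * D.sys₃.Γ ^ a * D.sys₃.S) = 0) ∧
    (∀ a : ℕ, (a : ℝ) < h - 1 / 2 → D.α₄ • (D.sys₄.C * D.sys₄.Γ ^ a * D.sys₄.S) = 0) := by
  -- Diagonal entries are nonnegative combinations of sums of squares, so the contributions of the
  -- two systems cannot cancel and each active one inherits the decay.
  have hdiag : ∀ w i, D.spec w i i = ((D.α₃ * ∑ l, ‖D.sys₃.transfer w i l‖ ^ 2 + D.α₄ * ∑ l, ‖D.sys₄.transfer w i l‖ ^ 2 : ℝ) : ℂ) := by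
    intro w i
    have h1 : ∀ {m p : ℕ} (X : Matrix (Fin m) (Fin p) ℂ) (i : Fin m), (X * Xᴴ) i i = ((∑ l, ‖X i l‖ ^ 2 : ℝ) : ℂ) := by
      intro m p X i
      rw [Matrix.mul_apply]
      push_cast
      refine Finset.sum_congr rfl fun l _ => ?_
      rw [Matrix.conjTranspose_apply]
      exact Complex.mul_conj' _
    rw [Model.spec, Model.spec₃, Model.spec₄, hD.adm₃.fourier_cov, hD.adm₄.fourier_cov, Matrix.add_apply, Matrix.smul_apply, Matrix.smul_apply, h1, h1]
    push_cast
    rfl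
  have h3 : 0 ≤ D.α₃ := by rcases hD.switch₃ with h | h <;> norm_num [h]
  have h4 : 0 ≤ D.α₄ := by rcases hD.switch₄ with h | h <;> norm_num [h]
  -- Taking square roots turns the exponent `2h + 1` into `h + 1/2`; the condition `a + 1 < h + 1/2`
  -- becomes `a < h - 1/2`.
  have hsqrt : ∀ {p : ℕ} (T : ℝ → Matrix (Fin r) (Fin p) ℂ), (∀ w i, ∑ l, ‖T w i l‖ ^ 2 ≤ ‖D.spec w i i‖) →
      ∀ i j, (fun w : ℝ => T w i j) =O[atTop] (fun w : ℝ => w ^ (-(h + 1 / 2))) := by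
    intro p T hT i j
    obtain ⟨K, hK⟩ := (hS i i).bound
    refine IsBigO.of_bound (Real.sqrt K) ?_
    filter_upwards [hK, eventually_gt_atTop 0] with w hw hw0
    have h5 : ‖T w i j‖ ^ 2 ≤ K * ‖1 / w ^ (2 * h + 1)‖ :=
      ((Finset.single_le_sum (f := fun l => ‖T w i l‖ ^ 2) (fun _ _ => by positivity) (Finset.mem_univ j)).trans (hT w i)).trans hw
    have h6 : ‖1 / w ^ (2 * h + 1)‖ = (w ^ (-(h + 1 / 2))) ^ 2 := by
      rw [Real.norm_of_nonneg (by positivity), one_div, ← Real.rpow_neg hw0.le, ← Real.rpow_natCast, ← Real.rpow_mul hw0.le]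
      congr 1; push_cast; ring
    rw [h6] at h5
    rw [Real.norm_of_nonneg (by positivity)]
    have h7 : 0 < (w ^ (-(h + 1 / 2))) := by positivity
    have h8 : 0 ≤ K := by
      by_contra hneg
      push Not at hneg
      nlinarith [sq_nonneg ‖T w i j‖, pow_pos h7 2]
    apply abs_le_of_sq_le_sq' _ (by positivity) |>.2
    rw [mul_pow, Real.sq_sqrt h8]
    exact h5
  constructor
  · intro a ha
    rcases hD.switch₃ with h0 | h1
    · rw [h0, zero_smul]
    · rw [h1, one_smul]
      refine hD.adm₃.mul_pow_mul_eq_zero_of_decay (h + 1 / 2) (hsqrt _ fun w i => ?_) a (by linarith)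
      rw [hdiag, Complex.norm_real, Real.norm_of_nonneg (by positivity), h1, one_mul]
      exact le_add_of_nonneg_right (by positivity)
  · intro a ha
    rcases hD.switch₄ with h0 | h1
    · rw [h0, zero_smul]
    · rw [h1, one_smul]
      refine hD.adm₄.mul_pow_mul_eq_zero_of_decay (h + 1 / 2) (hsqrt _ fun w i => ?_) a (by linarith)
      rw [hdiag, Complex.norm_real, Real.norm_of_nonneg (by positivity), h1, one_mul]
      exact le_add_of_nonneg_left (by positivity)

end GLE

/-! ### Square-integrable processes with continuous paths -/

namespace GLE

section L2

variable {Ω : Type*} [MeasurableSpace Ω] {P : Measure Ω}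

/-- A real process on `[0, ∞)` with continuous paths and locally bounded second moments. -/
structure IsSecondOrder (P : Measure Ω) (X : ℝ → Ω → ℝ) : Prop where
  aemeasurable : ∀ t, 0 ≤ t → AEMeasurable (X t) P
  continuous : ∀ᵐ ω ∂P, ContinuousOn (fun t => X t ω) (Set.Ici 0)
  memLp : ∀ t, 0 ≤ t → MemLp (X t) 2 P
  bound : ∀ T, ∃ C, ∀ t, 0 ≤ t → t ≤ T → ∫ ω, X t ω * X t ω ∂P ≤ C

/-- Fubini on time and probability space needs joint measurability, which follows from continuity of
every path and measurability at every time. The process is therefore replaced by `0` on a measurable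
null set containing all bad paths, and frozen at its initial value for negative times. -/
lemma exists_measurable_continuous_modification (X : ℝ → Ω → ℝ)
    (hm : ∀ t, 0 ≤ t → AEMeasurable (X t) P)
    (hc : ∀ᵐ ω ∂P, ContinuousOn (fun t => X t ω) (Set.Ici 0)) :
    ∃ Y : ℝ → Ω → ℝ, (∀ t, Measurable (Y t)) ∧ (∀ ω, Continuous fun t => Y t ω) ∧
      ∀ᵐ ω ∂P, ∀ t, 0 ≤ t → Y t ω = X t ω := by
  classical
  have hm' : ∀ q : ℚ, AEMeasurable (X (max (q : ℝ) 0)) P := fun q => hm _ (le_max_right _ _)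
  have hgood : ∀ᵐ ω ∂P, ContinuousOn (fun t => X t ω) (Set.Ici 0) ∧
      ∀ q : ℚ, X (max (q : ℝ) 0) ω = (hm' q).mk _ ω :=
    hc.and (ae_all_iff.2 fun q => (hm' q).ae_eq_mk)
  set N := toMeasurable P {ω | ¬ (ContinuousOn (fun t => X t ω) (Set.Ici 0) ∧
      ∀ q : ℚ, X (max (q : ℝ) 0) ω = (hm' q).mk _ ω)} with hN
  have hN0 : P N = 0 := by rw [hN, measure_toMeasurable]; exact hgood
  have hNm : MeasurableSet N := measurableSet_toMeasurable _ _
  have hNgood : ∀ ω, ω ∉ N → ContinuousOn (fun t => X t ω) (Set.Ici 0) ∧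
      ∀ q : ℚ, X (max (q : ℝ) 0) ω = (hm' q).mk _ ω := by
    intro ω hω
    by_contra h
    exact hω (subset_toMeasurable _ _ h)
  have hcont : ∀ ω, Continuous fun t : ℝ => if ω ∈ N then 0 else X (max t 0) ω := by
    intro ω
    by_cases h : ω ∈ N
    · simp only [h, if_true]; exact continuous_const
    · simp only [h, if_false]
      exact (hNgood ω h).1.comp_continuous (by fun_prop) fun t => le_max_right t 0
  refine ⟨fun t ω => if ω ∈ N then 0 else X (max t 0) ω, fun t => ?_, hcont, ?_⟩
  -- Off the null set the process agrees with measurable versions at all rational times at once;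
  -- continuity extends measurability to real times.
  · have ht : t ∈ closure (Set.range ((↑) : ℚ → ℝ)) := Rat.denseRange_cast t
    obtain ⟨x, hx, hxt⟩ := mem_closure_iff_seq_limit.1 ht
    choose q hq using hx
    refine measurable_of_tendsto_metrizable (f := fun n ω => if ω ∈ N then 0 else (hm' (q n)).mk _ ω)
      (fun n => Measurable.ite hNm measurable_const (hm' (q n)).measurable_mk) ?_
    rw [tendsto_pi_nhds]
    intro ω
    have h1 := ((hcont ω).tendsto t).comp hxt
    refine h1.congr fun n => ?_
    by_cases h : ω ∈ N
    · simp [h]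
    · simp only [Function.comp, h, if_false, ← hq n]
      exact (hNgood ω h).2 (q n)
  · have : ∀ᵐ ω ∂P, ω ∉ N := by rwa [ae_iff, show {a | ¬ a ∉ N} = N by ext; simp]
    filter_upwards [this] with ω hω t ht
    simp [hω, ht]

/-- The integral of the squared deviation of `u` from its mean is nonnegative. -/
lemma sq_intervalIntegral_le {a b : ℝ} (hab : a ≤ b) (u : ℝ → ℝ) (hu : Continuous u) :
    (∫ s in a..b, u s) ^ 2 ≤ (b - a) * ∫ s in a..b, u s ^ 2 := by
  rcases hab.eq_or_lt with rfl | hlt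
  · simp
  set m := (∫ s in a..b, u s) / (b - a) with hm
  have h0 : 0 ≤ ∫ s in a..b, (u s - m) ^ 2 :=
    intervalIntegral.integral_nonneg hab fun s _ => sq_nonneg _
  have h1 : ∫ s in a..b, (u s - m) ^ 2 = (∫ s in a..b, u s ^ 2) - 2 * m * (∫ s in a..b, u s) + (b - a) * m ^ 2 := by
    have : ∀ s, (u s - m) ^ 2 = u s ^ 2 - 2 * m * u s + m ^ 2 := fun s => by ring
    simp_rw [this]
    rw [intervalIntegral.integral_add, intervalIntegral.integral_sub, intervalIntegral.integral_const_mul, intervalIntegral.integral_const, smul_eq_mul]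
    all_goals exact Continuous.intervalIntegrable (by fun_prop) _ _
  have h2 : (∫ s in a..b, u s) = m * (b - a) := by
    rw [hm, div_mul_cancel₀ _ (by linarith : b - a ≠ 0)]
  rw [h1, h2] at h0
  rw [h2]
  nlinarith

/-- Time integration commutes with taking the expectation against a square integrable variable. This
is Fubini for the continuous modification. -/
lemma IsSecondOrder.integral [IsFiniteMeasure P] {X : ℝ → Ω → ℝ} (hX : IsSecondOrder P X) {a b : ℝ} (ha : 0 ≤ a) (hab : a ≤ b)
    {f : ℝ → ℝ} (hf : Continuous f) :
    MemLp (fun ω => ∫ s in a..b, f s * X s ω) 2 P ∧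
    ∀ Z, MemLp Z 2 P → ∫ ω, (∫ s in a..b, f s * X s ω) * Z ω ∂P = ∫ s in a..b, f s * ∫ ω, X s ω * Z ω ∂P := by
  obtain ⟨Y, hYm, hYc, hYX⟩ := exists_measurable_continuous_modification X hX.aemeasurable hX.continuous
  have hYt : ∀ t, 0 ≤ t → Y t =ᵐ[P] X t := fun t ht => hYX.mono fun ω h => h t ht
  obtain ⟨C, hC⟩ := hX.bound b
  have hYL : ∀ t, 0 ≤ t → MemLp (Y t) 2 P := fun t ht => (memLp_congr_ae (hYt t ht)).2 (hX.memLp t ht)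
  have hYC : ∀ t, 0 ≤ t → t ≤ b → ∫ ω, Y t ω ^ 2 ∂P ≤ C := fun t ht htb => by
    refine le_trans (le_of_eq (integral_congr_ae ((hYt t ht).mono fun ω h => ?_))) (hC t ht htb)
    simp only [h, sq]
  have hj : Measurable (Function.uncurry Y) := measurable_uncurry_of_continuous_of_measurable hYc hYm
  obtain ⟨K, hK⟩ := isCompact_Icc.exists_bound_of_continuousOn (s := Set.Icc a b) hf.continuousOn
  set μ := (volume : Measure ℝ).restrict (Set.Ioc a b) with hμ
  have hmem : ∀ᵐ s ∂μ, s ∈ Set.Ioc a b := ae_restrict_mem measurableSet_Ioc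
  have hgXY : ∀ᵐ ω ∂P, ∫ s in a..b, f s * X s ω = ∫ s in a..b, f s * Y s ω := by
    filter_upwards [hYX] with ω h
    refine intervalIntegral.integral_congr fun s hs => ?_
    rw [Set.uIcc_of_le hab] at hs
    simp only [h s (ha.trans hs.1)]
  have hjf : Measurable fun p : ℝ × Ω => f p.1 * Y p.1 p.2 := (hf.measurable.comp measurable_fst).mul hj
  -- `f` is bounded on `[a, b]` and the second moments are locally bounded. This square also
  -- dominates the product with `Z`, through `|xy| ≤ x² + y²`.
  have hsqint : Integrable (fun p : ℝ × Ω => (f p.1 * Y p.1 p.2) ^ 2) (μ.prod P) := by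
    rw [integrable_prod_iff (hjf.pow_const 2).aestronglyMeasurable]
    constructor
    · filter_upwards [hmem] with s hs
      simp_rw [mul_pow]
      exact ((hYL s (ha.trans hs.1.le)).integrable_sq).const_mul _
    · refine Integrable.of_bound ((hjf.pow_const 2).stronglyMeasurable.norm.integral_prod_right'.aestronglyMeasurable) (K ^ 2 * C) ?_
      filter_upwards [hmem] with s hs
      rw [Real.norm_of_nonneg (integral_nonneg fun ω => norm_nonneg _)]
      have h1 : ∀ ω, ‖(f s * Y s ω) ^ 2‖ = f s ^ 2 * Y s ω ^ 2 := fun ω => by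
        rw [Real.norm_of_nonneg (sq_nonneg _), mul_pow]
      simp_rw [h1]
      rw [integral_const_mul]
      have h2 := hK s ⟨hs.1.le, hs.2⟩
      have h3 : f s ^ 2 ≤ K ^ 2 := by
        rw [← sq_abs]; exact pow_le_pow_left₀ (abs_nonneg _) h2 2
      exact mul_le_mul h3 (hYC s (ha.trans hs.1.le) hs.2) (integral_nonneg fun ω => sq_nonneg _) (sq_nonneg _)
  have hgm : Measurable fun ω => ∫ s in a..b, f s * Y s ω := by
    simp_rw [intervalIntegral.integral_of_le hab]
    exact (hjf.comp measurable_swap).stronglyMeasurable.integral_prod_right'.measurable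
  have hgL : MemLp (fun ω => ∫ s in a..b, f s * Y s ω) 2 P := by
    rw [memLp_two_iff_integrable_sq hgm.aestronglyMeasurable]
    refine Integrable.mono' (hsqint.integral_prod_right.const_mul (b - a)) (hgm.pow_const 2).aestronglyMeasurable ?_
    refine Eventually.of_forall fun ω => ?_
    rw [Real.norm_of_nonneg (sq_nonneg _)]
    have := sq_intervalIntegral_le hab (fun s => f s * Y s ω) (hf.mul (hYc ω))
    rwa [intervalIntegral.integral_of_le hab (f := fun s => (f s * Y s ω) ^ 2)] at this
  refine ⟨(memLp_congr_ae hgXY).2 hgL, fun Z hZ => ?_⟩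
  have h1 : ∫ ω, (∫ s in a..b, f s * X s ω) * Z ω ∂P = ∫ ω, (∫ s, f s * Y s ω * Z ω ∂μ) ∂P := by
    refine integral_congr_ae (hgXY.mono fun ω h => ?_)
    simp only [h]
    rw [intervalIntegral.integral_of_le hab, integral_mul_const]
  have hZi : Integrable (fun p : Ω × ℝ => f p.2 * Y p.2 p.1 * Z p.1) (P.prod μ) := by
    have hsw : Integrable (fun p : ℝ × Ω => f p.1 * Y p.1 p.2 * Z p.2) (μ.prod P) := by
      have hmZ : AEStronglyMeasurable (fun p : ℝ × Ω => f p.1 * Y p.1 p.2 * Z p.2) (μ.prod P) :=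
        hjf.aestronglyMeasurable.mul hZ.1.comp_snd
      have hZ2 : Integrable (fun p : ℝ × Ω => Z p.2 ^ 2) (μ.prod P) := hZ.integrable_sq.comp_snd μ
      refine Integrable.mono' ((hsqint.add hZ2)) hmZ (Eventually.of_forall fun p => ?_)
      simp only [Pi.add_apply]
      rw [Real.norm_eq_abs, abs_mul]
      nlinarith [sq_nonneg (|f p.1 * Y p.1 p.2| - |Z p.2|), sq_abs (f p.1 * Y p.1 p.2), sq_abs (Z p.2), abs_nonneg (f p.1 * Y p.1 p.2), abs_nonneg (Z p.2)]
    exact hsw.swap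
  rw [h1, integral_integral_swap hZi, intervalIntegral.integral_of_le hab]
  refine setIntegral_congr_fun measurableSet_Ioc fun s hs => ?_
  rw [← integral_const_mul]
  refine integral_congr_ae ((hYt s (ha.trans hs.1.le)).mono fun ω h => ?_)
  simp only [h]; ring

/-- `f(t) X_t - ∫₀ᵗ f'(s) X_s ds`, the integral `∫₀ᵗ f dX` (when `X_0 = 0`). -/
noncomputable def partsIntegral (X : ℝ → Ω → ℝ) (f f' : ℝ → ℝ) (t : ℝ) (ω : Ω) : ℝ :=
  f t * X t ω - ∫ s in (0 : ℝ)..t, f' s * X s ω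

lemma IsSecondOrder.memLp_partsIntegral [IsFiniteMeasure P] {X : ℝ → Ω → ℝ} (hX : IsSecondOrder P X) (f : ℝ → ℝ) {f' : ℝ → ℝ}
    (hf' : Continuous f') {t : ℝ} (ht : 0 ≤ t) : MemLp (partsIntegral X f f' t) 2 P :=
  ((hX.memLp t ht).const_mul (f t)).sub (hX.integral le_rfl ht hf').1

lemma IsSecondOrder.integral_partsIntegral_mul [IsFiniteMeasure P] {X : ℝ → Ω → ℝ} (hX : IsSecondOrder P X) (f : ℝ → ℝ) {f' : ℝ → ℝ}
    (hf' : Continuous f') {t : ℝ} (ht : 0 ≤ t) (Z : Ω → ℝ) (hZ : MemLp Z 2 P) :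
    ∫ ω, partsIntegral X f f' t ω * Z ω ∂P =
      f t * (∫ ω, X t ω * Z ω ∂P) - ∫ s in (0 : ℝ)..t, f' s * ∫ ω, X s ω * Z ω ∂P := by
  rw [← (hX.integral le_rfl ht hf').2 Z hZ, ← integral_const_mul, ← integral_sub]
  · refine integral_congr_ae (Eventually.of_forall fun ω => ?_)
    simp only [partsIntegral]; ring
  · exact ((hX.memLp t ht).integrable_mul hZ).const_mul _
  · exact (hX.integral le_rfl ht hf').1.integrable_mul hZ

/-- Itô isometry for smooth integrands. -/
lemma integral_partsIntegral_mul_partsIntegral [IsFiniteMeasure P] {X Y : ℝ → Ω → ℝ} (hX : IsSecondOrder P X)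
    (hY : IsSecondOrder P Y) (c : ℝ) (hc : ∀ s r, 0 ≤ s → 0 ≤ r → ∫ ω, X s ω * Y r ω ∂P = c * min s r)
    {f f' g g' : ℝ → ℝ} (hf : ∀ s, HasDerivAt f (f' s) s) (hf' : Continuous f')
    (hg : ∀ s, HasDerivAt g (g' s) s) (hg' : Continuous g') {t u : ℝ} (ht : 0 ≤ t) (htu : t ≤ u) :
    ∫ ω, partsIntegral X f f' t ω * partsIntegral Y g g' u ω ∂P = c * ∫ s in (0 : ℝ)..t, f s * g s := by
  have hu := ht.trans htu
  have hfc : Continuous f := continuous_iff_continuousAt.2 fun s => (hf s).continuousAt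
  have hgc : Continuous g := continuous_iff_continuousAt.2 fun s => (hg s).continuousAt
  -- One integral at a time: pairing `∫ g dY` with `X_s` gives an integration by parts against
  -- `min(s, r)`, which stops the integral of `g` at `s`.
  have hψ : ∀ s, 0 ≤ s → s ≤ u → ∫ ω, X s ω * partsIntegral Y g g' u ω ∂P = c * ∫ r in (0 : ℝ)..s, g r := by
    intro s hs hsu
    have h1 := hY.integral_partsIntegral_mul g hg' hu (X s) (hX.memLp s hs)
    rw [show (fun ω => X s ω * partsIntegral Y g g' u ω) = fun ω => partsIntegral Y g g' u ω * X s ω from funext fun ω => mul_comm _ _, h1]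
    have h2 : ∀ r, 0 ≤ r → ∫ ω, Y r ω * X s ω ∂P = c * min s r := fun r hr => by
      rw [← hc s r hs hr]; congr 1; funext ω; ring
    rw [h2 u hu, min_eq_left hsu]
    -- The split is at `s`, where `min(s, r)` changes from `r` to the constant `s`.
    have h3 : ∫ r in (0 : ℝ)..u, g' r * ∫ ω, Y r ω * X s ω ∂P = (∫ r in (0 : ℝ)..s, c * (g' r * r)) + ∫ r in s..u, c * s * g' r := by
      rw [← intervalIntegral.integral_add_adjacent_intervals (a := 0) (b := s) (c := u)]
      · congr 1
        · refine intervalIntegral.integral_congr fun r hr => ?_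
          rw [Set.uIcc_of_le hs] at hr
          rw [h2 r hr.1, min_eq_right hr.2]; ring
        · refine intervalIntegral.integral_congr fun r hr => ?_
          rw [Set.uIcc_of_le hsu] at hr
          rw [h2 r (hs.trans hr.1), min_eq_left hr.1]; ring
      · refine ((continuous_const.mul (hg'.mul (continuous_const.min continuous_id))).intervalIntegrable (μ := volume) 0 s).congr (f := fun r => c * (g' r * min s r)) ?_
        intro r hr
        rw [Set.uIoc_of_le hs] at hr
        beta_reduce
        rw [h2 r hr.1.le]; ring
      · refine ((continuous_const.mul (hg'.mul (continuous_const.min continuous_id))).intervalIntegrable (μ := volume) s u).congr (f := fun r => c * (g' r * min s r)) ?_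
        intro r hr
        rw [Set.uIoc_of_le hsu] at hr
        beta_reduce
        rw [h2 r (hs.trans hr.1.le)]; ring
    rw [h3, intervalIntegral.integral_const_mul, intervalIntegral.integral_const_mul,
      intervalIntegral.integral_eq_sub_of_hasDerivAt (fun r _ => hg r) (hg'.intervalIntegrable _ _)]
    have h4 : ∫ r in (0 : ℝ)..s, g' r * r = g s * s - ∫ r in (0 : ℝ)..s, g r := by
      have h5 := intervalIntegral.integral_eq_sub_of_hasDerivAt (a := 0) (b := s) (f := fun r => g r * r)
        (fun r _ => (hg r).fun_mul (hasDerivAt_id r)) (Continuous.intervalIntegrable (by fun_prop) _ _)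
      simp only [mul_one, mul_zero, sub_zero] at h5
      rw [intervalIntegral.integral_add] at h5
      · linarith
      all_goals exact Continuous.intervalIntegrable (by fun_prop) _ _
    rw [h4]; ring
  rw [hX.integral_partsIntegral_mul f hf' ht _ (hY.memLp_partsIntegral g hg' hu), hψ t ht htu]
  have h6 : ∫ s in (0 : ℝ)..t, f' s * ∫ ω, X s ω * partsIntegral Y g g' u ω ∂P = ∫ s in (0 : ℝ)..t, c * (f' s * ∫ r in (0 : ℝ)..s, g r) := by
    refine intervalIntegral.integral_congr fun s hs => ?_
    rw [Set.uIcc_of_le ht] at hs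
    rw [hψ s hs.1 (hs.2.trans htu)]; ring
  have hG : ∀ s, HasDerivAt (fun s => ∫ r in (0 : ℝ)..s, g r) (g s) s := fun s => hgc.integral_hasStrictDerivAt 0 s |>.hasDerivAt
  have hGc : Continuous fun s => ∫ r in (0 : ℝ)..s, g r := continuous_iff_continuousAt.2 fun s => (hG s).continuousAt
  have h7 := intervalIntegral.integral_eq_sub_of_hasDerivAt (a := 0) (b := t) (f := fun s => f s * ∫ r in (0 : ℝ)..s, g r)
        (fun s _ => (hf s).fun_mul (hG s)) (Continuous.intervalIntegrable (by fun_prop) _ _)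
  rw [intervalIntegral.integral_add] at h7
  · rw [h6, intervalIntegral.integral_const_mul]
    simp only [intervalIntegral.integral_same, mul_zero, sub_zero] at h7
    rw [← eq_sub_iff_add_eq'] at h7
    rw [h7]; ring
  all_goals exact Continuous.intervalIntegrable (by fun_prop) _ _

end L2

end GLE

namespace GLE

/-! ### Variation of constants for linear equations with nondifferentiable forcing -/

section Linear

variable {ι : Type*} [Fintype ι] [DecidableEq ι]

lemma hasDerivAt_exp_sub_smul_apply (B : Matrix ι ι ℝ) (t s : ℝ) (i j : ι) :
    HasDerivAt (fun s : ℝ => NormedSpace.exp ((t - s) • B) i j) (-(NormedSpace.exp ((t - s) • B) * B) i j) s :=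
  (hasDerivAt_exp_smul_apply B (t - s) i j).comp_const_sub t s

lemma continuous_exp_sub_smul_apply (B : Matrix ι ι ℝ) (t : ℝ) (i j : ι) :
    Continuous fun s : ℝ => NormedSpace.exp ((t - s) • B) i j :=
  (continuous_exp_smul_apply B i j).comp (by fun_prop)

lemma continuous_exp_sub_smul_mul_apply {κ : Type*} (B : Matrix ι ι ℝ) (C : Matrix ι κ ℝ) (t : ℝ) (i : ι) (j : κ) :
    Continuous fun s : ℝ => (NormedSpace.exp ((t - s) • B) * C) i j := by
  simp only [Matrix.mul_apply]
  exact continuous_finsetSum _ fun k _ => (continuous_exp_sub_smul_apply B t i k).mul continuous_const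

/-- Variation of constants for `dz = (B z + ψ) dt + dφ`. -/
lemma variation_of_constants (B : Matrix ι ι ℝ) (z φ ψ : ℝ → ι → ℝ)
    (hz : ∀ i, ContinuousOn (fun t => z t i) (Set.Ici 0))
    (hψ : ∀ i, ContinuousOn (fun t => ψ t i) (Set.Ici 0))
    (heq : ∀ t, 0 ≤ t → ∀ i, z t i = z 0 i + (∫ s in (0 : ℝ)..t, ((B *ᵥ z s) i + ψ s i)) + φ t i)
    (t : ℝ) (ht : 0 ≤ t) (i : ι) :
    z t i = (NormedSpace.exp (t • B) *ᵥ z 0) i + φ t i +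
      ∫ s in (0 : ℝ)..t, (((NormedSpace.exp ((t - s) • B) * B) *ᵥ φ s) i + (NormedSpace.exp ((t - s) • B) *ᵥ ψ s) i) := by
  have hext : ∀ {f : ℝ → ι → ℝ}, (∀ i, ContinuousOn (fun t => f t i) (Set.Ici 0)) → ∀ i, Continuous fun s : ℝ => f (max s 0) i :=
    fun hf i => (hf i).comp_continuous (by fun_prop) fun t => le_max_right t 0
  -- `φ` need not be differentiable, but `u`, which equals `z - φ` on `[0, ∞)`, is. The argument
  -- `max r 0` extends the integrand continuously to the line.
  set u : ℝ → ι → ℝ := fun s j => z 0 j + ∫ r in (0 : ℝ)..s, ((B *ᵥ z (max r 0)) j + ψ (max r 0) j) with hu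
  have hint : ∀ j, Continuous fun r : ℝ => (B *ᵥ z (max r 0)) j + ψ (max r 0) j := by
    intro j
    refine Continuous.add ?_ (hext hψ j)
    simp only [Matrix.mulVec, dotProduct]
    exact continuous_finsetSum _ fun k _ => continuous_const.mul (hext hz k)
  have hud : ∀ s j, HasDerivAt (fun s => u s j) ((B *ᵥ z (max s 0)) j + ψ (max s 0) j) s := fun s j =>
    ((hint j).integral_hasStrictDerivAt 0 s).hasDerivAt.const_add (z 0 j)
  have huz : ∀ s, 0 ≤ s → ∀ j, z s j = u s j + φ s j := by
    intro s hs j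
    rw [heq s hs j, hu]
    congr 2
    refine intervalIntegral.integral_congr fun r hr => ?_
    rw [Set.uIcc_of_le hs] at hr
    rw [max_eq_left hr.1]
  -- The derivative of `e^{(t-s)B} u(s)` loses its `u` part when `z = u + φ` is inserted; only `φ`
  -- and `ψ` remain.
  have hGd : ∀ s, HasDerivAt (fun s => ∑ j, NormedSpace.exp ((t - s) • B) i j * u s j)
      (∑ j, (-(NormedSpace.exp ((t - s) • B) * B) i j * u s j + NormedSpace.exp ((t - s) • B) i j * ((B *ᵥ z (max s 0)) j + ψ (max s 0) j))) s :=
    fun s => HasDerivAt.fun_sum fun j _ => (hasDerivAt_exp_sub_smul_apply B t s i j).fun_mul (hud s j)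
  have huc : ∀ j, Continuous fun s => u s j := fun j => continuous_iff_continuousAt.2 fun s => (hud s j).continuousAt
  have hFTC := intervalIntegral.integral_eq_sub_of_hasDerivAt (a := 0) (b := t) (fun s _ => hGd s)
    (Continuous.intervalIntegrable (continuous_finsetSum _ fun j _ =>
      ((continuous_exp_sub_smul_mul_apply B B t i j).neg.mul (huc j)).add ((continuous_exp_sub_smul_apply B t i j).mul (hint j))) _ _)
  have h1 : ∑ j, NormedSpace.exp ((t - t) • B) i j * u t j = u t i := by
    rw [sub_self, zero_smul, NormedSpace.exp_zero]
    simp [Matrix.one_apply]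
  have h2 : ∑ j, NormedSpace.exp ((t - 0) • B) i j * u 0 j = (NormedSpace.exp (t • B) *ᵥ z 0) i := by
    rw [sub_zero]
    simp [Matrix.mulVec, dotProduct, hu]
  rw [h1, h2] at hFTC
  rw [huz t ht i, sub_eq_iff_eq_add'.1 hFTC.symm, add_right_comm]
  congr 1
  refine intervalIntegral.integral_congr fun s hs => ?_
  rw [Set.uIcc_of_le ht] at hs
  rw [max_eq_left hs.1]
  have h3 : z s = u s + φ s := funext fun j => huz s hs.1 j
  have h4 : ∑ j, NormedSpace.exp ((t - s) • B) i j * (B *ᵥ z s) j = ((NormedSpace.exp ((t - s) • B) * B) *ᵥ z s) i := by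
    rw [← Matrix.mulVec_mulVec]; rfl
  simp only [mul_add, Finset.sum_add_distrib, neg_mul, Finset.sum_neg_distrib]
  rw [h4, h3, Matrix.mulVec_add]
  simp only [Matrix.mulVec, dotProduct, Pi.add_apply]
  ring

end Linear

/-! ### Bilinearity of second moments -/

section Bilinear

variable {Ω κ : Type*} [MeasurableSpace Ω] {P : Measure Ω} [Fintype κ]

lemma integrable_mul_of_memLp {X Y : Ω → ℝ} (hX : MemLp X 2 P) (hY : MemLp Y 2 P) :
    Integrable (fun ω => X ω * Y ω) P := hX.integrable_mul hY

lemma integral_sum_mul {X : κ → Ω → ℝ} {Y : Ω → ℝ} (hX : ∀ k, MemLp (X k) 2 P) (hY : MemLp Y 2 P) :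
    ∫ ω, (∑ k, X k ω) * Y ω ∂P = ∑ k, ∫ ω, X k ω * Y ω ∂P := by
  simp_rw [Finset.sum_mul]
  exact integral_finsetSum _ fun k _ => integrable_mul_of_memLp (hX k) hY

lemma integral_mul_sum {X : Ω → ℝ} {Y : κ → Ω → ℝ} (hX : MemLp X 2 P) (hY : ∀ k, MemLp (Y k) 2 P) :
    ∫ ω, X ω * (∑ k, Y k ω) ∂P = ∑ k, ∫ ω, X ω * Y k ω ∂P := by
  simp_rw [Finset.mul_sum]
  exact integral_finsetSum _ fun k _ => integrable_mul_of_memLp hX (hY k)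

lemma integral_add_mul_add {X X' Y Y' : Ω → ℝ} (hX : MemLp X 2 P) (hX' : MemLp X' 2 P) (hY : MemLp Y 2 P) (hY' : MemLp Y' 2 P) :
    ∫ ω, (X ω + X' ω) * (Y ω + Y' ω) ∂P =
      ∫ ω, X ω * Y ω ∂P + ∫ ω, X' ω * Y ω ∂P + ∫ ω, X ω * Y' ω ∂P + ∫ ω, X' ω * Y' ω ∂P := by
  have h : ∀ ω, (X ω + X' ω) * (Y ω + Y' ω) = X ω * Y ω + X' ω * Y ω + X ω * Y' ω + X' ω * Y' ω := fun ω => by ring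
  simp_rw [h]
  rw [integral_add (((integrable_mul_of_memLp hX hY).fun_add (integrable_mul_of_memLp hX' hY)).fun_add (integrable_mul_of_memLp hX hY'))
      (integrable_mul_of_memLp hX' hY'),
    integral_add ((integrable_mul_of_memLp hX hY).fun_add (integrable_mul_of_memLp hX' hY)) (integrable_mul_of_memLp hX hY'),
    integral_add (integrable_mul_of_memLp hX hY) (integrable_mul_of_memLp hX' hY)]

lemma integral_mul_comm' (X Y : Ω → ℝ) : ∫ ω, X ω * Y ω ∂P = ∫ ω, Y ω * X ω ∂P := by
  simp_rw [mul_comm]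

end Bilinear

/-! ### Moments of Wiener processes -/

section Wiener

variable {Ω : Type*} [MeasurableSpace Ω] {P : Measure Ω} [IsProbabilityMeasure P] {n : ℕ}
  {W : ℝ≥0 → Ω → Fin n → ℝ}

lemma IsWiener.integral_eq_zero (h : IsWiener P W) (t : ℝ≥0) (i) : ∫ ω, W t ω i ∂P = 0 :=
  (h.brownian i).integral_eval t

lemma IsWiener.memLp (h : IsWiener P W) (t : ℝ≥0) (i) : MemLp (fun ω => W t ω i) 2 P :=
  ((h.brownian i).hasLaw_eval t).hasGaussianLaw.memLp_two

lemma IsWiener.integral_mul (h : IsWiener P W) (s t : ℝ≥0) (i j) :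
    ∫ ω, W s ω i * W t ω j ∂P = if i = j then (min s t : ℝ) else 0 := by
  split_ifs with hij
  · subst hij
    have h1 := (h.brownian i).covariance_fun_eval s t
    rw [covariance_eq_sub (h.memLp s i) (h.memLp t i), h.integral_eq_zero, zero_mul, sub_zero] at h1
    rw [← NNReal.coe_min, ← h1]
    rfl
  · have h1 : IndepFun (fun ω => W s ω i) (fun ω => W t ω j) P :=
      (h.indep.indepFun hij).comp (measurable_pi_apply s) (measurable_pi_apply t)
    rw [h1.integral_fun_mul_eq_mul_integral (h.memLp s i).1 (h.memLp t j).1, h.integral_eq_zero, zero_mul]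

lemma IsWiener.isSecondOrder (h : IsWiener P W) (i) : IsSecondOrder P fun t ω => W t.toNNReal ω i where
  aemeasurable t _ := (h.memLp _ i).1.aemeasurable
  continuous := by
    filter_upwards [(h.brownian i).cont] with ω hω
    exact (hω.comp continuous_real_toNNReal).continuousOn
  memLp t _ := h.memLp _ i
  bound T := ⟨T, fun t ht htT => by
    rw [h.integral_mul, if_pos rfl, min_self, Real.coe_toNNReal _ ht]; exact htT⟩

lemma IsWiener.integral_mul_toNNReal (h : IsWiener P W) (i j) (s r : ℝ) (hs : 0 ≤ s) (hr : 0 ≤ r) :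
    ∫ ω, W s.toNNReal ω i * W r.toNNReal ω j ∂P = (if i = j then 1 else 0) * min s r := by
  rw [h.integral_mul, Real.coe_toNNReal _ hs, Real.coe_toNNReal _ hr]
  split_ifs <;> simp

end Wiener

/-! ### Ornstein-Uhlenbeck processes: representation and stationary covariance -/

section OU

variable {Ω : Type*} [MeasurableSpace Ω] {P : Measure Ω} [IsProbabilityMeasure P] {n p r : ℕ}
  {A : Realization n p r} {W : ℝ≥0 → Ω → Fin p → ℝ} {β : ℝ → Ω → Fin n → ℝ}

lemma IsOU.memLp_zero (h : IsOU A P W β) (i) : MemLp (fun ω => β 0 ω i) 2 P := by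
  have h1 : HasGaussianLaw (fun ω => WithLp.toLp 2 (β 0 ω)) P := ⟨by rw [h.law_zero.map_eq]; infer_instance⟩
  exact (h1.map_fun (EuclideanSpace.proj i : EuclideanSpace ℝ (Fin n) →L[ℝ] ℝ)).memLp_two

lemma IsOU.integral_zero (h : IsOU A P W β) (i) : ∫ ω, β 0 ω i ∂P = 0 := by
  have h1 := h.law_zero.integral_comp (f := fun x : EuclideanSpace ℝ (Fin n) => x i) (by fun_prop)
  have h2 : ∫ x, x i ∂(multivariateGaussian 0 A.M) = (∫ x, x ∂(multivariateGaussian 0 A.M)) i :=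
    ContinuousLinearMap.integral_comp_comm (EuclideanSpace.proj i : EuclideanSpace ℝ (Fin n) →L[ℝ] ℝ) (IsGaussian.integrable_id)
  rw [h2, integral_id_multivariateGaussian] at h1
  simpa [Function.comp_def] using h1

lemma IsOU.integral_zero_mul (h : IsOU A P W β) (hA : A.Admissible) (i j) : ∫ ω, β 0 ω i * β 0 ω j ∂P = A.M i j := by
  have h1 := covariance_eval_multivariateGaussian (μ := 0) hA.posDef.posSemidef i j
  have h2 := h.law_zero.covariance_fun_comp (f := fun x : EuclideanSpace ℝ (Fin n) => x i) (g := fun x => x j) (by fun_prop) (by fun_prop)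
  rw [h1] at h2
  simp only at h2
  rw [covariance_eq_sub (h.memLp_zero i) (h.memLp_zero j), h.integral_zero, zero_mul, sub_zero] at h2
  exact h2

lemma IsOU.continuousOn (h : IsOU A P W β) : ∀ᵐ ω ∂P, ∀ i, ContinuousOn (fun t => β t ω i) (Set.Ici 0) := by
  filter_upwards [h.continuous] with ω hω i
  exact (continuous_apply i).comp_continuousOn hω

lemma IsOU.sde_apply (h : IsOU A P W β) : ∀ᵐ ω ∂P, ∀ t : ℝ, 0 ≤ t → ∀ i,
    β t ω i = β 0 ω i + (∫ s in (0 : ℝ)..t, (-A.Γ *ᵥ β s ω) i) + (A.S *ᵥ W t.toNNReal ω) i := by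
  filter_upwards [h.continuous, h.sde] with ω hc hs t ht i
  have h1 := congrFun (hs t.toNNReal) i
  rw [Real.coe_toNNReal _ ht] at h1
  have h2 : (∫ s in (0 : ℝ)..t, A.Γ *ᵥ β s ω) i = ∫ s in (0 : ℝ)..t, (A.Γ *ᵥ β s ω) i := by
    have hi : IntervalIntegrable (fun s => A.Γ *ᵥ β s ω) volume 0 t := by
      apply ContinuousOn.intervalIntegrable
      rw [Set.uIcc_of_le ht]
      exact (Continuous.matrix_mulVec continuous_const continuous_id).comp_continuousOn (hc.mono Set.Icc_subset_Ici_self)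
    exact ((ContinuousLinearMap.proj (R := ℝ) (φ := fun _ : Fin n => ℝ) i).intervalIntegral_comp_comm hi).symm
  rw [h1]
  simp only [Pi.add_apply, Pi.sub_apply]
  rw [h2]
  simp only [Matrix.neg_mulVec, Pi.neg_apply, intervalIntegral.integral_neg]
  ring

/-- The Ornstein-Uhlenbeck process in terms of its initial value and its Wiener process. -/
noncomputable def ouRep (A : Realization n p r) (W : ℝ≥0 → Ω → Fin p → ℝ) (β : ℝ → Ω → Fin n → ℝ) (t : ℝ) (i : Fin n) (ω : Ω) : ℝ :=
  (∑ k, NormedSpace.exp (t • -A.Γ) i k * β 0 ω k) +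
    ∑ l, partsIntegral (fun t ω => W t.toNNReal ω l) (fun s => (NormedSpace.exp ((t - s) • -A.Γ) * A.S) i l)
      (fun s => (NormedSpace.exp ((t - s) • -A.Γ) * (A.Γ * A.S)) i l) t ω

/-- Variation of constants with forcing `Σ W`. The coefficient `e^{-Γ(t-s)} Σ` equals `Σ` at `s =
t`, so the additive forcing is exactly the boundary term of the integration by parts. -/
lemma IsOU.eq_ouRep (h : IsOU A P W β) : ∀ᵐ ω ∂P, ∀ t : ℝ, 0 ≤ t → ∀ i, β t ω i = ouRep A W β t i ω := by
  filter_upwards [h.continuousOn, h.sde_apply, ae_all_iff.2 fun l => (h.wiener.brownian l).cont] with ω hc hs hW t ht i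
  have hWc : ∀ l, Continuous fun t : ℝ => W t.toNNReal ω l := fun l => (hW l).comp continuous_real_toNNReal
  have h1 := variation_of_constants (-A.Γ) (fun t => β t ω) (fun t => A.S *ᵥ W t.toNNReal ω) (fun _ => 0) hc
    (fun i => continuousOn_const) (fun t ht i => by simpa using hs t ht i) t ht i
  rw [h1, ouRep, add_assoc]
  congr 1
  simp only [partsIntegral, Finset.sum_sub_distrib, sub_self, zero_smul, NormedSpace.exp_zero, Matrix.one_mul]
  rw [sub_eq_add_neg]
  congr 1
  rw [← intervalIntegral.integral_finsetSum, ← intervalIntegral.integral_neg]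
  · refine intervalIntegral.integral_congr fun s _ => ?_
    simp only [Matrix.mulVec_zero, Pi.zero_apply, add_zero, Matrix.mulVec_mulVec, Matrix.mul_neg, Matrix.neg_mul, Matrix.neg_mulVec, Pi.neg_apply, ← Matrix.mul_assoc]
    rfl
  · intro l _
    exact ((continuous_exp_sub_smul_mul_apply _ _ t i l).mul (hWc l)).intervalIntegrable _ _

lemma hasDerivAt_exp_sub_neg_smul_mul_apply {κ : Type*} (Γ : Matrix (Fin n) (Fin n) ℝ) (N : Matrix (Fin n) κ ℝ) (t s : ℝ) (i : Fin n) (l : κ) :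
    HasDerivAt (fun s => (NormedSpace.exp ((t - s) • -Γ) * N) i l) ((NormedSpace.exp ((t - s) • -Γ) * (Γ * N)) i l) s := by
  have h1 : HasDerivAt (fun s => ∑ k, NormedSpace.exp ((t - s) • -Γ) i k * N k l)
    (∑ k, -(NormedSpace.exp ((t - s) • -Γ) * -Γ) i k * N k l) s :=
    HasDerivAt.fun_sum fun k _ => (hasDerivAt_exp_sub_smul_apply (-Γ) t s i k).mul_const _
  have h2 : ∑ k, -(NormedSpace.exp ((t - s) • -Γ) * -Γ) i k * N k l = (NormedSpace.exp ((t - s) • -Γ) * (Γ * N)) i l := by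
    rw [← Matrix.mul_assoc, Matrix.mul_apply (N := N)]
    refine Finset.sum_congr rfl fun k _ => ?_
    rw [Matrix.mul_neg, Matrix.neg_apply, neg_neg]
  rw [h2] at h1
  exact h1

lemma IsOU.memLp_sum_zero (h : IsOU A P W β) (t : ℝ) (i) : MemLp (fun ω => ∑ k, NormedSpace.exp (t • -A.Γ) i k * β 0 ω k) 2 P :=
  memLp_finsetSum _ fun k _ => (h.memLp_zero k).const_mul _

lemma IsOU.memLp_partsIntegral (h : IsOU A P W β) {t : ℝ} (ht : 0 ≤ t) (i) (l) :
    MemLp (partsIntegral (fun t ω => W t.toNNReal ω l) (fun s => (NormedSpace.exp ((t - s) • -A.Γ) * A.S) i l)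
      (fun s => (NormedSpace.exp ((t - s) • -A.Γ) * (A.Γ * A.S)) i l) t) 2 P :=
  (h.wiener.isSecondOrder l).memLp_partsIntegral _ (continuous_exp_sub_smul_mul_apply _ _ t i l) ht

lemma IsOU.memLp_ouRep (h : IsOU A P W β) {t : ℝ} (ht : 0 ≤ t) (i) : MemLp (ouRep A W β t i) 2 P :=
  (h.memLp_sum_zero t i).add (memLp_finsetSum _ fun l _ => h.memLp_partsIntegral ht i l)

lemma IsOU.ae_eq_ouRep (h : IsOU A P W β) {t : ℝ} (ht : 0 ≤ t) (i) : (fun ω => β t ω i) =ᵐ[P] ouRep A W β t i :=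
  h.eq_ouRep.mono fun _ hω => hω t ht i

lemma IsOU.memLp (h : IsOU A P W β) {t : ℝ} (ht : 0 ≤ t) (i) : MemLp (fun ω => β t ω i) 2 P :=
  (memLp_congr_ae (h.ae_eq_ouRep ht i)).2 (h.memLp_ouRep ht i)

lemma IsOU.integral_eq_zero (h : IsOU A P W β) {t : ℝ} (ht : 0 ≤ t) (i) : ∫ ω, β t ω i ∂P = 0 := by
  rw [integral_congr_ae (h.ae_eq_ouRep ht i)]
  simp only [ouRep]
  rw [integral_add ((h.memLp_sum_zero t i).integrable (by norm_num))
    ((memLp_finsetSum _ fun l _ => h.memLp_partsIntegral ht i l).integrable (by norm_num)),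
    integral_finsetSum _ fun k _ => ((h.memLp_zero k).const_mul _).integrable (by norm_num),
    integral_finsetSum _ fun l _ => (h.memLp_partsIntegral ht i l).integrable (by norm_num)]
  simp only [integral_const_mul, h.integral_zero, mul_zero, Finset.sum_const_zero, zero_add]
  refine Finset.sum_eq_zero fun l _ => ?_
  have h1 := (h.wiener.isSecondOrder l).integral_partsIntegral_mul (fun s => (NormedSpace.exp ((t - s) • -A.Γ) * A.S) i l)
    (continuous_exp_sub_smul_mul_apply (-A.Γ) (A.Γ * A.S) t i l) ht (fun _ => 1) (memLp_const 1)
  simp only [mul_one, h.wiener.integral_eq_zero, mul_zero, intervalIntegral.integral_zero, sub_zero] at h1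
  exact h1

/-- The initial value contributes `e^{-Γs} M e^{-Γ*u}` and the isometry contributes `∫₀ᵘ e^{-Γ(s-r)}
Σ Σ* e^{-Γ*(u-r)} dr`. By the Lyapunov equation the integrand is the derivative of `e^{-Γ(s-r)} M
e^{-Γ*(u-r)}`; its value at `r = 0` cancels the first contribution. -/
lemma IsOU.integral_mul (h : IsOU A P W β) (hA : A.Admissible) {s u : ℝ} (hu : 0 ≤ u) (hus : u ≤ s) (i j) :
    ∫ ω, β s ω i * β u ω j ∂P = (NormedSpace.exp ((s - u) • -A.Γ) * A.M) i j := by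
  have hs := hu.trans hus
  have h0 : ∫ ω, β s ω i * β u ω j ∂P = ∫ ω, ouRep A W β s i ω * ouRep A W β u j ω ∂P := by
    refine integral_congr_ae ?_
    filter_upwards [h.ae_eq_ouRep hs i, h.ae_eq_ouRep hu j] with ω h1 h2
    rw [h1, h2]
  set a := fun (t : ℝ) (i : Fin n) ω => ∑ k, NormedSpace.exp (t • -A.Γ) i k * β 0 ω k with ha
  set b := fun (t : ℝ) (i : Fin n) (l : Fin p) => partsIntegral (fun t ω => W t.toNNReal ω l) (fun s => (NormedSpace.exp ((t - s) • -A.Γ) * A.S) i l)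
      (fun s => (NormedSpace.exp ((t - s) • -A.Γ) * (A.Γ * A.S)) i l) t with hb
  have haL : ∀ t i, MemLp (a t i) 2 P := fun t i => h.memLp_sum_zero t i
  have hbL : ∀ t, 0 ≤ t → ∀ i l, MemLp (b t i l) 2 P := fun t ht i l => h.memLp_partsIntegral ht i l
  -- Independence of the initial value and the Wiener process, which is centred.
  have hcross : ∀ t, 0 ≤ t → ∀ t' i j l, ∫ ω, b t i l ω * a t' j ω ∂P = 0 := by
    intro t ht t' i j l
    have h1 := (h.wiener.isSecondOrder l).integral_partsIntegral_mul (fun s => (NormedSpace.exp ((t - s) • -A.Γ) * A.S) i l)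
      (continuous_exp_sub_smul_mul_apply (-A.Γ) (A.Γ * A.S) t i l) ht (a t' j) (haL t' j)
    have h2 : ∀ r : ℝ, ∫ ω, W r.toNNReal ω l * a t' j ω ∂P = 0 := by
      intro r
      simp only [ha]
      rw [integral_mul_sum (h.wiener.memLp _ l) fun k => (h.memLp_zero k).const_mul _]
      refine Finset.sum_eq_zero fun k _ => ?_
      have h3 : IndepFun (fun ω => W r.toNNReal ω l) (fun ω => NormedSpace.exp (t' • -A.Γ) j k * β 0 ω k) P :=
        (h.indep.comp (φ := fun x : Fin n → ℝ => NormedSpace.exp (t' • -A.Γ) j k * x k) (ψ := fun w : ℝ≥0 → Fin p → ℝ => w r.toNNReal l)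
          (by fun_prop) (by fun_prop)).symm
      rw [h3.integral_fun_mul_eq_mul_integral (h.wiener.memLp _ l).1 ((h.memLp_zero k).const_mul _).1, h.wiener.integral_eq_zero, zero_mul]
    simp only [h2, mul_zero, intervalIntegral.integral_zero, sub_zero] at h1
    exact h1
  -- The isometry asks for the earlier time in the first factor, so it is applied with the factors
  -- exchanged.
  have hbb : ∀ l l', ∫ ω, b s i l ω * b u j l' ω ∂P = (if l = l' then 1 else 0) * ∫ r in (0 : ℝ)..u,
      (NormedSpace.exp ((s - r) • -A.Γ) * A.S) i l * (NormedSpace.exp ((u - r) • -A.Γ) * A.S) j l' := by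
    intro l l'
    have h1 := integral_partsIntegral_mul_partsIntegral (h.wiener.isSecondOrder l') (h.wiener.isSecondOrder l) (if l = l' then 1 else 0)
      (fun s r hs hr => by simpa [eq_comm] using h.wiener.integral_mul_toNNReal l' l s r hs hr)
      (hasDerivAt_exp_sub_neg_smul_mul_apply A.Γ A.S u · j l') (continuous_exp_sub_smul_mul_apply _ _ u j l')
      (hasDerivAt_exp_sub_neg_smul_mul_apply A.Γ A.S s · i l) (continuous_exp_sub_smul_mul_apply _ _ s i l) hu hus
    rw [integral_mul_comm', h1]
    congr 1
    refine intervalIntegral.integral_congr fun r _ => mul_comm _ _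
  have haa : ∫ ω, a s i ω * a u j ω ∂P = (NormedSpace.exp (s • -A.Γ) * A.M * (NormedSpace.exp (u • -A.Γ))ᵀ) i j := by
    rw [ha, integral_sum_mul (fun k => (h.memLp_zero k).const_mul _) (haL u j)]
    simp_rw [ha, integral_mul_sum ((h.memLp_zero _).const_mul _) fun k' => (h.memLp_zero k').const_mul _]
    have h1 : ∀ k k', ∫ ω, NormedSpace.exp (s • -A.Γ) i k * β 0 ω k * (NormedSpace.exp (u • -A.Γ) j k' * β 0 ω k') ∂P
        = NormedSpace.exp (s • -A.Γ) i k * NormedSpace.exp (u • -A.Γ) j k' * A.M k k' := by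
      intro k k'
      rw [← h.integral_zero_mul hA, ← integral_const_mul]
      congr 1; funext ω; ring
    simp_rw [h1]
    rw [Finset.sum_comm, Matrix.mul_apply (N := (NormedSpace.exp (u • -A.Γ))ᵀ)]
    refine Finset.sum_congr rfl fun k' _ => ?_
    rw [Matrix.mul_apply, Finset.sum_mul]
    refine Finset.sum_congr rfl fun k _ => ?_
    rw [Matrix.transpose_apply]; ring
  have hsplit : ∫ ω, ouRep A W β s i ω * ouRep A W β u j ω ∂P = ∫ ω, a s i ω * a u j ω ∂P + ∑ l, ∑ l', ∫ ω, b s i l ω * b u j l' ω ∂P := by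
    have hBL : ∀ t, 0 ≤ t → ∀ i, MemLp (fun ω => ∑ l, b t i l ω) 2 P := fun t ht i => memLp_finsetSum _ fun l _ => hbL t ht i l
    have e1 : ∀ t i, ouRep A W β t i = fun ω => a t i ω + ∑ l, b t i l ω := fun t i => rfl
    rw [e1, e1, integral_add_mul_add (haL s i) (hBL s hs i) (haL u j) (hBL u hu j), integral_sum_mul (hbL s hs i) (haL u j),
      integral_mul_comm' (a s i) fun ω => ∑ l, b u j l ω, integral_sum_mul (hbL u hu j) (haL s i), integral_sum_mul (hbL s hs i) (hBL u hu j)]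
    simp only [hcross u hu, hcross s hs, Finset.sum_const_zero, add_zero, integral_mul_sum (hbL s hs i _) (hbL u hu j)]
  have hbsum : ∑ l, ∑ l', ∫ ω, b s i l ω * b u j l' ω ∂P = ∫ r in (0 : ℝ)..u, (NormedSpace.exp ((s - r) • -A.Γ) * (A.S * A.Sᵀ) * (NormedSpace.exp ((u - r) • -A.Γ))ᵀ) i j := by
    have e1 : ∀ r : ℝ, (NormedSpace.exp ((s - r) • -A.Γ) * (A.S * A.Sᵀ) * (NormedSpace.exp ((u - r) • -A.Γ))ᵀ) i j
        = ∑ l, (NormedSpace.exp ((s - r) • -A.Γ) * A.S) i l * (NormedSpace.exp ((u - r) • -A.Γ) * A.S) j l := by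
      intro r
      have : NormedSpace.exp ((s - r) • -A.Γ) * (A.S * A.Sᵀ) * (NormedSpace.exp ((u - r) • -A.Γ))ᵀ
        = (NormedSpace.exp ((s - r) • -A.Γ) * A.S) * (NormedSpace.exp ((u - r) • -A.Γ) * A.S)ᵀ := by
        rw [Matrix.transpose_mul]; simp only [Matrix.mul_assoc]
      rw [this, Matrix.mul_apply]; rfl
    simp_rw [e1]
    rw [intervalIntegral.integral_finsetSum]
    · refine Finset.sum_congr rfl fun l _ => ?_
      simp_rw [hbb]
      simp
    · intro l _
      exact ((continuous_exp_sub_smul_mul_apply _ _ s i l).mul (continuous_exp_sub_smul_mul_apply _ _ u j l)).intervalIntegrable _ _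
  rw [h0, hsplit, haa, hbsum]
  -- The two terms of the product rule are the two terms of the Lyapunov equation.
  have hder : ∀ r, HasDerivAt (fun r => ∑ k, (NormedSpace.exp ((s - r) • -A.Γ) * A.M) i k * NormedSpace.exp ((u - r) • -A.Γ) j k)
      ((NormedSpace.exp ((s - r) • -A.Γ) * (A.S * A.Sᵀ) * (NormedSpace.exp ((u - r) • -A.Γ))ᵀ) i j) r := by
    intro r
    have h1 := HasDerivAt.fun_sum (u := Finset.univ) fun k (_ : k ∈ Finset.univ) =>
      (hasDerivAt_exp_sub_neg_smul_mul_apply A.Γ A.M s r i k).fun_mul (hasDerivAt_exp_sub_smul_apply (-A.Γ) u r j k)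
    refine h1.congr_deriv ?_
    rw [← hA.lyapunov, Matrix.mul_add, Matrix.add_mul, Matrix.add_apply, Finset.sum_add_distrib]
    congr 1
    rw [show NormedSpace.exp ((s - r) • -A.Γ) * (A.M * A.Γᵀ) * (NormedSpace.exp ((u - r) • -A.Γ))ᵀ =
      NormedSpace.exp ((s - r) • -A.Γ) * A.M * (NormedSpace.exp ((u - r) • -A.Γ) * A.Γ)ᵀ by
        rw [Matrix.transpose_mul]; simp only [Matrix.mul_assoc], Matrix.mul_apply (N := (NormedSpace.exp ((u - r) • -A.Γ) * A.Γ)ᵀ)]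
    refine Finset.sum_congr rfl fun k _ => ?_
    rw [Matrix.transpose_apply, Matrix.mul_neg, Matrix.neg_apply, neg_neg]
  have hcont : Continuous fun r => (NormedSpace.exp ((s - r) • -A.Γ) * (A.S * A.Sᵀ) * (NormedSpace.exp ((u - r) • -A.Γ))ᵀ) i j := by
    simp only [Matrix.mul_apply (N := (NormedSpace.exp _)ᵀ), Matrix.transpose_apply]
    exact continuous_finsetSum _ fun k _ => (continuous_exp_sub_smul_mul_apply _ _ s i k).mul (continuous_exp_sub_smul_apply _ u j k)
  rw [intervalIntegral.integral_eq_sub_of_hasDerivAt (fun r _ => hder r) (hcont.intervalIntegrable _ _)]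
  simp only [sub_self, sub_zero, zero_smul, NormedSpace.exp_zero, Matrix.one_apply, Matrix.mul_apply (N := (NormedSpace.exp _)ᵀ), Matrix.transpose_apply]
  simp

end OU

end GLE

namespace GLE

/-! ### Mean-square continuity and differentiability -/

section MeanSquare

variable {Ω : Type*} [MeasurableSpace Ω] {P : Measure Ω} [IsProbabilityMeasure P]

lemma integral_add_sq_le {X Y : Ω → ℝ} (hX : MemLp X 2 P) (hY : MemLp Y 2 P) :
    ∫ ω, (X ω + Y ω) * (X ω + Y ω) ∂P ≤ 2 * ∫ ω, X ω * X ω ∂P + 2 * ∫ ω, Y ω * Y ω ∂P := by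
  rw [← integral_const_mul, ← integral_const_mul, ← integral_add ((integrable_mul_of_memLp hX hX).const_mul 2) ((integrable_mul_of_memLp hY hY).const_mul 2)]
  refine integral_mono (integrable_mul_of_memLp (hX.add hY) (hX.add hY))
    (((integrable_mul_of_memLp hX hX).const_mul 2).add ((integrable_mul_of_memLp hY hY).const_mul 2)) fun ω => ?_
  beta_reduce
  nlinarith [sq_nonneg (X ω - Y ω)]

lemma IsSecondOrder.add {X Y : ℝ → Ω → ℝ} (hX : IsSecondOrder P X) (hY : IsSecondOrder P Y) :
    IsSecondOrder P fun t ω => X t ω + Y t ω where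
  aemeasurable t ht := (hX.aemeasurable t ht).add (hY.aemeasurable t ht)
  continuous := by
    filter_upwards [hX.continuous, hY.continuous] with ω h1 h2 using h1.add h2
  memLp t ht := (hX.memLp t ht).add (hY.memLp t ht)
  bound T := by
    obtain ⟨C, hC⟩ := hX.bound T
    obtain ⟨C', hC'⟩ := hY.bound T
    exact ⟨2 * C + 2 * C', fun t h0 hT => (integral_add_sq_le (hX.memLp t h0) (hY.memLp t h0)).trans (by linarith [hC t h0 hT, hC' t h0 hT])⟩

lemma IsSecondOrder.const_mul {X : ℝ → Ω → ℝ} (hX : IsSecondOrder P X) (c : ℝ) :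
    IsSecondOrder P fun t ω => c * X t ω where
  aemeasurable t ht := (hX.aemeasurable t ht).const_mul c
  continuous := by
    filter_upwards [hX.continuous] with ω h1 using continuousOn_const.mul h1
  memLp t ht := (hX.memLp t ht).const_mul c
  bound T := by
    obtain ⟨C, hC⟩ := hX.bound T
    refine ⟨c ^ 2 * C, fun t h0 hT => ?_⟩
    have : ∀ ω, c * X t ω * (c * X t ω) = c ^ 2 * (X t ω * X t ω) := fun ω => by ring
    simp_rw [this]
    rw [integral_const_mul]
    exact mul_le_mul_of_nonneg_left (hC t h0 hT) (sq_nonneg c)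

lemma IsSecondOrder.of_memLp {X : Ω → ℝ} (hX : MemLp X 2 P) : IsSecondOrder P fun _ => X where
  aemeasurable _ _ := hX.1.aemeasurable
  continuous := Eventually.of_forall fun _ => continuousOn_const
  memLp _ _ := hX
  bound _ := ⟨_, fun _ _ _ => le_rfl⟩

lemma IsSecondOrder.sum {κ : Type*} (s : Finset κ) {X : κ → ℝ → Ω → ℝ} (hX : ∀ k, IsSecondOrder P (X k)) :
    IsSecondOrder P fun t ω => ∑ k ∈ s, X k t ω := by
  classical
  induction s using Finset.induction_on with
  | empty => simpa using IsSecondOrder.of_memLp (P := P) (memLp_const (0 : ℝ))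
  | insert a s ha ih => simpa only [Finset.sum_insert ha] using (hX a).add ih

/-- Mean-square continuity on `[0, ∞)`. -/
def IsMSContinuous (P : Measure Ω) (X : ℝ → Ω → ℝ) : Prop :=
  ∀ t, 0 ≤ t → Tendsto (fun s => ∫ ω, (X s ω - X t ω) * (X s ω - X t ω) ∂P) (𝓝[Set.Ici 0] t) (𝓝 0)

lemma IsMSContinuous.add {X Y : ℝ → Ω → ℝ} (hX : IsSecondOrder P X) (hY : IsSecondOrder P Y) (h : IsMSContinuous P X)
    (h' : IsMSContinuous P Y) : IsMSContinuous P fun t ω => X t ω + Y t ω := by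
  intro t ht
  have h1 := ((h t ht).const_mul 2).add ((h' t ht).const_mul 2)
  rw [mul_zero, add_zero] at h1
  refine squeeze_zero' (Eventually.of_forall fun s => integral_nonneg fun ω => mul_self_nonneg _) ?_ h1
  filter_upwards [self_mem_nhdsWithin] with s hs
  have h2 := integral_add_sq_le ((hX.memLp s hs).sub (hX.memLp t ht)) ((hY.memLp s hs).sub (hY.memLp t ht))
  simp only [Pi.sub_apply] at h2
  refine le_trans (le_of_eq ?_) h2
  congr 1; funext ω; ring

lemma IsMSContinuous.const_mul {X : ℝ → Ω → ℝ} (h : IsMSContinuous P X) (c : ℝ) :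
    IsMSContinuous P fun t ω => c * X t ω := by
  intro t ht
  have h1 := (h t ht).const_mul (c ^ 2)
  rw [mul_zero] at h1
  refine h1.congr fun s => ?_
  rw [← integral_const_mul]
  congr 1; funext ω; ring

lemma IsMSContinuous.sum {κ : Type*} (s : Finset κ) {X : κ → ℝ → Ω → ℝ} (hX : ∀ k, IsSecondOrder P (X k))
    (h : ∀ k, IsMSContinuous P (X k)) : IsMSContinuous P fun t ω => ∑ k ∈ s, X k t ω := by
  classical
  induction s using Finset.induction_on with
  | empty => intro t _; simpa using tendsto_const_nhds
  | insert a s ha ih => simpa only [Finset.sum_insert ha] using IsMSContinuous.add (hX a) (IsSecondOrder.sum s hX) (h a) ih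

lemma IsSecondOrder.sub_const {X : ℝ → Ω → ℝ} (hX : IsSecondOrder P X) {t : ℝ} (ht : 0 ≤ t) :
    IsSecondOrder P fun s ω => X s ω - X t ω := by
  have h := hX.add ((IsSecondOrder.of_memLp (hX.memLp t ht)).const_mul (-1))
  simpa only [neg_one_mul, ← sub_eq_add_neg] using h

/-- The second moment of a time integral is controlled by the second moments of the integrand. -/
lemma IsSecondOrder.integral_sq_le {X : ℝ → Ω → ℝ} (hX : IsSecondOrder P X) {a b ε : ℝ} (ha : 0 ≤ a) (hab : a ≤ b)
    (hε : ∀ s ∈ Set.Icc a b, ∫ ω, X s ω * X s ω ∂P ≤ ε) :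
    ∫ ω, (∫ s in a..b, X s ω) * (∫ s in a..b, X s ω) ∂P ≤ ε * (b - a) ^ 2 := by
  have hI := hX.integral ha hab (f := fun _ => 1) continuous_const
  simp only [one_mul] at hI
  rw [hI.2 _ hI.1]
  -- Polarization: `2|xy| ≤ x² + y²` bounds mixed moments by the bound on second moments.
  have h1 : ∀ s ∈ Set.Icc a b, ∀ r ∈ Set.Icc a b, ‖∫ ω, X r ω * X s ω ∂P‖ ≤ ε := by
    intro s hs r hr
    have hs' := hX.memLp s (ha.trans hs.1)
    have hr' := hX.memLp r (ha.trans hr.1)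
    refine (norm_integral_le_integral_norm _).trans ?_
    have h2 : ∫ ω, ‖X r ω * X s ω‖ ∂P ≤ ∫ ω, (1 / 2 * (X r ω * X r ω) + 1 / 2 * (X s ω * X s ω)) ∂P := by
      refine integral_mono (integrable_mul_of_memLp hr' hs').norm
        (((integrable_mul_of_memLp hr' hr').const_mul _).add ((integrable_mul_of_memLp hs' hs').const_mul _)) fun ω => ?_
      simp only
      rw [Real.norm_eq_abs, abs_mul]
      nlinarith [sq_nonneg (|X r ω| - |X s ω|), abs_mul_abs_self (X r ω), abs_mul_abs_self (X s ω)]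
    refine h2.trans ?_
    rw [integral_add ((integrable_mul_of_memLp hr' hr').const_mul _) ((integrable_mul_of_memLp hs' hs').const_mul _), integral_const_mul, integral_const_mul]
    linarith [hε s hs, hε r hr]
  have h3 : ∀ s ∈ Set.Icc a b, ‖∫ ω, X s ω * (∫ r in a..b, X r ω) ∂P‖ ≤ ε * (b - a) := by
    intro s hs
    rw [integral_mul_comm', hI.2 _ (hX.memLp s (ha.trans hs.1))]
    have := intervalIntegral.norm_integral_le_of_norm_le_const (a := a) (b := b) (C := ε) (f := fun r => ∫ ω, X r ω * X s ω ∂P)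
      fun r hr => h1 s hs r (by rw [Set.uIoc_of_le hab] at hr; exact ⟨hr.1.le, hr.2⟩)
    rwa [abs_of_nonneg (by linarith)] at this
  have h4 := intervalIntegral.norm_integral_le_of_norm_le_const (a := a) (b := b) (C := ε * (b - a)) (f := fun s => ∫ ω, X s ω * (∫ r in a..b, X r ω) ∂P)
      fun r hr => h3 r (by rw [Set.uIoc_of_le hab] at hr; exact ⟨hr.1.le, hr.2⟩)
  rw [abs_of_nonneg (by linarith)] at h4
  exact (le_abs_self _).trans (h4.trans (le_of_eq (by ring)))

/-- The average minus the value is the average of `X_s - X_t`. Its second moment is at most the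
supremum of the second moments of these increments, which mean-square continuity makes small. -/
lemma IsMSContinuous.tendsto_average {X : ℝ → Ω → ℝ} (hX : IsSecondOrder P X) (h : IsMSContinuous P X) {t : ℝ} (ht : 0 ≤ t) :
    Tendsto (fun δ : ℝ => eLpNorm (fun ω => δ⁻¹ * (∫ s in t..(t + δ), X s ω) - X t ω) 2 P)
      (𝓝[{δ : ℝ | δ ≠ 0 ∧ 0 ≤ t + δ}] 0) (𝓝 0) := by
  have hD := hX.sub_const ht
  have key : ∀ ε : ℝ, 0 < ε → ∀ᶠ δ in 𝓝[{δ : ℝ | δ ≠ 0 ∧ 0 ≤ t + δ}] 0,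
      eLpNorm (fun ω => δ⁻¹ * (∫ s in t..(t + δ), X s ω) - X t ω) 2 P ≤ ENNReal.ofReal ε := by
    intro ε hε
    have h1 := (h t ht).eventually (gt_mem_nhds (show (0 : ℝ) < ε ^ 2 by positivity))
    rw [eventually_nhdsWithin_iff, Metric.eventually_nhds_iff] at h1
    obtain ⟨η, hη, hη'⟩ := h1
    rw [eventually_nhdsWithin_iff, Metric.eventually_nhds_iff]
    refine ⟨η, hη, fun δ hδ hδ' => ?_⟩
    obtain ⟨hδ0, hδt⟩ := hδ'
    rw [dist_zero_right, Real.norm_eq_abs] at hδ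
    have hbound : ∀ s, 0 ≤ s → |s - t| ≤ |δ| → ∫ ω, (X s ω - X t ω) * (X s ω - X t ω) ∂P ≤ ε ^ 2 := fun s hs hst =>
      (hη' (by rw [Real.dist_eq]; linarith) hs).le
    -- Both signs of `δ` occur away from `t = 0`; for negative `δ` the interval is reversed, which
    -- the square does not see.
    have hsq : MemLp (fun ω => ∫ s in t..(t + δ), (X s ω - X t ω)) 2 P ∧
        ∫ ω, (∫ s in t..(t + δ), (X s ω - X t ω)) * (∫ s in t..(t + δ), (X s ω - X t ω)) ∂P ≤ ε ^ 2 * δ ^ 2 := by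
      rcases le_total 0 δ with hd | hd
      · have h2 := hD.integral_sq_le (a := t) (b := t + δ) (ε := ε ^ 2) ht (by linarith) fun s hs => hbound s (ht.trans hs.1) (by
          rw [abs_of_nonneg (by linarith [hs.1]), abs_of_nonneg hd]; linarith [hs.2])
        have h3 := (hD.integral ht (show t ≤ t + δ by linarith) (f := fun _ => 1) continuous_const).1
        simp only [one_mul] at h3
        rw [add_sub_cancel_left] at h2
        exact ⟨h3, h2⟩
      · have h2 := hD.integral_sq_le (a := t + δ) (b := t) (ε := ε ^ 2) hδt (by linarith) fun s hs => hbound s (hδt.trans hs.1) (by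
          rw [abs_of_nonpos (by linarith [hs.2]), abs_of_nonpos hd]; linarith [hs.1])
        have h3 := (hD.integral hδt (show t + δ ≤ t by linarith) (f := fun _ => 1) continuous_const).1
        simp only [one_mul] at h3
        rw [show (t - (t + δ)) ^ 2 = δ ^ 2 by ring] at h2
        have h4 : ∀ ω, ∫ s in t..(t + δ), (X s ω - X t ω) = - ∫ s in (t + δ)..t, (X s ω - X t ω) := fun ω =>
          intervalIntegral.integral_symm _ _
        simp_rw [h4, neg_mul_neg]
        exact ⟨h3.neg, h2⟩
    have hrep : ∀ᵐ ω ∂P, δ⁻¹ * (∫ s in t..(t + δ), X s ω) - X t ω = δ⁻¹ * ∫ s in t..(t + δ), (X s ω - X t ω) := by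
      filter_upwards [hX.continuous] with ω hω
      rw [intervalIntegral.integral_sub _ intervalIntegrable_const, intervalIntegral.integral_const]
      · rw [add_sub_cancel_left, smul_eq_mul, mul_sub, inv_mul_cancel_left₀ hδ0]
      · refine (hω.mono fun s hs => ?_).intervalIntegrable
        exact (le_min ht hδt).trans hs.1
    rw [eLpNorm_congr_ae hrep]
    have hL : MemLp (fun ω => δ⁻¹ * ∫ s in t..(t + δ), (X s ω - X t ω)) 2 P := hsq.1.const_mul _
    rw [hL.eLpNorm_eq_integral_rpow_norm (by norm_num) (by norm_num)]
    apply ENNReal.ofReal_le_ofReal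
    have h5 : ∫ ω, ‖δ⁻¹ * ∫ s in t..(t + δ), (X s ω - X t ω)‖ ^ (2 : ENNReal).toReal ∂P =
        (δ⁻¹) ^ 2 * ∫ ω, (∫ s in t..(t + δ), (X s ω - X t ω)) * (∫ s in t..(t + δ), (X s ω - X t ω)) ∂P := by
      rw [← integral_const_mul]
      congr 1; funext ω
      rw [ENNReal.toReal_ofNat, Real.rpow_ofNat, Real.norm_eq_abs, sq_abs]
      ring
    rw [h5]
    have h6 : (δ⁻¹) ^ 2 * ∫ ω, (∫ s in t..(t + δ), (X s ω - X t ω)) * (∫ s in t..(t + δ), (X s ω - X t ω)) ∂P ≤ ε ^ 2 := by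
      calc _ ≤ (δ⁻¹) ^ 2 * (ε ^ 2 * δ ^ 2) := by gcongr; exact hsq.2
        _ = ε ^ 2 := by field_simp
    calc _ ≤ (ε ^ 2) ^ ((2 : ENNReal).toReal)⁻¹ := by
          apply Real.rpow_le_rpow _ h6 (by norm_num)
          exact mul_nonneg (sq_nonneg _) (integral_nonneg fun ω => mul_self_nonneg _)
      _ = ε := by
          rw [ENNReal.toReal_ofNat, ← Real.rpow_natCast, ← Real.rpow_mul hε.le]; norm_num
  rw [ENNReal.tendsto_nhds_zero]
  intro ε hε
  rcases eq_or_ne ε ⊤ with rfl | htop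
  · exact Eventually.of_forall fun _ => le_top
  · filter_upwards [key ε.toReal (ENNReal.toReal_pos hε.ne' htop)] with δ hδ
    rwa [ENNReal.ofReal_toReal htop] at hδ

/-- A pathwise primitive of a mean-square continuous process has averages of that process as
difference quotients. The norm of the vector is at most the sum of the norms of its coordinates, so
the coordinates may be treated separately. -/
lemma isMSDeriv_of_integral {r : ℕ} {X Y : ℝ → Ω → Fin r → ℝ} (hY : ∀ i, IsSecondOrder P fun t ω => Y t ω i)
    (hc : ∀ i, IsMSContinuous P fun t ω => Y t ω i)
    (hXY : ∀ᵐ ω ∂P, ∀ t u, 0 ≤ t → 0 ≤ u → ∀ i, X u ω i - X t ω i = ∫ s in t..u, Y s ω i)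
    (hX : ∀ t, 0 ≤ t → ∀ i, MemLp (fun ω => X t ω i) 2 P) : IsMSDeriv P X Y := by
  intro t ht
  have h1 : Tendsto (fun δ : ℝ => ∑ i, eLpNorm (fun ω => δ⁻¹ * (∫ s in t..(t + δ), Y s ω i) - Y t ω i) 2 P)
      (𝓝[{δ : ℝ | δ ≠ 0 ∧ 0 ≤ t + δ}] 0) (𝓝 (∑ _i : Fin r, 0)) :=
    tendsto_finsetSum _ fun i _ => (hc i).tendsto_average (hY i) ht
  rw [Finset.sum_const_zero] at h1
  refine tendsto_of_tendsto_of_tendsto_of_le_of_le' tendsto_const_nhds h1 (Eventually.of_forall fun _ => zero_le) ?_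
  filter_upwards [self_mem_nhdsWithin] with δ hδ
  have h2 : ∀ i, (fun ω => (δ⁻¹ • (X (t + δ) ω - X t ω) - Y t ω) i) =ᵐ[P] fun ω => δ⁻¹ * (∫ s in t..(t + δ), Y s ω i) - Y t ω i := by
    intro i
    filter_upwards [hXY] with ω hω
    simp only [Pi.sub_apply, Pi.smul_apply, smul_eq_mul]
    rw [hω t (t + δ) ht hδ.2 i]
  have h3 : eLpNorm (fun ω => δ⁻¹ • (X (t + δ) ω - X t ω) - Y t ω) 2 P ≤ eLpNorm (∑ i, fun ω => ‖(δ⁻¹ • (X (t + δ) ω - X t ω) - Y t ω) i‖) 2 P := by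
    refine eLpNorm_mono fun ω => ?_
    rw [Finset.sum_apply, Real.norm_of_nonneg (Finset.sum_nonneg fun i _ => norm_nonneg _)]
    exact (pi_norm_le_iff_of_nonneg (Finset.sum_nonneg fun i _ => norm_nonneg _)).2 fun i =>
      Finset.single_le_sum (f := fun i => ‖(δ⁻¹ • (X (t + δ) ω - X t ω) - Y t ω) i‖) (fun i _ => norm_nonneg _) (Finset.mem_univ i)
  refine h3.trans ((eLpNorm_sum_le (fun i _ => ?_) (by norm_num)).trans (Finset.sum_le_sum fun i _ => ?_))
  · have : MemLp (fun ω => (δ⁻¹ • (X (t + δ) ω - X t ω) - Y t ω) i) 2 P :=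
      (((hX _ hδ.2 i).sub (hX t ht i)).const_mul δ⁻¹).sub ((hY i).memLp t ht)
    exact this.1.norm
  · rw [eLpNorm_norm, eLpNorm_congr_ae (h2 i)]

end MeanSquare

/-! ### Mean-square regularity of Ornstein-Uhlenbeck processes -/

section OU

variable {Ω : Type*} [MeasurableSpace Ω] {P : Measure Ω} [IsProbabilityMeasure P] {n p r : ℕ}
  {A : Realization n p r} {W : ℝ≥0 → Ω → Fin p → ℝ} {β : ℝ → Ω → Fin n → ℝ}

lemma IsOU.isSecondOrder (h : IsOU A P W β) (hA : A.Admissible) (i) : IsSecondOrder P fun t ω => β t ω i where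
  aemeasurable t ht := (h.memLp ht i).1.aemeasurable
  continuous := h.continuousOn.mono fun ω hω => hω i
  memLp t ht := h.memLp ht i
  bound _ := ⟨_, fun t ht _ => (h.integral_mul hA ht le_rfl i i).trans_le (by rw [sub_self])⟩

/-- By stationarity the second moment of an increment is `2 (M - e^{-Γ|s-t|} M)ᵢᵢ`, a continuous
function of `|s - t|` that vanishes at `0`. -/
lemma IsOU.isMSContinuous (h : IsOU A P W β) (hA : A.Admissible) (i) : IsMSContinuous P fun t ω => β t ω i := by
  intro t ht
  set ρ : ℝ → ℝ := fun τ => A.M i i + A.M i i - 2 * (NormedSpace.exp (τ • -A.Γ) * A.M) i i with hρ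
  have hρc : Continuous ρ := by
    have h0 : Continuous fun τ : ℝ => (NormedSpace.exp (τ • -A.Γ) * A.M) i i := by
      simp only [Matrix.mul_apply]
      exact continuous_finsetSum _ fun k _ => (continuous_exp_smul_apply (-A.Γ) i k).mul continuous_const
    exact continuous_const.sub (continuous_const.mul h0)
  have hρ0 : ρ 0 = 0 := by
    simp only [hρ, zero_smul, NormedSpace.exp_zero, Matrix.one_mul]; ring
  have h1 : Tendsto (fun s => ρ |s - t|) (𝓝[Set.Ici 0] t) (𝓝 0) := by
    have h2 : Continuous fun s => ρ |s - t| := hρc.comp (by fun_prop)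
    have h3 := (h2.tendsto t).mono_left (nhdsWithin_le_nhds (s := Set.Ici 0))
    simpa [hρ0] using h3
  refine h1.congr' ?_
  filter_upwards [self_mem_nhdsWithin] with s hs
  have hs : 0 ≤ s := hs
  have h4 : ∫ ω, β s ω i * β t ω i ∂P = (NormedSpace.exp (|s - t| • -A.Γ) * A.M) i i := by
    rcases le_total t s with hst | hst
    · rw [h.integral_mul hA ht hst, abs_of_nonneg (by linarith)]
    · rw [integral_mul_comm', h.integral_mul hA hs hst, abs_of_nonpos (by linarith), neg_sub]
  have h5 : ∀ u, 0 ≤ u → ∫ ω, β u ω i * β u ω i ∂P = A.M i i := fun u hu => by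
    rw [h.integral_mul hA hu le_rfl]; simp
  have h6 : ∀ ω, (β s ω i - β t ω i) * (β s ω i - β t ω i) = β s ω i * β s ω i + β t ω i * β t ω i - 2 * (β s ω i * β t ω i) := fun ω => by ring
  simp_rw [h6]
  rw [integral_sub ((integrable_mul_of_memLp (h.memLp hs i) (h.memLp hs i)).fun_add (integrable_mul_of_memLp (h.memLp ht i) (h.memLp ht i)))
    ((integrable_mul_of_memLp (h.memLp hs i) (h.memLp ht i)).const_mul 2),
    integral_add (integrable_mul_of_memLp (h.memLp hs i) (h.memLp hs i)) (integrable_mul_of_memLp (h.memLp ht i) (h.memLp ht i)),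
    integral_const_mul, h4, h5 s hs, h5 t ht]

lemma IsOU.isSecondOrder_mulVec (h : IsOU A P W β) (hA : A.Admissible) {m : ℕ} (X : Matrix (Fin m) (Fin n) ℝ) (i) :
    IsSecondOrder P fun t ω => (X *ᵥ β t ω) i := by
  simp only [Matrix.mulVec, dotProduct]
  exact IsSecondOrder.sum _ fun k => (h.isSecondOrder hA k).const_mul (X i k)

lemma IsOU.isMSContinuous_mulVec (h : IsOU A P W β) (hA : A.Admissible) {m : ℕ} (X : Matrix (Fin m) (Fin n) ℝ) (i) :
    IsMSContinuous P fun t ω => (X *ᵥ β t ω) i := by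
  simp only [Matrix.mulVec, dotProduct]
  exact IsMSContinuous.sum _ (fun k => (h.isSecondOrder hA k).const_mul (X i k)) fun k => (h.isMSContinuous hA k).const_mul _

lemma IsOU.integral_mulVec_mul (h : IsOU A P W β) (hA : A.Admissible) {m m' : ℕ} (X : Matrix (Fin m) (Fin n) ℝ)
    (Y : Matrix (Fin m') (Fin n) ℝ) {s u : ℝ} (hu : 0 ≤ u) (hus : u ≤ s) (i j) :
    ∫ ω, (X *ᵥ β s ω) i * (Y *ᵥ β u ω) j ∂P = (X * NormedSpace.exp ((s - u) • -A.Γ) * A.M * Yᵀ) i j := by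
  simp only [Matrix.mulVec, dotProduct]
  rw [integral_sum_mul (fun k => (h.memLp (hu.trans hus) k).const_mul _) (memLp_finsetSum _ fun k _ => (h.memLp hu k).const_mul _)]
  simp_rw [integral_mul_sum ((h.memLp (hu.trans hus) _).const_mul _) (fun k => (h.memLp hu k).const_mul _)]
  have h1 : ∀ k l, ∫ ω, X i k * β s ω k * (Y j l * β u ω l) ∂P = X i k * (NormedSpace.exp ((s - u) • -A.Γ) * A.M) k l * Y j l := by
    intro k l
    rw [← h.integral_mul hA hu hus, ← integral_const_mul, ← integral_mul_const]
    congr 1; funext ω; ring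
  simp_rw [h1]
  rw [Finset.sum_comm, Matrix.mul_assoc X, Matrix.mul_apply (N := Yᵀ)]
  refine Finset.sum_congr rfl fun l _ => ?_
  rw [Matrix.mul_apply (M := X), Finset.sum_mul]
  rfl

/-- The condition `X Σ = 0` removes the Wiener term from the equation of `X β`, so its paths are
ordinary primitives. -/
lemma IsOU.mulVec_sub_eq_integral (h : IsOU A P W β) {m : ℕ} (X : Matrix (Fin m) (Fin n) ℝ) (hX : X * A.S = 0) :
    ∀ᵐ ω ∂P, ∀ t u, 0 ≤ t → 0 ≤ u → ∀ i, (X *ᵥ β u ω) i - (X *ᵥ β t ω) i = ∫ s in t..u, ((-(X * A.Γ)) *ᵥ β s ω) i := by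
  filter_upwards [h.continuousOn, h.sde_apply] with ω hc hs t u ht hu i
  have hcont : ∀ k, ContinuousOn (fun s => (-A.Γ *ᵥ β s ω) k) (Set.Ici 0) := fun k => by
    simp only [Matrix.mulVec, dotProduct]
    exact continuousOn_finsetSum _ fun l _ => continuousOn_const.mul (hc l)
  have hint : ∀ {a b : ℝ}, 0 ≤ a → 0 ≤ b → ∀ k, IntervalIntegrable (fun s => (-A.Γ *ᵥ β s ω) k) volume a b := fun ha hb k =>
    ((hcont k).mono fun s hs => (le_min ha hb).trans hs.1).intervalIntegrable
  have h1 : ∀ v, 0 ≤ v → (X *ᵥ β v ω) i = (X *ᵥ β 0 ω) i + ∑ k, X i k * ∫ s in (0 : ℝ)..v, (-A.Γ *ᵥ β s ω) k := by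
    intro v hv
    have h2 : β v ω = β 0 ω + (fun k => ∫ s in (0 : ℝ)..v, (-A.Γ *ᵥ β s ω) k) + A.S *ᵥ W v.toNNReal ω := funext fun k => hs v hv k
    rw [h2, Matrix.mulVec_add, Matrix.mulVec_add, Matrix.mulVec_mulVec, hX, Matrix.zero_mulVec, add_zero]
    rfl
  rw [h1 u hu, h1 t ht, add_sub_add_left_eq_sub, ← Finset.sum_sub_distrib]
  have h3 : ∀ s, ((-(X * A.Γ)) *ᵥ β s ω) i = ∑ k, X i k * (-A.Γ *ᵥ β s ω) k := fun s => by
    rw [← Matrix.mul_neg, ← Matrix.mulVec_mulVec]; rfl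
  simp_rw [h3]
  rw [intervalIntegral.integral_finsetSum fun k _ => (hint ht hu k).const_mul _]
  refine Finset.sum_congr rfl fun k _ => ?_
  rw [intervalIntegral.integral_const_mul, ← mul_sub, intervalIntegral.integral_interval_sub_left (hint le_rfl hu k) (hint le_rfl ht k)]

end OU

/-! ### Covariance and mean-square derivatives of the noise -/

section Noise

variable {Ω : Type*} [MeasurableSpace Ω] {P : Measure Ω} [IsProbabilityMeasure P] {q r : ℕ} {D : Model q r}
  {ξ : ℝ → Ω → Fin r → ℝ}

lemma isSecondOrder_congr {X Y : ℝ → Ω → ℝ} (h : ∀ t, 0 ≤ t → ∀ ω, Y t ω = X t ω) (hX : IsSecondOrder P X) : IsSecondOrder P Y where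
  aemeasurable t ht := by rw [show Y t = X t from funext (h t ht)]; exact hX.aemeasurable t ht
  continuous := hX.continuous.mono fun ω hω => hω.congr fun t ht => h t ht ω
  memLp t ht := by rw [show Y t = X t from funext (h t ht)]; exact hX.memLp t ht
  bound T := by
    obtain ⟨C, hC⟩ := hX.bound T
    exact ⟨C, fun t ht hT => by rw [show Y t = X t from funext (h t ht)]; exact hC t ht hT⟩

lemma IsNoise.isSecondOrder (hD : D.Standing) (h : IsNoise D P ξ) (i) : IsSecondOrder P fun t ω => ξ t ω i := by
  obtain ⟨W₃, W₄, β₃, β₄, h₃, h₄, -, -, hξ⟩ := h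
  refine isSecondOrder_congr (fun t ht ω => congrFun (hξ t ht ω) i) ?_
  exact ((h₃.isSecondOrder_mulVec hD.adm₃ _ i).const_mul D.α₃).add ((h₄.isSecondOrder_mulVec hD.adm₄ _ i).const_mul D.α₄)

lemma IsOU.integral_mulVec_eq_zero {n p r' m : ℕ} {A : Realization n p r'} {W : ℝ≥0 → Ω → Fin p → ℝ} {β : ℝ → Ω → Fin n → ℝ}
    (h : IsOU A P W β) (X : Matrix (Fin m) (Fin n) ℝ) {t : ℝ} (ht : 0 ≤ t) (i) : ∫ ω, (X *ᵥ β t ω) i ∂P = 0 := by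
  simp only [Matrix.mulVec, dotProduct]
  rw [integral_finsetSum _ fun k _ => ((h.memLp ht k).const_mul _).integrable (by norm_num)]
  refine Finset.sum_eq_zero fun k _ => ?_
  rw [integral_const_mul, h.integral_eq_zero ht, mul_zero]

lemma IsNoise.integral_eq_zero (hD : D.Standing) (h : IsNoise D P ξ) {t : ℝ} (ht : 0 ≤ t) (i) : ∫ ω, ξ t ω i ∂P = 0 := by
  obtain ⟨W₃, W₄, β₃, β₄, h₃, h₄, -, -, hξ⟩ := h
  simp_rw [hξ t ht, Pi.add_apply, Pi.smul_apply, smul_eq_mul]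
  rw [integral_add, integral_const_mul, integral_const_mul, h₃.integral_mulVec_eq_zero _ ht, h₄.integral_mulVec_eq_zero _ ht, mul_zero, mul_zero, add_zero]
  · exact (((h₃.isSecondOrder_mulVec hD.adm₃ _ i).const_mul D.α₃).memLp t ht).integrable (by norm_num)
  · exact (((h₄.isSecondOrder_mulVec hD.adm₄ _ i).const_mul D.α₄).memLp t ht).integrable (by norm_num)

/-- Away from `0` this is built into the definition; at `0` it is the symmetry of `M`. -/
lemma Model.R_neg (hD : D.Standing) (t : ℝ) : D.R (-t) = (D.R t)ᵀ := by
  have h1 : ∀ {n p : ℕ} (A : Realization n p r), A.Admissible → ∀ t, A.cov (-t) = (A.cov t)ᵀ := by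
    intro n p A hA t
    have hM : A.Mᵀ = A.M := by
      have := hA.posDef.1
      rwa [Matrix.IsHermitian, Matrix.conjTranspose_eq_transpose_of_trivial] at this
    rcases lt_trichotomy t 0 with h | rfl | h
    · simp only [Realization.cov, Realization.kernel_neg]
      rw [if_pos (by linarith), if_neg (by linarith), Matrix.transpose_transpose]
    · simp [Realization.cov, Realization.kernel, hM, Matrix.mul_assoc]
    · simp only [Realization.cov, Realization.kernel_neg]
      rw [if_neg (by linarith), if_pos (by linarith)]
  simp only [Model.R, h1 _ hD.adm₃, h1 _ hD.adm₄, Matrix.transpose_add, Matrix.transpose_smul]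

/-- The two systems are independent and centred, so only the diagonal terms survive; their
coefficients `α²` equal `α` because the switches are `0` or `1`. -/
lemma IsNoise.integral_mul_of_le (hD : D.Standing) (h : IsNoise D P ξ) {s u : ℝ} (hu : 0 ≤ u) (hus : u ≤ s) (i j) :
    ∫ ω, ξ s ω i * ξ u ω j ∂P = D.R (s - u) i j := by
  obtain ⟨W₃, W₄, β₃, β₄, h₃, h₄, hind, -, hξ⟩ := h
  have hs := hu.trans hus
  simp_rw [hξ s hs, hξ u hu, Pi.add_apply, Pi.smul_apply, smul_eq_mul]
  have L3 := fun t (ht : 0 ≤ t) i => ((h₃.isSecondOrder_mulVec hD.adm₃ D.sys₃.C i).const_mul D.α₃).memLp t ht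
  have L4 := fun t (ht : 0 ≤ t) i => ((h₄.isSecondOrder_mulVec hD.adm₄ D.sys₄.C i).const_mul D.α₄).memLp t ht
  have hcross : ∀ t (ht : 0 ≤ t) t' (ht' : 0 ≤ t') (i j), ∫ ω, D.α₃ * (D.sys₃.C *ᵥ β₃ t ω) i * (D.α₄ * (D.sys₄.C *ᵥ β₄ t' ω) j) ∂P = 0 := by
    intro t ht t' ht' i j
    have h1 : IndepFun (fun ω => D.α₃ * (D.sys₃.C *ᵥ β₃ t ω) i) (fun ω => D.α₄ * (D.sys₄.C *ᵥ β₄ t' ω) j) P := by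
      refine hind.comp (φ := fun x : ℝ≥0 → Fin D.d₃ → ℝ => D.α₃ * (D.sys₃.C *ᵥ x ⟨t, ht⟩) i)
        (ψ := fun x : ℝ≥0 → Fin D.d₄ → ℝ => D.α₄ * (D.sys₄.C *ᵥ x ⟨t', ht'⟩) j) ?_ ?_
      all_goals
        simp only [Matrix.mulVec, dotProduct]
        fun_prop
    rw [h1.integral_fun_mul_eq_mul_integral (L3 t ht i).1 (L4 t' ht' j).1, integral_const_mul, h₃.integral_mulVec_eq_zero _ ht, mul_zero, zero_mul]
  rw [integral_add_mul_add (L3 s hs i) (L4 s hs i) (L3 u hu j) (L4 u hu j), integral_mul_comm' (fun ω => D.α₄ * (D.sys₄.C *ᵥ β₄ s ω) i),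
    hcross u hu s hs, hcross s hs u hu, add_zero, add_zero]
  have hdiag : ∀ {n p : ℕ} (A : Realization n p r) (W : ℝ≥0 → Ω → Fin p → ℝ) (β : ℝ → Ω → Fin n → ℝ) (α : ℝ), A.Admissible → IsOU A P W β → α = 0 ∨ α = 1 →
      ∫ ω, α * (A.C *ᵥ β s ω) i * (α * (A.C *ᵥ β u ω) j) ∂P = α * A.cov (s - u) i j := by
    intro n p A W β α hA hβ hα
    have h2 : ∀ ω, α * (A.C *ᵥ β s ω) i * (α * (A.C *ᵥ β u ω) j) = α * ((A.C *ᵥ β s ω) i * (A.C *ᵥ β u ω) j) := by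
      intro ω; rcases hα with rfl | rfl <;> ring
    simp_rw [h2]
    rw [integral_const_mul, hβ.integral_mulVec_mul hA _ _ hu hus, Realization.cov, if_pos (by linarith), A.kernel_of_nonneg (by linarith)]
  rw [hdiag _ _ _ _ hD.adm₃ h₃ hD.switch₃, hdiag _ _ _ _ hD.adm₄ h₄ hD.switch₄]
  rfl

lemma IsNoise.integral_mul (hD : D.Standing) (h : IsNoise D P ξ) {s u : ℝ} (hs : 0 ≤ s) (hu : 0 ≤ u) (i j) :
    ∫ ω, ξ s ω i * ξ u ω j ∂P = D.R (s - u) i j := by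
  rcases le_total u s with hus | hus
  · exact h.integral_mul_of_le hD hu hus i j
  · rw [integral_mul_comm', h.integral_mul_of_le hD hs hus j i, ← neg_sub, Model.R_neg hD]; rfl

/-- The `j`-th derivative is `(-1)ʲ C Γʲ β`, summed over the active systems. Passing from one to the
next requires the Markov parameter `C Γʲ Σ` to vanish. -/
lemma IsNoise.isMSDifferentiable (hD : D.Standing) (h : IsNoise D P ξ) (n : ℕ)
    (hS₃ : ∀ a, a < n → D.α₃ • (D.sys₃.C * D.sys₃.Γ ^ a * D.sys₃.S) = 0)
    (hS₄ : ∀ a, a < n → D.α₄ • (D.sys₄.C * D.sys₄.Γ ^ a * D.sys₄.S) = 0) : IsMSDifferentiable P n ξ := by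
  obtain ⟨W₃, W₄, β₃, β₄, h₃, h₄, -, -, hξ⟩ := h
  set X₃ : ℕ → Matrix (Fin r) (Fin D.d₃) ℝ := fun j => (-1 : ℝ) ^ j • D.α₃ • (D.sys₃.C * D.sys₃.Γ ^ j) with hX₃
  set X₄ : ℕ → Matrix (Fin r) (Fin D.d₄) ℝ := fun j => (-1 : ℝ) ^ j • D.α₄ • (D.sys₄.C * D.sys₄.Γ ^ j) with hX₄
  set Z : ℕ → ℝ → Ω → Fin r → ℝ := fun j t ω => X₃ j *ᵥ β₃ t ω + X₄ j *ᵥ β₄ t ω with hZ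
  -- The zeroth process has to be `ξ` itself, whose values at negative times are arbitrary; the
  -- formula is used from index one on.
  set Y : ℕ → ℝ → Ω → Fin r → ℝ := fun j => if j = 0 then ξ else Z j with hY
  have hYZ : ∀ j t, 0 ≤ t → ∀ ω, Y j t ω = Z j t ω := by
    intro j t ht ω
    by_cases hj : j = 0
    · subst hj
      simp only [hY, if_true, hξ t ht, hZ, hX₃, hX₄, pow_zero, one_smul, Matrix.mul_one, Matrix.smul_mulVec]
    · simp only [hY, hj, if_false]
  have hL : ∀ j i, IsSecondOrder P fun t ω => Y j t ω i := fun j i =>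
    isSecondOrder_congr (fun t ht ω => congrFun (hYZ j t ht ω) i) ((h₃.isSecondOrder_mulVec hD.adm₃ _ i).add (h₄.isSecondOrder_mulVec hD.adm₄ _ i))
  have hstep₃ : ∀ j, -(X₃ j * D.sys₃.Γ) = X₃ (j + 1) := fun j => by
    simp only [hX₃, Matrix.smul_mul, Matrix.mul_assoc, pow_succ, mul_neg, mul_one, neg_smul]
  have hstep₄ : ∀ j, -(X₄ j * D.sys₄.Γ) = X₄ (j + 1) := fun j => by
    simp only [hX₄, Matrix.smul_mul, Matrix.mul_assoc, pow_succ, mul_neg, mul_one, neg_smul]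
  refine ⟨Y, by simp [hY], fun j _ t ht => MemLp.of_eval fun i => (hL j i).memLp t ht, fun j hj => ?_⟩
  refine isMSDeriv_of_integral (hL (j + 1)) (fun i => ?_) ?_ fun t ht i => (hL j i).memLp t ht
  · have h1 : Y (j + 1) = Z (j + 1) := by simp [hY]
    rw [h1]
    exact IsMSContinuous.add (h₃.isSecondOrder_mulVec hD.adm₃ _ i) (h₄.isSecondOrder_mulVec hD.adm₄ _ i)
      (h₃.isMSContinuous_mulVec hD.adm₃ _ i) (h₄.isMSContinuous_mulVec hD.adm₄ _ i)
  · have e3 : X₃ j * D.sys₃.S = 0 := by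
      have := hS₃ j hj
      simp only [hX₃, Matrix.smul_mul, this, smul_zero]
    have e4 : X₄ j * D.sys₄.S = 0 := by
      have := hS₄ j hj
      simp only [hX₄, Matrix.smul_mul, this, smul_zero]
    filter_upwards [h₃.mulVec_sub_eq_integral _ e3, h₄.mulVec_sub_eq_integral _ e4, h₃.continuousOn, h₄.continuousOn] with ω k3 k4 c3 c4 t u ht hu i
    have h1 : Y (j + 1) = Z (j + 1) := by simp [hY]
    rw [h1, hYZ j u hu, hYZ j t ht]
    simp only [hZ, Pi.add_apply]
    have hint : ∀ {m : ℕ} (X : Matrix (Fin r) (Fin m) ℝ) (β : ℝ → Ω → Fin m → ℝ), (∀ k, ContinuousOn (fun t => β t ω k) (Set.Ici 0)) →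
        IntervalIntegrable (fun s => (X *ᵥ β s ω) i) volume t u := by
      intro m X β hc
      refine ContinuousOn.intervalIntegrable (ContinuousOn.mono (s := Set.Ici 0) ?_ fun s hs => (le_min ht hu).trans hs.1)
      simp only [Matrix.mulVec, dotProduct]
      exact continuousOn_finsetSum _ fun l _ => continuousOn_const.mul (hc l)
    rw [intervalIntegral.integral_add (hint _ _ c3) (hint _ _ c4), ← hstep₃, ← hstep₄, ← k3 t u ht hu i, ← k4 t u ht hu i]
    ring

/-- Mean-square regularity of the noise from the decay of its spectral density. -/
lemma IsNoise.isMSDifferentiable_of_spec (hD : D.Standing) (h : IsNoise D P ξ) (η : ℝ)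
    (hS : ∀ i j, (fun w : ℝ => D.spec w i j) =O[atTop] (fun w : ℝ => 1 / w ^ (2 * η + 1))) (n : ℕ) (hn : (n : ℝ) < η) :
    IsMSDifferentiable P n ξ := by
  obtain ⟨h3, h4⟩ := hD.mul_pow_mul_eq_zero η hS
  have hlt : ∀ a, a < n → (a : ℝ) < η - 1 / 2 := fun a ha => by
    have : (a : ℝ) + 1 ≤ n := by exact_mod_cast ha
    linarith
  exact h.isMSDifferentiable hD n (fun a ha => h3 a (hlt a ha)) fun a ha => h4 a (hlt a ha)

end Noise

end GLE

namespace GLE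

/-! ### The Markovian system for position, velocity and memory; the response function -/

section Augmented

variable {ι : Type*} [Fintype ι] [DecidableEq ι] {d q r k : ℕ}

/-- The generator of the Markovian system for `(x, v, y)`, with memory `κ(t) = C e^{-Γt} N`. -/
noncomputable def augGen (G : Coeff d q r k) (Γ : Matrix ι ι ℝ) (C : Matrix (Fin q) ι ℝ) (N : Matrix ι (Fin q) ℝ) :
    Matrix (Fin d ⊕ Fin d ⊕ ι) (Fin d ⊕ Fin d ⊕ ι) ℝ :=
  Matrix.fromBlocks 0 (Matrix.fromCols 1 0) 0
    (Matrix.fromBlocks (-(G.m⁻¹ • G.γ₀)) (-(G.m⁻¹ • (G.g * C))) (N * G.h) (-Γ))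

variable (G : Coeff d q r k) (Γ : Matrix ι ι ℝ) (C : Matrix (Fin q) ι ℝ) (N : Matrix ι (Fin q) ℝ)

/-- The response function: the position generated by a unit impulse. -/
noncomputable def response (t : ℝ) : Matrix (Fin d) (Fin d) ℝ :=
  Matrix.of fun i j => G.m⁻¹ * NormedSpace.exp (t • augGen G Γ C N) (Sum.inl i) (Sum.inr (Sum.inl j))

/-- The coupling of the response to the memory variables. -/
noncomputable def responseMem (t : ℝ) : Matrix (Fin d) ι ℝ :=
  Matrix.of fun i l => NormedSpace.exp (t • augGen G Γ C N) (Sum.inl i) (Sum.inr (Sum.inr l))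

/-- The derivative of the response function. -/
noncomputable def responseDeriv (t : ℝ) : Matrix (Fin d) (Fin d) ℝ :=
  G.m⁻¹ • (1 - response G Γ C N t * G.γ₀ + responseMem G Γ C N t * (N * G.h))

/-- The position acts on nothing: the first block column of the generator is zero. -/
lemma exp_augGen_inl_inl (t : ℝ) (i j : Fin d) :
    NormedSpace.exp (t • augGen G Γ C N) (Sum.inl i) (Sum.inl j) = (1 : Matrix (Fin d) (Fin d) ℝ) i j := by
  have h1 : ∀ t, HasDerivAt (fun t : ℝ => NormedSpace.exp (t • augGen G Γ C N) (Sum.inl i) (Sum.inl j)) 0 t := fun t => by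
    refine (hasDerivAt_exp_smul_apply (augGen G Γ C N) t (Sum.inl i) (Sum.inl j)).congr_deriv ?_
    simp [Matrix.mul_apply, Fintype.sum_sum_type, augGen]
  have h2 := is_const_of_deriv_eq_zero (fun t => (h1 t).differentiableAt) (fun t => (h1 t).deriv) t 0
  rw [h2]
  simp [Matrix.one_apply]

/-- Multiplying the position row of the exponential by the generator expresses `H'` through `H` and
the memory coupling. The identity in `responseDeriv` comes from the constant position block. -/
lemma exp_augGen_mul_inr_inl (t : ℝ) (i j : Fin d) :
    (NormedSpace.exp (t • augGen G Γ C N) * augGen G Γ C N) (Sum.inl i) (Sum.inr (Sum.inl j)) = G.m * responseDeriv G Γ C N t i j := by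
  have hm := G.m_pos.ne'
  rw [Matrix.mul_apply]
  simp only [Fintype.sum_sum_type, exp_augGen_inl_inl]
  have a1 : ∀ l, augGen G Γ C N (Sum.inl l) (Sum.inr (Sum.inl j)) = (1 : Matrix (Fin d) (Fin d) ℝ) l j := fun l => rfl
  have a2 : ∀ l, augGen G Γ C N (Sum.inr (Sum.inl l)) (Sum.inr (Sum.inl j)) = -(G.m⁻¹ * G.γ₀ l j) := fun l => rfl
  have a3 : ∀ l, augGen G Γ C N (Sum.inr (Sum.inr l)) (Sum.inr (Sum.inl j)) = (N * G.h) l j := fun l => rfl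
  simp only [a1, a2, a3]
  rw [← Matrix.mul_apply, Matrix.mul_one, responseDeriv, Matrix.smul_apply, smul_eq_mul, mul_inv_cancel_left₀ hm, Matrix.add_apply, Matrix.sub_apply,
    Matrix.mul_apply (M := response G Γ C N t), Matrix.mul_apply (M := responseMem G Γ C N t)]
  simp only [response, responseMem, Matrix.of_apply, mul_neg, Finset.sum_neg_distrib]
  rw [sub_eq_add_neg, add_assoc]
  congr 3
  refine Finset.sum_congr rfl fun l _ => ?_
  ring

lemma exp_augGen_mul_inr_inr (t : ℝ) (i : Fin d) (l : ι) :
    (NormedSpace.exp (t • augGen G Γ C N) * augGen G Γ C N) (Sum.inl i) (Sum.inr (Sum.inr l)) =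
      -(response G Γ C N t * (G.g * C)) i l - (responseMem G Γ C N t * Γ) i l := by
  rw [Matrix.mul_apply]
  simp only [Fintype.sum_sum_type]
  simp only [augGen, Matrix.fromBlocks_apply₁₂, Matrix.fromBlocks_apply₂₂, Matrix.fromCols_apply_inr]
  rw [Matrix.mul_apply (M := response G Γ C N t), Matrix.mul_apply (M := responseMem G Γ C N t)]
  simp only [response, responseMem, Matrix.of_apply, Matrix.neg_apply, Matrix.smul_apply, smul_eq_mul, Matrix.zero_apply, mul_zero, Finset.sum_const_zero, zero_add]
  rw [sub_eq_add_neg, ← Finset.sum_neg_distrib, ← Finset.sum_neg_distrib]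
  simp only [augGen]
  congr 1
  · refine Finset.sum_congr rfl fun l _ => ?_
    ring
  · refine Finset.sum_congr rfl fun l _ => ?_
    ring

lemma hasDerivAt_response (t : ℝ) (i j) :
    HasDerivAt (fun t => response G Γ C N t i j) (responseDeriv G Γ C N t i j) t := by
  have h := (hasDerivAt_exp_smul_apply (augGen G Γ C N) t (Sum.inl i) (Sum.inr (Sum.inl j))).const_mul G.m⁻¹
  rw [exp_augGen_mul_inr_inl, inv_mul_cancel_left₀ G.m_pos.ne'] at h
  exact h

lemma hasDerivAt_responseMem (t : ℝ) (i l) :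
    HasDerivAt (fun t => responseMem G Γ C N t i l) (-(response G Γ C N t * (G.g * C)) i l - (responseMem G Γ C N t * Γ) i l) t := by
  have h := hasDerivAt_exp_smul_apply (augGen G Γ C N) t (Sum.inl i) (Sum.inr (Sum.inr l))
  rw [exp_augGen_mul_inr_inr] at h
  exact h

lemma response_zero : response G Γ C N 0 = 0 := by
  ext i j; simp [response]

lemma responseMem_zero : responseMem G Γ C N 0 = 0 := by
  ext i j; simp [responseMem]

lemma continuous_response (i j) : Continuous fun t => response G Γ C N t i j :=
  continuous_iff_continuousAt.2 fun t => (hasDerivAt_response G Γ C N t i j).continuousAt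

lemma continuous_responseMem (i j) : Continuous fun t => responseMem G Γ C N t i j :=
  continuous_iff_continuousAt.2 fun t => (hasDerivAt_responseMem G Γ C N t i j).continuousAt

lemma continuous_responseDeriv (i j) : Continuous fun t => responseDeriv G Γ C N t i j := by
  simp only [responseDeriv, Matrix.smul_apply, Matrix.add_apply, Matrix.sub_apply, smul_eq_mul]
  refine continuous_const.mul ((continuous_const.sub ?_).add ?_)
  · simp only [Matrix.mul_apply (M := response G Γ C N _)]
    exact continuous_finsetSum _ fun k _ => (continuous_response G Γ C N i k).mul continuous_const
  · simp only [Matrix.mul_apply (M := responseMem G Γ C N _)]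
    exact continuous_finsetSum _ fun k _ => (continuous_responseMem G Γ C N i k).mul continuous_const

/-- The Volterra equation `m H' + H γ₀ + H ∗ (g κ h) = I`. -/
lemma response_volterra (t : ℝ) (i j) :
    G.m * responseDeriv G Γ C N t i j + (response G Γ C N t * G.γ₀) i j +
      ∫ s in (0 : ℝ)..t, (response G Γ C N s * (G.g * (C * NormedSpace.exp ((t - s) • -Γ) * N) * G.h)) i j = (1 : Matrix (Fin d) (Fin d) ℝ) i j := by
  -- The memory coupling, propagated by `e^{-Γ(t-s)}`, has a derivative in which the two `Γ` terms
  -- cancel, leaving only the convolution integrand. Its values at `0` and `t` give the solved form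
  -- of the memory equation.
  have hd : ∀ s, HasDerivAt (fun s => ∑ l, responseMem G Γ C N s i l * (NormedSpace.exp ((t - s) • -Γ) * (N * G.h)) l j)
      (-(response G Γ C N s * (G.g * (C * NormedSpace.exp ((t - s) • -Γ) * N) * G.h)) i j) s := by
    intro s
    have hE : ∀ l, HasDerivAt (fun s => (NormedSpace.exp ((t - s) • -Γ) * (N * G.h)) l j) ((Γ * (NormedSpace.exp ((t - s) • -Γ) * (N * G.h))) l j) s := by
      intro l
      have h1 : HasDerivAt (fun s => ∑ k, NormedSpace.exp ((t - s) • -Γ) l k * (N * G.h) k j) (∑ k, -((-Γ) * NormedSpace.exp ((t - s) • -Γ)) l k * (N * G.h) k j) s :=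
        HasDerivAt.fun_sum fun k _ => ((hasDerivAt_exp_smul_apply' (-Γ) (t - s) l k).comp_const_sub t s).mul_const _
      have h2 : ∑ k, -((-Γ) * NormedSpace.exp ((t - s) • -Γ)) l k * (N * G.h) k j = (Γ * (NormedSpace.exp ((t - s) • -Γ) * (N * G.h))) l j := by
        rw [← Matrix.mul_assoc, Matrix.mul_apply (N := N * G.h)]
        refine Finset.sum_congr rfl fun k _ => ?_
        rw [Matrix.neg_mul, Matrix.neg_apply, neg_neg]
      rw [h2] at h1
      exact h1
    refine (HasDerivAt.fun_sum fun l _ => (hasDerivAt_responseMem G Γ C N s i l).fun_mul (hE l)).congr_deriv ?_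
    set X := NormedSpace.exp ((t - s) • -Γ) * (N * G.h) with hX
    have e1 : G.g * (C * NormedSpace.exp ((t - s) • -Γ) * N) * G.h = (G.g * C) * X := by rw [hX]; simp only [Matrix.mul_assoc]
    have e2 : ∑ l, (responseMem G Γ C N s * Γ) i l * X l j = ∑ l, responseMem G Γ C N s i l * (Γ * X) l j := by
      rw [← Matrix.mul_apply, ← Matrix.mul_apply, Matrix.mul_assoc]
    rw [e1, ← Matrix.mul_assoc (response G Γ C N s) (G.g * C) X, Matrix.mul_apply (N := X)]
    simp only [sub_mul, Finset.sum_add_distrib, Finset.sum_sub_distrib, e2, neg_mul, Finset.sum_neg_distrib]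
    ring
  have hc : Continuous fun s => -(response G Γ C N s * (G.g * (C * NormedSpace.exp ((t - s) • -Γ) * N) * G.h)) i j := by
    have e1 : ∀ s, (response G Γ C N s * (G.g * (C * NormedSpace.exp ((t - s) • -Γ) * N) * G.h)) i j
        = ∑ l, (response G Γ C N s * (G.g * C)) i l * (NormedSpace.exp ((t - s) • -Γ) * (N * G.h)) l j := fun s => by
      rw [← Matrix.mul_apply]; simp only [Matrix.mul_assoc]
    simp_rw [e1]
    refine (continuous_finsetSum _ fun l _ => Continuous.mul ?_ (continuous_exp_sub_smul_mul_apply _ _ t l j)).neg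
    simp only [Matrix.mul_apply (M := response G Γ C N _)]
    exact continuous_finsetSum _ fun k _ => (continuous_response G Γ C N i k).mul continuous_const
  have hFTC := intervalIntegral.integral_eq_sub_of_hasDerivAt (a := 0) (b := t) (fun s _ => hd s) (hc.intervalIntegrable _ _)
  simp only [sub_self, zero_smul, NormedSpace.exp_zero, Matrix.one_mul, responseMem_zero, Matrix.zero_apply, zero_mul, Finset.sum_const_zero, sub_zero] at hFTC
  rw [intervalIntegral.integral_neg, ← Matrix.mul_apply] at hFTC
  rw [responseDeriv, Matrix.smul_apply, smul_eq_mul, mul_inv_cancel_left₀ G.m_pos.ne', Matrix.add_apply, Matrix.sub_apply, ← hFTC]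
  ring

/-- The Laplace transforms of the memory function and of the response function. -/
lemma laplace_response (κ : ℝ → Matrix (Fin q) (Fin q) ℝ) (hκ : ∀ t, 0 ≤ t → κ t = C * NormedSpace.exp (t • -Γ) * N) :
    ∃ c : ℝ, 0 ≤ c ∧ ∀ z : ℂ, c < z.re → LaplaceConverges κ z ∧ LaplaceConverges (response G Γ C N) z ∧
      laplace (response G Γ C N) z * symbol G κ z = z⁻¹ • 1 := by
  obtain ⟨c₁, K₁, hc₁, hK₁⟩ := exists_abs_exp_smul_apply_le_of_large (augGen G Γ C N)
  obtain ⟨c₂, K₂, hc₂, hK₂⟩ := exists_abs_exp_smul_apply_le_of_large (-Γ)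
  refine ⟨max c₁ c₂, le_max_of_le_left hc₁, fun z hz => ?_⟩
  obtain ⟨i1, e1⟩ := laplace_exp_mul _ c₁ K₁ hK₁ z ((le_max_left _ _).trans_lt hz)
  obtain ⟨i2, e2⟩ := laplace_exp_mul _ c₂ K₂ hK₂ z ((le_max_right _ _).trans_lt hz)
  set L := (Matrix.of fun i j => ∫ t in Set.Ioi (0 : ℝ), (NormedSpace.exp (t • augGen G Γ C N) i j : ℂ) * Complex.exp (-(z * t))) with hL
  set Q := (Matrix.of fun i j => ∫ t in Set.Ioi (0 : ℝ), (NormedSpace.exp (t • -Γ) i j : ℂ) * Complex.exp (-(z * t))) with hQ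
  have hz0 : z ≠ 0 := by
    rintro rfl
    simp only [Complex.zero_re] at hz
    linarith [le_max_left c₁ c₂]
  set cC : Matrix (Fin q) ι ℂ := C.map (algebraMap ℝ ℂ) with hcC
  set cN : Matrix ι (Fin q) ℂ := N.map (algebraMap ℝ ℂ) with hcN
  set cΓ : Matrix ι ι ℂ := Γ.map (algebraMap ℝ ℂ) with hcΓ
  have eκ : ∀ a b, ∀ t : ℝ, 0 ≤ t → (κ t a b : ℂ) * Complex.exp (-(z * t)) =
      ∑ l, ∑ k, cC a k * ((NormedSpace.exp (t • -Γ) k l : ℂ) * Complex.exp (-(z * t))) * cN l b := by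
    intro a b t ht
    rw [hκ t ht, Matrix.mul_apply (N := N)]
    push_cast [Matrix.mul_apply (M := C)]
    simp only [Finset.sum_mul]
    refine Finset.sum_congr rfl fun l _ => Finset.sum_congr rfl fun k _ => ?_
    simp only [hcC, hcN, Matrix.map_apply, Complex.coe_algebraMap]
    ring
  have iκ : ∀ a b l k, IntegrableOn (fun t : ℝ => cC a k * ((NormedSpace.exp (t • -Γ) k l : ℂ) * Complex.exp (-(z * t))) * cN l b) (Set.Ioi 0) :=
    fun a b l k => ((i2 k l).const_mul _).mul_const _
  have eκ' : ∀ a b, ∀ᵐ t ∂(volume.restrict (Set.Ioi (0 : ℝ))), (κ t a b : ℂ) * Complex.exp (-(z * t)) =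
      ∑ l, ∑ k, cC a k * ((NormedSpace.exp (t • -Γ) k l : ℂ) * Complex.exp (-(z * t))) * cN l b := by
    intro a b
    filter_upwards [ae_restrict_mem measurableSet_Ioi] with t ht using eκ a b t (le_of_lt ht)
  have hκc : LaplaceConverges κ z := fun a b =>
    (integrable_finsetSum _ fun l _ => integrable_finsetSum _ fun k _ => iκ a b l k).congr ((eκ' a b).mono fun t ht => ht.symm)
  have hκL : laplace κ z = cC * Q * cN := by
    ext a b
    rw [laplace, Matrix.of_apply, integral_congr_ae (eκ' a b), integral_finsetSum _ fun l _ => integrable_finsetSum _ fun k _ => iκ a b l k,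
      Matrix.mul_apply (N := cN)]
    refine Finset.sum_congr rfl fun l _ => ?_
    rw [integral_finsetSum _ fun k _ => iκ a b l k, Matrix.mul_apply (M := cC), Finset.sum_mul]
    refine Finset.sum_congr rfl fun k _ => ?_
    rw [integral_mul_const, integral_const_mul]
    rfl
  have hHc : LaplaceConverges (response G Γ C N) z := fun i j => by
    have := (i1 (Sum.inl i) (Sum.inr (Sum.inl j))).const_mul (G.m⁻¹ : ℂ)
    refine this.congr (Eventually.of_forall fun t => ?_)
    simp only [response, Matrix.of_apply]
    push_cast; ring
  set Lxv : Matrix (Fin d) (Fin d) ℂ := Matrix.of fun i j => L (Sum.inl i) (Sum.inr (Sum.inl j)) with hLxv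
  set Lxy : Matrix (Fin d) ι ℂ := Matrix.of fun i j => L (Sum.inl i) (Sum.inr (Sum.inr j)) with hLxy
  set Lxx : Matrix (Fin d) (Fin d) ℂ := Matrix.of fun i j => L (Sum.inl i) (Sum.inl j) with hLxx
  have hHL : laplace (response G Γ C N) z = (G.m⁻¹ : ℂ) • Lxv := by
    ext i j
    rw [laplace, Matrix.of_apply, Matrix.smul_apply, smul_eq_mul, hLxv, Matrix.of_apply, hL, Matrix.of_apply, ← integral_const_mul]
    congr 1; funext t
    simp only [response, Matrix.of_apply]
    push_cast; ring
  have hm : (G.m : ℂ) ≠ 0 := by exact_mod_cast G.m_pos.ne'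
  -- The position row of `L (z - B) = 1`, with `B` the generator, is written out block by block in
  -- `b1`, `b2`, `b3`.
  have b1 : z • Lxx = 1 := by
    ext i j
    have := congrFun (congrFun e1 (Sum.inl i)) (Sum.inl j)
    rw [Matrix.mul_apply] at this
    simp only [Fintype.sum_sum_type, Matrix.sub_apply, Matrix.smul_apply, Matrix.map_apply, augGen, Matrix.fromBlocks_apply₁₁, Matrix.fromBlocks_apply₂₁,
      Matrix.one_apply, Sum.inl.injEq, reduceCtorEq, if_false, Matrix.zero_apply, map_zero, sub_zero, smul_zero, mul_zero, Finset.sum_const_zero, add_zero] at this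
    simp only [smul_eq_mul, mul_ite, mul_one, mul_zero, Finset.sum_ite_eq', Finset.mem_univ, if_true] at this
    rw [Matrix.smul_apply, smul_eq_mul, mul_comm, Matrix.one_apply, ← this, hLxx, Matrix.of_apply]
  have b2 : z • Lxv + (G.m⁻¹ : ℂ) • (Lxv * toC G.γ₀) - Lxy * (cN * toC G.h) = Lxx := by
    ext i j
    have := congrFun (congrFun e1 (Sum.inl i)) (Sum.inr (Sum.inl j))
    rw [Matrix.mul_apply] at this
    simp only [Fintype.sum_sum_type, Matrix.sub_apply, Matrix.smul_apply, Matrix.map_apply, augGen, Matrix.fromBlocks_apply₁₂, Matrix.fromBlocks_apply₂₂, Matrix.fromCols_apply_inl, Matrix.fromBlocks_apply₁₁, Matrix.fromBlocks_apply₂₁, Matrix.one_apply, Sum.inl.injEq, Sum.inr.injEq, reduceCtorEq, if_false, smul_zero, zero_sub, Matrix.neg_apply, map_neg, sub_neg_eq_add] at this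
    simp only [smul_eq_mul, mul_add, Finset.sum_add_distrib, mul_ite, mul_one, mul_zero, Finset.sum_ite_eq', Finset.mem_univ, if_true, mul_neg, Finset.sum_neg_distrib] at this
    have f1 : ∑ x, L (Sum.inl i) (Sum.inl x) * (algebraMap ℝ ℂ) (if x = j then 1 else 0) = Lxx i j := by simp [hLxx]
    have f2 : ∑ x, L (Sum.inl i) (Sum.inr (Sum.inl x)) * (algebraMap ℝ ℂ) (G.m⁻¹ * G.γ₀ x j) = (G.m⁻¹ : ℂ) * (Lxv * toC G.γ₀) i j := by
      rw [Matrix.mul_apply, Finset.mul_sum]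
      refine Finset.sum_congr rfl fun x _ => ?_
      simp [hLxv]; ring
    have f3 : ∑ x, L (Sum.inl i) (Sum.inr (Sum.inr x)) * (algebraMap ℝ ℂ) ((N * G.h) x j) = (Lxy * (cN * toC G.h)) i j := by
      rw [Matrix.mul_apply]
      refine Finset.sum_congr rfl fun x _ => ?_
      congr 1
      exact congrFun (congrFun (Matrix.map_mul (f := algebraMap ℝ ℂ) (L := N) (M := G.h)) x) j
    rw [f1, f2, f3] at this
    rw [Matrix.sub_apply, Matrix.add_apply, Matrix.smul_apply, Matrix.smul_apply, smul_eq_mul, smul_eq_mul]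
    have f4 : Lxv i j = L (Sum.inl i) (Sum.inr (Sum.inl j)) := rfl
    rw [f4]
    linear_combination this
  have b3 : (G.m⁻¹ : ℂ) • (Lxv * (toC G.g * cC)) + Lxy * (z • 1 + cΓ) = 0 := by
    ext i l
    have := congrFun (congrFun e1 (Sum.inl i)) (Sum.inr (Sum.inr l))
    rw [Matrix.mul_apply] at this
    simp only [Fintype.sum_sum_type, Matrix.sub_apply, Matrix.smul_apply, Matrix.map_apply, augGen, Matrix.fromBlocks_apply₁₂, Matrix.fromBlocks_apply₂₂, Matrix.fromCols_apply_inr, Matrix.one_apply, Sum.inr.injEq, reduceCtorEq, if_false, smul_zero, zero_sub, Matrix.neg_apply, Matrix.zero_apply, map_neg, sub_neg_eq_add, map_zero, neg_zero, mul_zero, Finset.sum_const_zero, zero_add] at this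
    rw [Matrix.add_apply, Matrix.smul_apply, Matrix.zero_apply, ← this, smul_eq_mul, Matrix.mul_apply (M := Lxv), Matrix.mul_apply (M := Lxy), Finset.mul_sum]
    congr 1
    refine Finset.sum_congr rfl fun x _ => ?_
    have f5 : (toC G.g * cC) x l = (((G.g * C) x l : ℝ) : ℂ) :=
      (congrFun (congrFun (Matrix.map_mul (f := algebraMap ℝ ℂ) (L := G.g) (M := C)) x) l).symm
    rw [f5]
    simp [hLxv]; ring
  have hQ' : (z • 1 + cΓ) * Q = 1 := by
    have hz' : z • 1 + cΓ = z • 1 - (-Γ).map (algebraMap ℝ ℂ) := by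
      ext a b; simp [hcΓ]
    rw [hz']
    exact mul_eq_one_comm.1 e2
  -- The memory block is eliminated with `Q = (z + Γ)⁻¹`; then `C Q N`, which is `κ̂(z)`, appears
  -- and completes the symbol.
  have hLxy' : Lxy = -((G.m⁻¹ : ℂ) • (Lxv * (toC G.g * cC))) * Q := by
    rw [← eq_neg_of_add_eq_zero_right b3, Matrix.mul_assoc, hQ', Matrix.mul_one]
  refine ⟨hκc, hHc, ?_⟩
  have hLxx' : Lxx = z⁻¹ • 1 := by rw [← b1, smul_smul, inv_mul_cancel₀ hz0, one_smul]
  rw [hHL, symbol, hκL, ← hLxx', ← b2, hLxy']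
  simp only [Matrix.mul_add, Matrix.smul_mul, Matrix.mul_smul, Matrix.mul_one, Matrix.mul_assoc, Matrix.neg_mul, sub_neg_eq_add, smul_smul]
  rw [show (G.m : ℂ) * z * (G.m : ℂ)⁻¹ = z by field_simp]

end Augmented

end GLE

open FourierTransform in
/-- Injectivity of the Laplace transform on continuous functions. -/
lemma eqOn_of_laplace_eq {f g : ℝ → ℝ} (hf : ContinuousOn f (Set.Ici 0)) (hg : ContinuousOn g (Set.Ici 0)) (c : ℝ)
    (h : ∀ z : ℂ, c < z.re → IntegrableOn (fun t : ℝ => (f t : ℂ) * Complex.exp (-(z * t))) (Set.Ioi 0) ∧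
      IntegrableOn (fun t : ℝ => (g t : ℂ) * Complex.exp (-(z * t))) (Set.Ioi 0) ∧
      ∫ t in Set.Ioi (0 : ℝ), (f t : ℂ) * Complex.exp (-(z * t)) = ∫ t in Set.Ioi (0 : ℝ), (g t : ℂ) * Complex.exp (-(z * t))) :
    Set.EqOn f g (Set.Ici 0) := by
  -- On the vertical line `Re z = c + 1` the Laplace transform of the difference is the Fourier
  -- transform of the damped function `F`. It vanishes, so Fourier inversion gives `F t = 0` at each
  -- continuity point `t > 0`.
  set a : ℝ := c + 1 with ha
  set F : ℝ → ℂ := (Set.Ioi (0 : ℝ)).indicator fun t => (f t : ℂ) * Complex.exp (-((a : ℂ) * t)) - (g t : ℂ) * Complex.exp (-((a : ℂ) * t)) with hF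
  have hFi : Integrable F := by
    rw [hF, integrable_indicator_iff measurableSet_Ioi]
    obtain ⟨h1, h2, -⟩ := h a (by simp [ha])
    exact h1.sub h2
  have hFt : 𝓕 F = 0 := by
    funext w
    rw [Real.fourier_real_eq_integral_exp_smul]
    have e : ∀ t : ℝ, Complex.exp (↑(-2 * Real.pi * t * w) * Complex.I) • F t = (Set.Ioi (0 : ℝ)).indicator
        (fun t : ℝ => (f t : ℂ) * Complex.exp (-(((a : ℂ) + 2 * Real.pi * w * Complex.I) * t)) - (g t : ℂ) * Complex.exp (-(((a : ℂ) + 2 * Real.pi * w * Complex.I) * t))) t := by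
      intro t
      by_cases ht : t ∈ Set.Ioi (0 : ℝ)
      · rw [hF, Set.indicator_of_mem ht, Set.indicator_of_mem ht, smul_eq_mul]
        rw [show -(((a : ℂ) + 2 * Real.pi * w * Complex.I) * t) = ↑(-2 * Real.pi * t * w) * Complex.I + -((a : ℂ) * t) by push_cast; ring, Complex.exp_add]
        ring
      · rw [hF, Set.indicator_of_notMem ht, Set.indicator_of_notMem ht, smul_zero]
    simp_rw [e]
    obtain ⟨h1, h2, h3⟩ := h ((a : ℂ) + 2 * Real.pi * w * Complex.I) (by simp [ha])
    rw [integral_indicator measurableSet_Ioi, integral_sub h1 h2, h3, sub_self]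
    rfl
  have hpos : Set.EqOn f g (Set.Ioi 0) := by
    intro t ht
    have hnhds : Set.Ioi (0 : ℝ) ∈ 𝓝 t := Ioi_mem_nhds ht
    have hfc : ContinuousAt f t := hf.continuousAt (mem_of_superset hnhds Set.Ioi_subset_Ici_self)
    have hgc : ContinuousAt g t := hg.continuousAt (mem_of_superset hnhds Set.Ioi_subset_Ici_self)
    have hFc : ContinuousAt F t := by
      have : ContinuousAt (fun t : ℝ => (f t : ℂ) * Complex.exp (-((a : ℂ) * t)) - (g t : ℂ) * Complex.exp (-((a : ℂ) * t))) t := by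
        have h1 : ContinuousAt (fun t : ℝ => Complex.exp (-((a : ℂ) * t))) t := by fun_prop
        exact ((Complex.continuous_ofReal.continuousAt.comp hfc).mul h1).sub ((Complex.continuous_ofReal.continuousAt.comp hgc).mul h1)
      refine this.congr ?_
      filter_upwards [hnhds] with s hs
      rw [hF, Set.indicator_of_mem hs]
    have := hFi.fourierInv_fourier_eq (by rw [hFt]; exact integrable_zero _ _ _) hFc
    rw [hFt] at this
    have h0 : F t = 0 := by
      rw [← this, Real.fourierInv_eq]
      simp
    rw [hF, Set.indicator_of_mem ht, ← sub_mul, mul_eq_zero, sub_eq_zero] at h0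
    rcases h0 with h0 | h0
    · exact_mod_cast h0
    · exact absurd h0 (Complex.exp_ne_zero _)
  exact hpos.of_subset_closure hf hg Set.Ioi_subset_Ici_self (by rw [closure_Ioi])

namespace GLE

/-- The convolution of `exp(tB)` with a forcing term solves the linear equation. -/
lemma hasDerivAt_exp_convolution {ι : Type*} [Fintype ι] [DecidableEq ι] (B : Matrix ι ι ℝ) (w : ℝ → ι → ℝ) (hw : ∀ l, Continuous fun s => w s l)
    (t : ℝ) (l : ι) :
    HasDerivAt (fun t => ∫ u in (0 : ℝ)..t, (NormedSpace.exp ((t - u) • B) *ᵥ w u) l)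
      ((B *ᵥ fun k => ∫ u in (0 : ℝ)..t, (NormedSpace.exp ((t - u) • B) *ᵥ w u) k) l + w t l) t := by
  have hc : ∀ k, Continuous fun u : ℝ => (NormedSpace.exp ((0 - u) • B) *ᵥ w u) k := fun k => by
    simp only [Matrix.mulVec, dotProduct]
    exact continuous_finsetSum _ fun j _ => (continuous_exp_sub_smul_apply B 0 k j).mul (hw j)
  -- Factoring `e^{(t-u)B} = e^{tB} e^{-uB}` frees the integrand from `t`, so that the product rule
  -- applies.
  have hy : ∀ l t, ∫ u in (0 : ℝ)..t, (NormedSpace.exp ((t - u) • B) *ᵥ w u) l =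
      ∑ k, NormedSpace.exp (t • B) l k * ∫ u in (0 : ℝ)..t, (NormedSpace.exp ((0 - u) • B) *ᵥ w u) k := by
    intro l t
    simp_rw [← intervalIntegral.integral_const_mul]
    rw [← intervalIntegral.integral_finsetSum fun k _ => ((hc k).const_mul _).intervalIntegrable _ _]
    refine intervalIntegral.integral_congr fun u _ => ?_
    rw [show t - u = t + (0 - u) by ring, exp_add_smul, ← Matrix.mulVec_mulVec]
    rfl
  have h1 : HasDerivAt (fun t => ∑ k, NormedSpace.exp (t • B) l k * ∫ u in (0 : ℝ)..t, (NormedSpace.exp ((0 - u) • B) *ᵥ w u) k)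
      (∑ k, ((B * NormedSpace.exp (t • B)) l k * (∫ u in (0 : ℝ)..t, (NormedSpace.exp ((0 - u) • B) *ᵥ w u) k)
        + NormedSpace.exp (t • B) l k * (NormedSpace.exp ((0 - t) • B) *ᵥ w t) k)) t :=
    HasDerivAt.fun_sum fun k _ => (hasDerivAt_exp_smul_apply' B t l k).fun_mul
      (intervalIntegral.integral_hasDerivAt_right ((hc k).intervalIntegrable _ _) ((hc k).stronglyMeasurableAtFilter _ _) (hc k).continuousAt)
  simp_rw [← hy l] at h1
  refine h1.congr_deriv ?_
  rw [Finset.sum_add_distrib]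
  congr 1
  · simp_rw [hy]
    change _ = (B *ᵥ (NormedSpace.exp (t • B) *ᵥ fun k => ∫ u in (0 : ℝ)..t, (NormedSpace.exp ((0 - u) • B) *ᵥ w u) k)) l
    rw [Matrix.mulVec_mulVec]
    rfl
  · change (NormedSpace.exp (t • B) *ᵥ (NormedSpace.exp ((0 - t) • B) *ᵥ w t)) l = _
    rw [Matrix.mulVec_mulVec, ← exp_add_smul, add_sub_cancel, zero_smul, NormedSpace.exp_zero, Matrix.one_mulVec]

/-- The components of the integral of a vector-valued function. -/
lemma intervalIntegral_apply {κ : Type*} [Fintype κ] {f : ℝ → κ → ℝ} {t : ℝ} (ht : 0 ≤ t) (hf : ∀ i, ContinuousOn (fun s => f s i) (Set.Icc 0 t)) (i : κ) :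
    (∫ s in (0 : ℝ)..t, f s) i = ∫ s in (0 : ℝ)..t, f s i := by
  have hi : IntervalIntegrable f volume 0 t := by
    apply ContinuousOn.intervalIntegrable
    rw [Set.uIcc_of_le ht]
    exact continuousOn_pi.2 hf
  exact ((ContinuousLinearMap.proj (R := ℝ) (φ := fun _ : κ => ℝ) i).intervalIntegral_comp_comm hi).symm

lemma continuousOn_mulVec_apply {κ μ : Type*} [Fintype κ] {s : Set ℝ} {f : ℝ → κ → ℝ} (A : Matrix μ κ ℝ) (hf : ∀ i, ContinuousOn (fun t => f t i) s) (i : μ) :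
    ContinuousOn (fun t => (A *ᵥ f t) i) s := by
  simp only [Matrix.mulVec, dotProduct]
  exact continuousOn_finsetSum _ fun j _ => continuousOn_const.mul (hf j)

/-! ### Uniqueness of the response function and closed form of the position -/

section Augmented

variable {ι : Type*} [Fintype ι] [DecidableEq ι] {d q r k : ℕ}
variable (G : Coeff d q r k) (Γ : Matrix ι ι ℝ) (C : Matrix (Fin q) ι ℝ) (N : Matrix ι (Fin q) ℝ)

lemma isResponse_response (κ : ℝ → Matrix (Fin q) (Fin q) ℝ) (hκ : ∀ t, 0 ≤ t → κ t = C * NormedSpace.exp (t • -Γ) * N) :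
    IsResponse G κ (response G Γ C N) := by
  refine ⟨fun i j => ContDiff.contDiffOn ?_, ?_⟩
  · rw [contDiff_one_iff_deriv]
    refine ⟨fun t => (hasDerivAt_response G Γ C N t i j).differentiableAt, ?_⟩
    rw [show deriv (fun t => response G Γ C N t i j) = fun t => responseDeriv G Γ C N t i j from funext fun t => (hasDerivAt_response G Γ C N t i j).deriv]
    exact continuous_responseDeriv G Γ C N i j
  · obtain ⟨c, hc, h⟩ := laplace_response G Γ C N κ hκ
    refine ⟨c, hc, fun z hz => ?_⟩
    obtain ⟨h1, h2, h3⟩ := h z hz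
    have hz0 : z ≠ 0 := by
      rintro rfl
      simp only [Complex.zero_re] at hz
      linarith
    have h4 : (z • laplace (response G Γ C N) z) * symbol G κ z = 1 := by
      rw [Matrix.smul_mul, h3, smul_smul, mul_inv_cancel₀ hz0, one_smul]
    refine ⟨h1, IsUnit.of_mul_eq_one_right _ h4, h2, ?_⟩
    have h5 : (z⁻¹ • laplace (response G Γ C N) z) * (z ^ 2 • symbol G κ z) = 1 := by
      rw [Matrix.smul_mul, Matrix.mul_smul, h3, smul_smul, smul_smul]
      rw [show z⁻¹ * z ^ 2 * z⁻¹ = 1 by field_simp, one_smul]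
    rw [Fhat, Matrix.inv_eq_left_inv h5, smul_smul, mul_inv_cancel₀ hz0, one_smul]

lemma IsResponse.eqOn {κ : ℝ → Matrix (Fin q) (Fin q) ℝ} {H H' : ℝ → Matrix (Fin d) (Fin d) ℝ} (h : IsResponse G κ H) (h' : IsResponse G κ H')
    (t : ℝ) (ht : 0 ≤ t) : H t = H' t := by
  ext i j
  obtain ⟨h1, c, -, h2⟩ := h
  obtain ⟨h1', c', -, h2'⟩ := h'
  refine eqOn_of_laplace_eq (h1 i j).continuousOn (h1' i j).continuousOn (max c c') (fun z hz => ?_) ht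
  obtain ⟨-, -, h3, h4⟩ := h2 z ((le_max_left _ _).trans_lt hz)
  obtain ⟨-, -, h3', h4'⟩ := h2' z ((le_max_right _ _).trans_lt hz)
  exact ⟨h3 i j, h3' i j, congrFun (congrFun (h4.trans h4'.symm) i) j⟩

lemma matDeriv_of_eqOn_response {H : ℝ → Matrix (Fin d) (Fin d) ℝ} (h : ∀ t, 0 ≤ t → H t = response G Γ C N t) (t : ℝ) (ht : 0 ≤ t) :
    matDeriv H t = responseDeriv G Γ C N t := by
  ext i j
  rw [matDeriv, Matrix.of_apply, derivWithin_congr (f := fun s => response G Γ C N s i j) (fun s hs => by rw [h s hs]) (by rw [h t ht])]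
  exact (hasDerivAt_response G Γ C N t i j).hasDerivWithinAt.derivWithin (uniqueDiffOn_Ici 0 t ht)

/-- The position in terms of the initial velocity, the Wiener process and the noise. -/
noncomputable def positionRep {Ω : Type*} (ξ : ℝ → Ω → Fin r → ℝ) (W : ℝ≥0 → Ω → Fin k → ℝ) (v : ℝ → Ω → Fin d → ℝ) (t : ℝ) (i : Fin d) (ω : Ω) : ℝ :=
  (∑ j, (G.m * response G Γ C N t i j) * v 0 ω j) +
    (∑ a, partsIntegral (fun t ω => W t.toNNReal ω a) (fun s => (response G Γ C N (t - s) * G.σ₀) i a)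
      (fun s => -(responseDeriv G Γ C N (t - s) * G.σ₀) i a) t ω) +
    ∑ b, ∫ s in (0 : ℝ)..t, (response G Γ C N (t - s) * G.σ) i b * ξ s ω b

lemma continuous_response_mul {n : ℕ} (A : Matrix (Fin d) (Fin n) ℝ) (t : ℝ) (i j) : Continuous fun s => (response G Γ C N (t - s) * A) i j := by
  simp only [Matrix.mul_apply]
  exact continuous_finsetSum _ fun l _ => ((continuous_response G Γ C N i l).comp (continuous_sub_left t)).mul continuous_const

lemma continuous_responseDeriv_mul {n : ℕ} (A : Matrix (Fin d) (Fin n) ℝ) (t : ℝ) (i j) : Continuous fun s => (responseDeriv G Γ C N (t - s) * A) i j := by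
  simp only [Matrix.mul_apply]
  exact continuous_finsetSum _ fun l _ => ((continuous_responseDeriv G Γ C N i l).comp (continuous_sub_left t)).mul continuous_const

/-- The memory integral is `C y`, where `y` is the convolution of `e^{-Γt}` with `N h v` and solves
a linear equation. The triple of position, velocity and `y` then obeys a linear equation with
additive forcing in the velocity, and the position component of variation of constants is the
formula. -/
lemma IsSolution.eq_apply {Ω : Type*} [MeasurableSpace Ω] {P : Measure Ω} {κ : ℝ → Matrix (Fin q) (Fin q) ℝ} {ξ : ℝ → Ω → Fin r → ℝ}
    {W : ℝ≥0 → Ω → Fin k → ℝ} {v : ℝ → Ω → Fin d → ℝ} (hκ : ∀ t, 0 ≤ t → κ t = C * NormedSpace.exp (t • -Γ) * N)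
    (h : IsSolution G κ P ξ W v) (hξ : ∀ᵐ ω ∂P, ∀ i, ContinuousOn (fun t => ξ t ω i) (Set.Ici 0)) :
    ∀ᵐ ω ∂P, ∀ t : ℝ, 0 ≤ t → ∀ i, position v t ω i = positionRep G Γ C N ξ W v t i ω := by
  filter_upwards [h.continuous, h.eq, hξ, ae_all_iff.2 fun l => (h.wiener.brownian l).cont] with ω hc heq hξc hW t ht i
  have hvc : ∀ i, ContinuousOn (fun t => v t ω i) (Set.Ici 0) := fun i => (continuous_apply i).comp_continuousOn hc
  have hIcc : ∀ t : ℝ, Set.Icc 0 t ⊆ Set.Ici (0 : ℝ) := fun t => Set.Icc_subset_Ici_self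
  have hWc : ∀ l, Continuous fun t : ℝ => W t.toNNReal ω l := fun l => (hW l).comp continuous_real_toNNReal
  have hm := G.m_pos.ne'
  -- Paths are continuous only on `[0, ∞)`; freezing the velocity at time `0` makes `w` continuous
  -- on the line.
  set w : ℝ → ι → ℝ := fun u => N *ᵥ (G.h *ᵥ v (max u 0) ω) with hw
  have hvm : ∀ i, Continuous fun u : ℝ => v (max u 0) ω i := fun i => (hvc i).comp_continuous (by fun_prop) fun t => le_max_right t 0
  have hwc : ∀ l, Continuous fun u => w u l := fun l => by
    simp only [hw, Matrix.mulVec, dotProduct]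
    exact continuous_finsetSum _ fun j _ => continuous_const.mul (continuous_finsetSum _ fun l _ => continuous_const.mul (hvm l))
  set y : ℝ → ι → ℝ := fun t l => ∫ u in (0 : ℝ)..t, (NormedSpace.exp ((t - u) • -Γ) *ᵥ w u) l with hy
  have hyd : ∀ t l, HasDerivAt (fun t => y t l) ((-Γ *ᵥ y t) l + w t l) t := fun t l => hasDerivAt_exp_convolution (-Γ) w hwc t l
  have hyc : ∀ l, Continuous fun t => y t l := fun l => continuous_iff_continuousAt.2 fun t => (hyd t l).continuousAt
  have hx : ∀ t, 0 ≤ t → ∀ i, position v t ω i = ∫ s in (0 : ℝ)..t, v s ω i := fun t ht i =>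
    intervalIntegral_apply ht (fun i => (hvc i).mono (hIcc _)) i
  have hmem : ∀ s, 0 ≤ s → ∀ a, (∫ u in (0 : ℝ)..s, κ (s - u) *ᵥ (G.h *ᵥ v u ω)) a = (C *ᵥ y s) a := by
    intro s hs a
    have e1 : ∫ u in (0 : ℝ)..s, κ (s - u) *ᵥ (G.h *ᵥ v u ω) = ∫ u in (0 : ℝ)..s, C *ᵥ (NormedSpace.exp ((s - u) • -Γ) *ᵥ w u) := by
      refine intervalIntegral.integral_congr fun u hu => ?_
      rw [Set.uIcc_of_le hs] at hu
      simp only [hw]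
      rw [hκ _ (sub_nonneg.2 hu.2), max_eq_left hu.1]
      simp only [Matrix.mulVec_mulVec, Matrix.mul_assoc]
    have hec : ∀ l, Continuous fun u : ℝ => (NormedSpace.exp ((s - u) • -Γ) *ᵥ w u) l := fun l => by
      simp only [Matrix.mulVec, dotProduct]
      exact continuous_finsetSum _ fun j _ => (continuous_exp_sub_smul_apply (-Γ) s l j).mul (hwc j)
    rw [e1, intervalIntegral_apply hs (continuousOn_mulVec_apply C fun l => (hec l).continuousOn)]
    simp only [Matrix.mulVec, dotProduct, hy]
    rw [intervalIntegral.integral_finsetSum]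
    · simp_rw [intervalIntegral.integral_const_mul]
    · exact fun l _ => ((hec l).const_mul _).intervalIntegrable _ _
  have hv : ∀ t, 0 ≤ t → ∀ i, v t ω i = v 0 ω i + (∫ s in (0 : ℝ)..t, (-(G.m⁻¹ * (G.γ₀ *ᵥ v s ω) i) - G.m⁻¹ * ((G.g * C) *ᵥ y s) i + G.m⁻¹ * (G.σ *ᵥ ξ s ω) i))
      + G.m⁻¹ * (G.σ₀ *ᵥ W t.toNNReal ω) i := by
    intro t ht i
    have h1 := congrFun (heq t.toNNReal) i
    rw [Real.coe_toNNReal _ ht] at h1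
    have e2 : ∫ s in (0 : ℝ)..t, G.g *ᵥ (∫ u in (0 : ℝ)..s, κ (s - u) *ᵥ (G.h *ᵥ v u ω)) = ∫ s in (0 : ℝ)..t, (G.g * C) *ᵥ y s := by
      refine intervalIntegral.integral_congr fun s hs => ?_
      rw [Set.uIcc_of_le ht] at hs
      rw [funext (hmem s hs.1), Matrix.mulVec_mulVec]
    rw [e2] at h1
    simp only [Pi.add_apply, Pi.sub_apply, Pi.smul_apply, smul_eq_mul] at h1
    have c1 := continuousOn_mulVec_apply G.γ₀ fun i => (hvc i).mono (hIcc t)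
    have c2 := continuousOn_mulVec_apply (G.g * C) fun l => (hyc l).continuousOn (s := Set.Icc 0 t)
    have c3 := continuousOn_mulVec_apply G.σ fun i => (hξc i).mono (hIcc t)
    rw [intervalIntegral_apply ht c1, intervalIntegral_apply ht c2, intervalIntegral_apply ht c3] at h1
    have ii : ∀ {f : ℝ → ℝ}, ContinuousOn f (Set.Icc 0 t) → IntervalIntegrable f volume 0 t := fun hf => by
      apply ContinuousOn.intervalIntegrable
      rwa [Set.uIcc_of_le ht]
    have i1 : IntervalIntegrable (fun s => -(G.m⁻¹ * (G.γ₀ *ᵥ v s ω) i)) volume 0 t := ((ii (c1 i)).const_mul G.m⁻¹).neg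
    have i2 := (ii (c2 i)).const_mul G.m⁻¹
    have i3 := (ii (c3 i)).const_mul G.m⁻¹
    rw [intervalIntegral.integral_add (i1.sub i2) i3, intervalIntegral.integral_sub i1 i2, intervalIntegral.integral_neg]
    simp only [intervalIntegral.integral_const_mul]
    field_simp
    linarith
  have hzero : ∀ i, position v 0 ω i = 0 := fun i => by rw [hx 0 le_rfl, intervalIntegral.integral_same]
  have hy0 : ∀ l, y 0 l = 0 := fun l => intervalIntegral.integral_same
  -- The Wiener process enters as the nondifferentiable forcing `φ`, the noise `ξ` as the continuous
  -- forcing `ψ`, both divided by the mass.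
  have key := variation_of_constants (augGen G Γ C N)
    (fun t => Sum.elim (position v t ω) (Sum.elim (v t ω) (y t)))
    (fun t => Sum.elim (fun _ => 0) (Sum.elim (fun i => G.m⁻¹ * (G.σ₀ *ᵥ W t.toNNReal ω) i) fun _ => 0))
    (fun t => Sum.elim (fun _ => 0) (Sum.elim (fun i => G.m⁻¹ * (G.σ *ᵥ ξ t ω) i) fun _ => 0))
    (by
      rintro (i | i | l)
      · have hcont : Continuous fun t => ∫ s in (0 : ℝ)..t, v (max s 0) ω i :=
          intervalIntegral.continuous_primitive (fun a b => (hvm i).intervalIntegrable a b) 0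
        refine hcont.continuousOn.congr fun t ht => ?_
        rw [Sum.elim_inl, hx t ht]
        refine intervalIntegral.integral_congr fun s hs => ?_
        rw [Set.uIcc_of_le ht] at hs
        simp only [max_eq_left hs.1]
      · exact hvc i
      · exact (hyc l).continuousOn)
    (by
      rintro (i | i | l)
      · exact continuousOn_const
      · exact continuousOn_const.mul (continuousOn_mulVec_apply _ hξc i)
      · exact continuousOn_const)
    (by
      rintro t ht (i | i | l)
      · simp only [Sum.elim_inl, add_zero, hzero, zero_add]
        rw [hx t ht]
        refine intervalIntegral.integral_congr fun s _ => ?_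
        simp only [augGen, Matrix.mulVec, dotProduct, Fintype.sum_sum_type, Matrix.fromBlocks_apply₁₁, Matrix.fromBlocks_apply₁₂,
          Matrix.fromCols_apply_inl, Matrix.fromCols_apply_inr, Matrix.zero_apply, zero_mul, Finset.sum_const_zero, zero_add, add_zero, Sum.elim_inl, Sum.elim_inr]
        exact (congrFun (Matrix.one_mulVec (v s ω)) i).symm
      · simp only [Sum.elim_inl, Sum.elim_inr]
        rw [hv t ht i]
        congr 2
        refine intervalIntegral.integral_congr fun s _ => ?_
        congr 1
        simp only [augGen, Matrix.mulVec, dotProduct, Fintype.sum_sum_type, Matrix.fromBlocks_apply₂₁, Matrix.fromBlocks_apply₂₂, Matrix.fromBlocks_apply₁₁, Matrix.fromBlocks_apply₁₂,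
          Matrix.zero_apply, zero_mul, Finset.sum_const_zero, zero_add, Sum.elim_inl, Sum.elim_inr, Matrix.neg_apply, Matrix.smul_apply, smul_eq_mul, neg_mul, Finset.sum_neg_distrib,
          mul_assoc, ← Finset.mul_sum, ← sub_eq_add_neg]
      · simp only [Sum.elim_inr, hy0, zero_add, add_zero]
        have hint := intervalIntegral.integral_eq_sub_of_hasDerivAt (a := 0) (b := t) (fun s _ => hyd s l)
          (((continuousOn_mulVec_apply (-Γ) fun l => (hyc l).continuousOn (s := Set.univ)) l |> continuousOn_univ.1).add (hwc l) |>.intervalIntegrable _ _)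
        rw [hy0, sub_zero] at hint
        rw [← hint]
        refine intervalIntegral.integral_congr fun s hs => ?_
        rw [Set.uIcc_of_le ht] at hs
        simp only [hw, max_eq_left hs.1, Matrix.mulVec_mulVec]
        simp only [augGen, Matrix.mulVec, dotProduct, Fintype.sum_sum_type, Matrix.fromBlocks_apply₂₁, Matrix.fromBlocks_apply₂₂,
          Matrix.zero_apply, zero_mul, Finset.sum_const_zero, zero_add, Sum.elim_inl, Sum.elim_inr]
        ring)
    t ht (Sum.inl i)
  simp only [Sum.elim_inl] at key
  have hH : ∀ t j, NormedSpace.exp (t • augGen G Γ C N) (Sum.inl i) (Sum.inr (Sum.inl j)) = G.m * response G Γ C N t i j := fun t j => by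
    rw [response, Matrix.of_apply, mul_inv_cancel_left₀ hm]
  rw [key, positionRep, add_zero, add_assoc (∑ j, _)]
  congr 1
  · simp only [Matrix.mulVec, dotProduct, Fintype.sum_sum_type, Sum.elim_inl, Sum.elim_inr, hzero, hy0, mul_zero, Finset.sum_const_zero, zero_add, add_zero, hH]
  -- `H(0) = 0` removes the boundary term, so the stochastic integral is the integral of `H'(t-s) σ₀
  -- W_s`.
  · simp only [partsIntegral, sub_self, response_zero, Matrix.zero_mul, Matrix.zero_apply, zero_mul, zero_sub, neg_mul, intervalIntegral.integral_neg, neg_neg]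
    have c1 : ∀ a, Continuous fun s => (responseDeriv G Γ C N (t - s) * G.σ₀) i a * W s.toNNReal ω a := fun a =>
      (continuous_responseDeriv_mul G Γ C N G.σ₀ t i a).mul (hWc a)
    have c2 : ∀ b, ContinuousOn (fun s => (response G Γ C N (t - s) * G.σ) i b * ξ s ω b) (Set.uIcc 0 t) := fun b => by
      rw [Set.uIcc_of_le ht]
      exact (continuous_response_mul G Γ C N G.σ t i b).continuousOn.mul ((hξc b).mono (hIcc t))
    rw [← intervalIntegral.integral_finsetSum fun a _ => (c1 a).intervalIntegrable _ _,
      ← intervalIntegral.integral_finsetSum fun b _ => (c2 b).intervalIntegrable,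
      ← intervalIntegral.integral_add ((continuous_finsetSum _ fun a _ => c1 a).intervalIntegrable _ _)
        (continuousOn_finsetSum _ fun b _ => c2 b).intervalIntegrable]
    refine intervalIntegral.integral_congr fun s _ => ?_
    have f1 : ∑ a, (responseDeriv G Γ C N (t - s) * G.σ₀) i a * W s.toNNReal ω a = ∑ j, responseDeriv G Γ C N (t - s) i j * (G.σ₀ *ᵥ W s.toNNReal ω) j := by
      change ((responseDeriv G Γ C N (t - s) * G.σ₀) *ᵥ W s.toNNReal ω) i = (responseDeriv G Γ C N (t - s) *ᵥ (G.σ₀ *ᵥ W s.toNNReal ω)) i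
      rw [Matrix.mulVec_mulVec]
    have f2 : ∑ b, (response G Γ C N (t - s) * G.σ) i b * ξ s ω b = ∑ j, response G Γ C N (t - s) i j * (G.σ *ᵥ ξ s ω) j := by
      change ((response G Γ C N (t - s) * G.σ) *ᵥ ξ s ω) i = (response G Γ C N (t - s) *ᵥ (G.σ *ᵥ ξ s ω)) i
      rw [Matrix.mulVec_mulVec]
    rw [f1, f2]
    congr 1
    · rw [Matrix.mulVec, dotProduct]
      simp only [Fintype.sum_sum_type, Sum.elim_inl, Sum.elim_inr, mul_zero, Finset.sum_const_zero, zero_add, add_zero, exp_augGen_mul_inr_inl]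
      refine Finset.sum_congr rfl fun j _ => ?_
      field_simp
    · rw [Matrix.mulVec, dotProduct]
      simp only [Fintype.sum_sum_type, Sum.elim_inl, Sum.elim_inr, mul_zero, Finset.sum_const_zero, zero_add, add_zero, hH]
      refine Finset.sum_congr rfl fun j _ => ?_
      field_simp

end Augmented

end GLE

/-- Splitting the integral over a square along its diagonal. -/
lemma intervalIntegral_square_eq_triangles {φ : ℝ → ℝ → ℝ} (hφ : Continuous fun p : ℝ × ℝ => φ p.1 p.2) {t : ℝ} (ht : 0 ≤ t) :
    ∫ s in (0 : ℝ)..t, ∫ r in (0 : ℝ)..t, φ s r =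
      (∫ u in (0 : ℝ)..t, ∫ s in (0 : ℝ)..u, φ u s) + ∫ u in (0 : ℝ)..t, ∫ s in (0 : ℝ)..u, φ s u := by
  have hc : ∀ s, Continuous fun r => φ s r := fun s => hφ.comp (Continuous.prodMk continuous_const continuous_id)
  have hc' : ∀ r, Continuous fun s => φ s r := fun r => hφ.comp (Continuous.prodMk continuous_id continuous_const)
  have hψ : Continuous fun p : ℝ × ℝ => φ p.1 p.2 := hφ
  have c1 : Continuous fun s => ∫ r in (0 : ℝ)..s, φ s r :=
    intervalIntegral.continuous_parametric_intervalIntegral_of_continuous (f := φ) hφ continuous_id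
  have c2 : Continuous fun s => ∫ r in (0 : ℝ)..t, φ s r :=
    intervalIntegral.continuous_parametric_intervalIntegral_of_continuous (f := φ) hφ continuous_const
  have c3 : Continuous fun s => ∫ r in s..t, φ s r := by
    have : (fun s => ∫ r in s..t, φ s r) = fun s => (∫ r in (0 : ℝ)..t, φ s r) - ∫ r in (0 : ℝ)..s, φ s r := funext fun s =>
      (intervalIntegral.integral_interval_sub_left ((hc s).intervalIntegrable _ _) ((hc s).intervalIntegrable _ _)).symm
    rw [this]
    exact c2.sub c1
  have h1 : ∫ s in (0 : ℝ)..t, ∫ r in (0 : ℝ)..t, φ s r = (∫ u in (0 : ℝ)..t, ∫ s in (0 : ℝ)..u, φ u s) + ∫ s in (0 : ℝ)..t, ∫ r in s..t, φ s r := by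
    rw [← intervalIntegral.integral_add (c1.intervalIntegrable _ _) (c3.intervalIntegrable _ _)]
    refine intervalIntegral.integral_congr fun s _ => ?_
    exact (intervalIntegral.integral_add_adjacent_intervals ((hc s).intervalIntegrable _ _) ((hc s).intervalIntegrable _ _)).symm
  rw [h1]
  congr 1
  set μ := (volume : Measure ℝ).restrict (Set.Ioc 0 t) with hμ
  -- Both remaining integrals are iterated integrals of `φ` over the triangle `s < r`, in opposite
  -- orders.
  set ψ : ℝ → ℝ → ℝ := fun s r => {p : ℝ × ℝ | p.1 < p.2}.indicator (fun p => φ p.1 p.2) (s, r) with hψd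
  have hint : Integrable (Function.uncurry ψ) (μ.prod μ) := by
    have : Integrable (fun p : ℝ × ℝ => φ p.1 p.2) (μ.prod μ) := by
      rw [hμ, Measure.prod_restrict]
      exact (hφ.continuousOn.integrableOn_compact (isCompact_Icc.prod isCompact_Icc)).mono_set
        (Set.prod_mono Set.Ioc_subset_Icc_self Set.Ioc_subset_Icc_self)
    exact this.indicator (measurableSet_lt measurable_fst measurable_snd)
  have hsw := integral_integral_swap hint
  have e1 : ∫ s in (0 : ℝ)..t, ∫ r in s..t, φ s r = ∫ s, ∫ r, ψ s r ∂μ ∂μ := by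
    rw [intervalIntegral.integral_of_le ht, hμ]
    refine setIntegral_congr_fun measurableSet_Ioc fun s hs => ?_
    have : (fun r => ψ s r) = (Set.Ioi s).indicator fun r => φ s r := by
      funext r
      simp only [hψd, Set.indicator_apply, Set.mem_ofPred_eq, Set.mem_Ioi]
    rw [this, setIntegral_indicator measurableSet_Ioi, intervalIntegral.integral_of_le hs.2]
    congr 2
    ext r
    simp only [Set.mem_Ioc, Set.mem_inter_iff, Set.mem_Ioi]
    exact ⟨fun h => ⟨⟨hs.1.trans h.1, h.2⟩, h.1⟩, fun h => ⟨h.2, h.1.2⟩⟩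
  have e2 : ∫ u in (0 : ℝ)..t, ∫ s in (0 : ℝ)..u, φ s u = ∫ r, ∫ s, ψ s r ∂μ ∂μ := by
    rw [intervalIntegral.integral_of_le ht, hμ]
    refine setIntegral_congr_fun measurableSet_Ioc fun u hu => ?_
    have : (fun s => ψ s u) = (Set.Iio u).indicator fun s => φ s u := by
      funext r
      simp only [hψd, Set.indicator_apply, Set.mem_ofPred_eq, Set.mem_Iio]
    rw [this, setIntegral_indicator measurableSet_Iio, intervalIntegral.integral_of_le hu.1.le, integral_Ioc_eq_integral_Ioo]
    congr 2
    ext r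
    simp only [Set.mem_Ioc, Set.mem_inter_iff, Set.mem_Iio, Set.mem_Ioo]
    exact ⟨fun h => ⟨⟨h.1, h.2.le.trans hu.2⟩, h.2⟩, fun h => ⟨h.1.1, h.2⟩⟩
  rw [e1, e2, hsw]

lemma intervalIntegral_sum_sum {κ μ : Type*} [Fintype κ] [Fintype μ] {f : κ → μ → ℝ → ℝ} (hf : ∀ i j, Continuous (f i j)) (a b : ℝ) :
    ∫ x in a..b, ∑ i, ∑ j, f i j x = ∑ i, ∑ j, ∫ x in a..b, f i j x := by
  rw [intervalIntegral.integral_finsetSum fun i _ => (continuous_finsetSum _ fun j _ => hf i j).intervalIntegrable _ _]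
  exact Finset.sum_congr rfl fun i _ => intervalIntegral.integral_finsetSum fun j _ => (hf i j).intervalIntegrable _ _

namespace GLE

/-! ### Second moments of the position -/

section SecondMoment

variable {Ω : Type*} [MeasurableSpace Ω] {P : Measure Ω} [IsProbabilityMeasure P]

/-- Independent square integrable variables, one of them centred, are orthogonal. -/
lemma integral_mul_eq_zero_of_indepFun {X Y : Ω → ℝ} (h : IndepFun X Y P) (hX : MemLp X 2 P) (hY : MemLp Y 2 P) (h0 : ∫ ω, X ω ∂P = 0) :
    ∫ ω, X ω * Y ω ∂P = 0 := by
  rw [h.integral_fun_mul_eq_mul_integral hX.1 hY.1, h0, zero_mul]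

lemma IsSecondOrder.integral_partsIntegral_mul_eq_zero {X : ℝ → Ω → ℝ} (hX : IsSecondOrder P X) (f : ℝ → ℝ) {f' : ℝ → ℝ}
    (hf' : Continuous f') {t : ℝ} (ht : 0 ≤ t) (Z : Ω → ℝ) (hZ : MemLp Z 2 P) (h0 : ∀ s, 0 ≤ s → ∫ ω, X s ω * Z ω ∂P = 0) :
    ∫ ω, partsIntegral X f f' t ω * Z ω ∂P = 0 := by
  rw [hX.integral_partsIntegral_mul f hf' ht Z hZ, h0 t ht, mul_zero, zero_sub, neg_eq_zero]
  refine (intervalIntegral.integral_congr fun s hs => ?_).trans intervalIntegral.integral_zero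
  rw [Set.uIcc_of_le ht] at hs
  simp only [h0 s hs.1, mul_zero]

lemma IsSecondOrder.integral_integral_mul_eq_zero {X : ℝ → Ω → ℝ} (hX : IsSecondOrder P X) {f : ℝ → ℝ}
    (hf : Continuous f) {t : ℝ} (ht : 0 ≤ t) (Z : Ω → ℝ) (hZ : MemLp Z 2 P) (h0 : ∀ s, 0 ≤ s → ∫ ω, X s ω * Z ω ∂P = 0) :
    ∫ ω, (∫ s in (0 : ℝ)..t, f s * X s ω) * Z ω ∂P = 0 := by
  rw [(hX.integral le_rfl ht hf).2 Z hZ]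
  refine (intervalIntegral.integral_congr fun s hs => ?_).trans intervalIntegral.integral_zero
  rw [Set.uIcc_of_le ht] at hs
  simp only [h0 s hs.1, mul_zero]

lemma IsSecondOrder.integral_integral_mul_integral {X Y : ℝ → Ω → ℝ} (hX : IsSecondOrder P X) (hY : IsSecondOrder P Y) {f g : ℝ → ℝ} {ρ : ℝ → ℝ → ℝ}
    (hf : Continuous f) (hg : Continuous g) (hρ : ∀ s r, 0 ≤ s → 0 ≤ r → ∫ ω, X s ω * Y r ω ∂P = ρ s r) {t : ℝ} (ht : 0 ≤ t) :
    ∫ ω, (∫ s in (0 : ℝ)..t, f s * X s ω) * (∫ r in (0 : ℝ)..t, g r * Y r ω) ∂P = ∫ s in (0 : ℝ)..t, ∫ r in (0 : ℝ)..t, f s * ρ s r * g r := by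
  rw [(hX.integral le_rfl ht hf).2 _ (hY.integral le_rfl ht hg).1]
  refine intervalIntegral.integral_congr fun s hs => ?_
  rw [Set.uIcc_of_le ht] at hs
  rw [integral_mul_comm', (hY.integral le_rfl ht hg).2 _ (hX.memLp s hs.1), ← intervalIntegral.integral_const_mul]
  refine intervalIntegral.integral_congr fun r hr => ?_
  rw [Set.uIcc_of_le ht] at hr
  rw [integral_mul_comm', hρ s r hs.1 hr.1]
  ring

lemma integral_add_mul_add_of_orthogonal {X Y Z X' Y' Z' : Ω → ℝ} (hX : MemLp X 2 P) (hY : MemLp Y 2 P) (hZ : MemLp Z 2 P)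
    (hX' : MemLp X' 2 P) (hY' : MemLp Y' 2 P) (hZ' : MemLp Z' 2 P)
    (h1 : ∫ ω, Y ω * X' ω ∂P = 0) (h2 : ∫ ω, Y' ω * X ω ∂P = 0) (h3 : ∫ ω, Z ω * X' ω ∂P = 0) (h4 : ∫ ω, Z' ω * X ω ∂P = 0)
    (h5 : ∫ ω, Y ω * Z' ω ∂P = 0) (h6 : ∫ ω, Y' ω * Z ω ∂P = 0) :
    ∫ ω, (X ω + Y ω + Z ω) * (X' ω + Y' ω + Z' ω) ∂P = ∫ ω, X ω * X' ω ∂P + ∫ ω, Y ω * Y' ω ∂P + ∫ ω, Z ω * Z' ω ∂P := by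
  have e1 := integral_add_mul_add (X := fun ω => X ω + Y ω) (Y := fun ω => X' ω + Y' ω) (hX.add hY) hZ (hX'.add hY') hZ'
  have e2 := integral_add_mul_add hX hY hX' hY'
  have e3 : ∫ ω, Z ω * (X' ω + Y' ω) ∂P = 0 := by
    simp_rw [mul_add]
    rw [integral_add (integrable_mul_of_memLp hZ hX') (integrable_mul_of_memLp hZ hY'), h3, integral_mul_comm', h6, add_zero]
  have e4 : ∫ ω, (X ω + Y ω) * Z' ω ∂P = 0 := by
    simp_rw [add_mul]
    rw [integral_add (integrable_mul_of_memLp hX hZ') (integrable_mul_of_memLp hY hZ'), h5, integral_mul_comm', h4, add_zero]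
  have e5 : ∫ ω, X ω * Y' ω ∂P = 0 := by rw [integral_mul_comm', h2]
  rw [e1, e2, e3, e4, h1, e5]
  ring

variable {ι : Type*} [Fintype ι] [DecidableEq ι] {d q r k : ℕ}
variable (G : Coeff d q r k) (Γ : Matrix ι ι ℝ) (C : Matrix (Fin q) ι ℝ) (N : Matrix ι (Fin q) ℝ)

lemma continuous_response_matrix : Continuous (response G Γ C N) := continuous_matrix fun i j => continuous_response G Γ C N i j

lemma continuous_responseDeriv_matrix : Continuous (responseDeriv G Γ C N) := continuous_matrix fun i j => continuous_responseDeriv G Γ C N i j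

variable {κ : ℝ → Matrix (Fin q) (Fin q) ℝ} {ξ : ℝ → Ω → Fin r → ℝ} {W : ℝ≥0 → Ω → Fin k → ℝ} {v : ℝ → Ω → Fin d → ℝ}

/-- The second moments of the position in terms of the covariance function `R` of the noise. -/
lemma memLp_positionRep_and_integral_mul (hW : IsWiener P W) (hv : MemLp (v 0) 2 P) (hξ : ∀ b, IsSecondOrder P fun t ω => ξ t ω b)
    (hξ0 : ∀ t, 0 ≤ t → ∀ b, ∫ ω, ξ t ω b ∂P = 0) {R : ℝ → Matrix (Fin r) (Fin r) ℝ}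
    (hR : ∀ s u, 0 ≤ s → 0 ≤ u → ∀ b b', ∫ ω, ξ s ω b * ξ u ω b' ∂P = R (s - u) b b') (hRc : Continuous R)
    (hξW : IndepFun (path ξ) (fun ω t => W t ω) P) (hvξ : IndepFun (v 0) (path ξ) P) (hvW : IndepFun (v 0) (fun ω t => W t ω) P)
    {t : ℝ} (ht : 0 ≤ t) :
    (∀ i, MemLp (positionRep G Γ C N ξ W v t i) 2 P) ∧
    ∀ i j, ∫ ω, positionRep G Γ C N ξ W v t i ω * positionRep G Γ C N ξ W v t j ω ∂P =
      G.m ^ 2 * (response G Γ C N t * secondMoment P (v 0) * (response G Γ C N t)ᵀ) i j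
      + (∫ u in (0 : ℝ)..t, (response G Γ C N u * (G.σ₀ * G.σ₀ᵀ) * (response G Γ C N u)ᵀ) i j)
      + ∫ s in (0 : ℝ)..t, ∫ u in (0 : ℝ)..t, (response G Γ C N s * (G.σ * R (u - s) * G.σᵀ) * (response G Γ C N u)ᵀ) i j := by
  have hvi : ∀ i, MemLp (fun ω => v 0 ω i) 2 P := memLp_pi_iff.1 hv
  have mj : ∀ j, Measurable fun x : Fin d → ℝ => x j := fun j => measurable_pi_apply j
  have hWL := hW.isSecondOrder
  have cD := continuous_responseDeriv_mul G Γ C N G.σ₀ t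
  have cH := continuous_response_mul G Γ C N G.σ t
  have mX : ∀ i, MemLp (fun ω => ∑ j, (G.m * response G Γ C N t i j) * v 0 ω j) 2 P := fun i =>
    memLp_finsetSum _ fun j _ => (hvi j).const_mul _
  have mY' : ∀ i a, MemLp (partsIntegral (fun t ω => W t.toNNReal ω a) (fun s => (response G Γ C N (t - s) * G.σ₀) i a)
      (fun s => -(responseDeriv G Γ C N (t - s) * G.σ₀) i a) t) 2 P := fun i a => (hWL a).memLp_partsIntegral _ (cD i a).neg ht
  have mY : ∀ i, MemLp (fun ω => ∑ a, partsIntegral (fun t ω => W t.toNNReal ω a) (fun s => (response G Γ C N (t - s) * G.σ₀) i a)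
      (fun s => -(responseDeriv G Γ C N (t - s) * G.σ₀) i a) t ω) 2 P := fun i => memLp_finsetSum _ fun a _ => mY' i a
  have mZ' : ∀ i b, MemLp (fun ω => ∫ s in (0 : ℝ)..t, (response G Γ C N (t - s) * G.σ) i b * ξ s ω b) 2 P := fun i b =>
    ((hξ b).integral le_rfl ht (cH i b)).1
  have mZ : ∀ i, MemLp (fun ω => ∑ b, ∫ s in (0 : ℝ)..t, (response G Γ C N (t - s) * G.σ) i b * ξ s ω b) 2 P := fun i =>
    memLp_finsetSum _ fun b _ => mZ' i b
  -- Cross terms vanish by pairwise independence, since the Wiener process and the noise are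
  -- centred; the initial velocity may have nonzero mean.
  have oWv : ∀ a j (s : ℝ), 0 ≤ s → ∫ ω, W s.toNNReal ω a * v 0 ω j ∂P = 0 := fun a j s hs =>
    integral_mul_eq_zero_of_indepFun (hvW.symm.comp (φ := fun p : ℝ≥0 → Fin k → ℝ => p s.toNNReal a) (ψ := fun x : Fin d → ℝ => x j)
      (by fun_prop) (mj j)) (hW.memLp _ a) (hvi j) (hW.integral_eq_zero _ a)
  have oξv : ∀ b j (s : ℝ), 0 ≤ s → ∫ ω, ξ s ω b * v 0 ω j ∂P = 0 := fun b j s hs => by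
    have h1 := hvξ.symm.comp (φ := fun p : ℝ≥0 → Fin r → ℝ => p s.toNNReal b) (ψ := fun x : Fin d → ℝ => x j) (by fun_prop) (mj j)
    simp only [Function.comp_def, path, Real.coe_toNNReal _ hs] at h1
    exact integral_mul_eq_zero_of_indepFun h1 ((hξ b).memLp s hs) (hvi j) (hξ0 s hs b)
  have oξW : ∀ b a (s u : ℝ), 0 ≤ s → 0 ≤ u → ∫ ω, ξ s ω b * W u.toNNReal ω a ∂P = 0 := fun b a s u hs hu => by
    have h1 := hξW.comp (φ := fun p : ℝ≥0 → Fin r → ℝ => p s.toNNReal b) (ψ := fun p : ℝ≥0 → Fin k → ℝ => p u.toNNReal a) (by fun_prop) (by fun_prop)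
    simp only [Function.comp_def, path, Real.coe_toNNReal _ hs] at h1
    exact integral_mul_eq_zero_of_indepFun h1 ((hξ b).memLp s hs) (hW.memLp _ a) (hξ0 s hs b)
  refine ⟨fun i => ((mX i).add (mY i)).add (mZ i), fun i j => ?_⟩
  have oYX : ∀ i j, ∫ ω, (∑ a, partsIntegral (fun t ω => W t.toNNReal ω a) (fun s => (response G Γ C N (t - s) * G.σ₀) i a)
      (fun s => -(responseDeriv G Γ C N (t - s) * G.σ₀) i a) t ω) * (∑ l, (G.m * response G Γ C N t j l) * v 0 ω l) ∂P = 0 := fun i j => by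
    rw [integral_sum_mul (mY' i) (mX j)]
    refine Finset.sum_eq_zero fun a _ => (hWL a).integral_partsIntegral_mul_eq_zero _ (cD i a).neg ht _ (mX j) fun s hs => ?_
    rw [integral_mul_sum (hW.memLp _ a) fun l => (hvi l).const_mul _]
    refine Finset.sum_eq_zero fun l _ => ?_
    exact (integral_congr_ae (Eventually.of_forall fun ω => mul_left_comm _ _ _)).trans ((integral_const_mul _ _).trans (by rw [oWv a l s hs, mul_zero]))
  have oZX : ∀ i j, ∫ ω, (∑ b, ∫ s in (0 : ℝ)..t, (response G Γ C N (t - s) * G.σ) i b * ξ s ω b) * (∑ l, (G.m * response G Γ C N t j l) * v 0 ω l) ∂P = 0 := fun i j => by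
    rw [integral_sum_mul (mZ' i) (mX j)]
    refine Finset.sum_eq_zero fun b _ => (hξ b).integral_integral_mul_eq_zero (cH i b) ht _ (mX j) fun s hs => ?_
    rw [integral_mul_sum ((hξ b).memLp s hs) fun l => (hvi l).const_mul _]
    refine Finset.sum_eq_zero fun l _ => ?_
    exact (integral_congr_ae (Eventually.of_forall fun ω => mul_left_comm _ _ _)).trans ((integral_const_mul _ _).trans (by rw [oξv b l s hs, mul_zero]))
  have oYZ : ∀ i j, ∫ ω, (∑ a, partsIntegral (fun t ω => W t.toNNReal ω a) (fun s => (response G Γ C N (t - s) * G.σ₀) i a)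
      (fun s => -(responseDeriv G Γ C N (t - s) * G.σ₀) i a) t ω) * (∑ b, ∫ s in (0 : ℝ)..t, (response G Γ C N (t - s) * G.σ) j b * ξ s ω b) ∂P = 0 := fun i j => by
    rw [integral_sum_mul (mY' i) (mZ j)]
    refine Finset.sum_eq_zero fun a _ => (hWL a).integral_partsIntegral_mul_eq_zero _ (cD i a).neg ht _ (mZ j) fun s hs => ?_
    rw [integral_mul_comm', integral_sum_mul (mZ' j) (hW.memLp _ a)]
    exact Finset.sum_eq_zero fun b _ => (hξ b).integral_integral_mul_eq_zero (cH j b) ht _ (hW.memLp _ a) fun u hu => oξW b a u s hu hs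
  simp only [positionRep]
  rw [integral_add_mul_add_of_orthogonal (mX i) (mY i) (mZ i) (mX j) (mY j) (mZ j) (oYX i j) (oYX j i) (oZX i j) (oZX j i) (oYZ i j) (oYZ j i)]
  have cHm := continuous_response_matrix G Γ C N
  congr 1
  · congr 1
    · rw [integral_sum_mul (fun l => (hvi l).const_mul _) (mX j)]
      have : ∀ l, ∫ ω, G.m * response G Γ C N t i l * v 0 ω l * (∑ l', (G.m * response G Γ C N t j l') * v 0 ω l') ∂P =
          ∑ l', G.m ^ 2 * (response G Γ C N t i l * secondMoment P (v 0) l l' * response G Γ C N t j l') := fun l => by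
        rw [integral_mul_sum ((hvi l).const_mul _) fun l' => (hvi l').const_mul _]
        refine Finset.sum_congr rfl fun l' _ => ?_
        have e : ∀ ω, G.m * response G Γ C N t i l * v 0 ω l * (G.m * response G Γ C N t j l' * v 0 ω l') =
            (G.m ^ 2 * (response G Γ C N t i l * response G Γ C N t j l')) * (v 0 ω l * v 0 ω l') := fun ω => by ring
        simp_rw [e]
        rw [integral_const_mul, secondMoment, Matrix.of_apply]
        ring
      simp_rw [this]
      rw [Finset.sum_comm, Matrix.mul_apply, Finset.mul_sum]
      refine Finset.sum_congr rfl fun l' _ => ?_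
      rw [Matrix.mul_apply, Finset.sum_mul, Finset.mul_sum]
      rfl
    · rw [integral_sum_mul (mY' i) (mY j)]
      have e1 : ∀ a, ∫ ω, partsIntegral (fun t ω => W t.toNNReal ω a) (fun s => (response G Γ C N (t - s) * G.σ₀) i a)
          (fun s => -(responseDeriv G Γ C N (t - s) * G.σ₀) i a) t ω * (∑ a, partsIntegral (fun t ω => W t.toNNReal ω a) (fun s => (response G Γ C N (t - s) * G.σ₀) j a)
          (fun s => -(responseDeriv G Γ C N (t - s) * G.σ₀) j a) t ω) ∂P =
          ∫ s in (0 : ℝ)..t, (response G Γ C N (t - s) * G.σ₀) i a * (response G Γ C N (t - s) * G.σ₀) j a := fun a => by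
        have hd : ∀ i a s, HasDerivAt (fun s => (response G Γ C N (t - s) * G.σ₀) i a) (-(responseDeriv G Γ C N (t - s) * G.σ₀) i a) s := fun i a s => by
          simp only [Matrix.mul_apply, ← Finset.sum_neg_distrib]
          refine HasDerivAt.fun_sum fun l _ => ?_
          rw [← neg_mul]
          exact ((hasDerivAt_response G Γ C N (t - s) i l).comp_const_sub t s).mul_const _
        rw [integral_mul_sum (mY' i a) (mY' j)]
        rw [Finset.sum_congr rfl fun a' _ => integral_partsIntegral_mul_partsIntegral (hWL a) (hWL a') (if a = a' then 1 else 0)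
          (hW.integral_mul_toNNReal a a') (hd i a) (cD i a).neg (hd j a') (cD j a').neg ht le_rfl]
        simp
      have e0 : ∀ a, Continuous fun s => (response G Γ C N (t - s) * G.σ₀) i a * (response G Γ C N (t - s) * G.σ₀) j a := fun a =>
        (continuous_response_mul G Γ C N G.σ₀ t i a).mul (continuous_response_mul G Γ C N G.σ₀ t j a)
      simp_rw [e1]
      rw [← intervalIntegral.integral_finsetSum fun a _ => (e0 a).intervalIntegrable _ _]
      have e2 := intervalIntegral.integral_comp_sub_left (a := 0) (b := t) (fun u => (response G Γ C N u * (G.σ₀ * G.σ₀ᵀ) * (response G Γ C N u)ᵀ) i j) t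
      rw [sub_self, sub_zero] at e2
      rw [← e2]
      refine intervalIntegral.integral_congr fun s _ => ?_
      have e3 : response G Γ C N (t - s) * (G.σ₀ * G.σ₀ᵀ) * (response G Γ C N (t - s))ᵀ = (response G Γ C N (t - s) * G.σ₀) * (response G Γ C N (t - s) * G.σ₀)ᵀ := by
        simp only [Matrix.transpose_mul, Matrix.mul_assoc]
      rw [e3, Matrix.mul_apply]
      rfl
  · rw [integral_sum_mul (mZ' i) (mZ j)]
    have e1 : ∀ b, ∫ ω, (∫ s in (0 : ℝ)..t, (response G Γ C N (t - s) * G.σ) i b * ξ s ω b) *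
        (∑ b', ∫ s in (0 : ℝ)..t, (response G Γ C N (t - s) * G.σ) j b' * ξ s ω b') ∂P =
        ∑ b', ∫ s in (0 : ℝ)..t, ∫ u in (0 : ℝ)..t, (response G Γ C N (t - s) * G.σ) i b * R (s - u) b b' * (response G Γ C N (t - u) * G.σ) j b' := fun b => by
      rw [integral_mul_sum (mZ' i b) (mZ' j)]
      exact Finset.sum_congr rfl fun b' _ => (hξ b).integral_integral_mul_integral (ρ := fun s u => R (s - u) b b') (hξ b') (cH i b) (cH j b') (fun s u hs hu => hR s u hs hu b b') ht
    simp_rw [e1]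
    have cc : ∀ b b', Continuous fun p : ℝ × ℝ => (response G Γ C N (t - p.1) * G.σ) i b * R (p.1 - p.2) b b' * (response G Γ C N (t - p.2) * G.σ) j b' := fun b b' =>
      (((cH i b).comp continuous_fst).mul ((hRc.comp (continuous_fst.sub continuous_snd)).matrix_elem b b')).mul ((cH j b').comp continuous_snd)
    have cc1 : ∀ b b', Continuous fun s => ∫ u in (0 : ℝ)..t, (response G Γ C N (t - s) * G.σ) i b * R (s - u) b b' * (response G Γ C N (t - u) * G.σ) j b' := fun b b' =>
      intervalIntegral.continuous_parametric_intervalIntegral_of_continuous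
        (f := fun s u => (response G Γ C N (t - s) * G.σ) i b * R (s - u) b b' * (response G Γ C N (t - u) * G.σ) j b') (cc b b') continuous_const
    have cc2 : ∀ s b b', Continuous fun u => (response G Γ C N (t - s) * G.σ) i b * R (s - u) b b' * (response G Γ C N (t - u) * G.σ) j b' := fun s b b' =>
      (continuous_const.mul ((hRc.comp (continuous_const.sub continuous_id)).matrix_elem b b')).mul (cH j b')
    have e3 : ∀ s u, (response G Γ C N (t - s) * (G.σ * R (s - u) * G.σᵀ) * (response G Γ C N (t - u))ᵀ) i j =
        ∑ b, ∑ b', (response G Γ C N (t - s) * G.σ) i b * R (s - u) b b' * (response G Γ C N (t - u) * G.σ) j b' := fun s u => by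
      have e3' : response G Γ C N (t - s) * (G.σ * R (s - u) * G.σᵀ) * (response G Γ C N (t - u))ᵀ =
          (response G Γ C N (t - s) * G.σ) * R (s - u) * (response G Γ C N (t - u) * G.σ)ᵀ := by
        simp only [Matrix.transpose_mul, Matrix.mul_assoc]
      rw [e3', Matrix.mul_apply, Finset.sum_comm]
      refine Finset.sum_congr rfl fun b' _ => ?_
      rw [Matrix.mul_apply, Finset.sum_mul]
      rfl
    have e2 : ∑ b, ∑ b', ∫ s in (0 : ℝ)..t, ∫ u in (0 : ℝ)..t, (response G Γ C N (t - s) * G.σ) i b * R (s - u) b b' * (response G Γ C N (t - u) * G.σ) j b' =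
        ∫ s in (0 : ℝ)..t, ∫ u in (0 : ℝ)..t, (response G Γ C N (t - s) * (G.σ * R (s - u) * G.σᵀ) * (response G Γ C N (t - u))ᵀ) i j := by
      rw [← intervalIntegral_sum_sum cc1]
      refine intervalIntegral.integral_congr fun s _ => ?_
      refine (intervalIntegral_sum_sum (cc2 s) 0 t).symm.trans ?_
      exact intervalIntegral.integral_congr fun u _ => (e3 s u).symm
    rw [e2]
    -- Both times are reflected, `s ↦ t - s` and `u ↦ t - u`, which turns `R(s - u)` into `R(u -
    -- s)`.
    have e4 := intervalIntegral.integral_comp_sub_left (a := 0) (b := t)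
      (fun s => ∫ u in (0 : ℝ)..t, (response G Γ C N s * (G.σ * R (u - s) * G.σᵀ) * (response G Γ C N u)ᵀ) i j) t
    rw [sub_self, sub_zero] at e4
    rw [← e4]
    refine intervalIntegral.integral_congr fun s _ => ?_
    have e5 := intervalIntegral.integral_comp_sub_left (a := 0) (b := t)
      (fun u => (response G Γ C N (t - s) * (G.σ * R (u - (t - s)) * G.σᵀ) * (response G Γ C N u)ᵀ) i j) t
    rw [sub_self, sub_zero] at e5
    rw [← e5]
    refine intervalIntegral.integral_congr fun u _ => ?_
    rw [show t - u - (t - s) = s - u by ring]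

end SecondMoment

end GLE

/-! ### The joint realization of the memory function -/

lemma hasSum_matrix_exp {m : Type*} [Fintype m] [DecidableEq m] (A : Matrix m m ℝ) :
    HasSum (fun k : ℕ => ((k.factorial : ℝ)⁻¹) • A ^ k) (NormedSpace.exp A) := by
  let _ := Matrix.linftyOpNormedRing (n := m) (α := ℝ)
  let _ := Matrix.linftyOpNormedAlgebra (n := m) (R := ℝ) (α := ℝ)
  exact NormedSpace.exp_series_hasSum_exp' (𝕂 := ℝ) A

lemma exp_fromBlocks_diagonal {m n : Type*} [Fintype m] [DecidableEq m] [Fintype n] [DecidableEq n] (A : Matrix m m ℝ) (B : Matrix n n ℝ) :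
    NormedSpace.exp (Matrix.fromBlocks A 0 0 B) = Matrix.fromBlocks (NormedSpace.exp A) 0 0 (NormedSpace.exp B) := by
  let f : Matrix m m ℝ × Matrix n n ℝ →+ Matrix (m ⊕ n) (m ⊕ n) ℝ :=
    { toFun := fun p => Matrix.fromBlocks p.1 0 0 p.2
      map_zero' := by simp
      map_add' := fun p q => by simp [Matrix.fromBlocks_add] }
  have hf : Continuous f := Continuous.matrix_fromBlocks continuous_fst continuous_const continuous_const continuous_snd
  have h := ((hasSum_matrix_exp A).prodMk (hasSum_matrix_exp B)).map f hf
  have e : (f ∘ fun k : ℕ => (((k.factorial : ℝ)⁻¹) • A ^ k, ((k.factorial : ℝ)⁻¹) • B ^ k)) =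
      fun k : ℕ => ((k.factorial : ℝ)⁻¹) • Matrix.fromBlocks A 0 0 B ^ k := by
    funext k
    rw [Matrix.fromBlocks_diagonal_pow, Matrix.fromBlocks_smul, smul_zero, smul_zero]
    rfl
  rw [e] at h
  exact (hasSum_matrix_exp (Matrix.fromBlocks A 0 0 B)).unique h

namespace GLE

namespace Model

variable {q r : ℕ} (D : Model q r)

/-- The rate matrix of the joint realization of the memory function. -/
noncomputable def memΓ : Matrix (Fin D.d₁ ⊕ Fin D.d₂) (Fin D.d₁ ⊕ Fin D.d₂) ℝ := Matrix.fromBlocks D.sys₁.Γ 0 0 D.sys₂.Γ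

/-- The stationary covariance of the joint realization of the memory function. -/
noncomputable def memM : Matrix (Fin D.d₁ ⊕ Fin D.d₂) (Fin D.d₁ ⊕ Fin D.d₂) ℝ := Matrix.fromBlocks D.sys₁.M 0 0 D.sys₂.M

/-- The noise intensity of the joint realization of the memory function. -/
noncomputable def memS : Matrix (Fin D.d₁ ⊕ Fin D.d₂) (Fin D.q₁ ⊕ Fin D.q₂) ℝ := Matrix.fromBlocks D.sys₁.S 0 0 D.sys₂.S

/-- The output matrix of the joint realization of the memory function. -/
noncomputable def memC : Matrix (Fin q) (Fin D.d₁ ⊕ Fin D.d₂) ℝ := Matrix.fromCols (D.α₁ • D.sys₁.C) (D.α₂ • D.sys₂.C)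

variable {D}

lemma Standing.memM_transpose (hD : D.Standing) : D.memMᵀ = D.memM := by
  rw [memM, Matrix.fromBlocks_transpose, Matrix.transpose_zero, Matrix.transpose_zero]
  congr 1
  · simpa [Matrix.conjTranspose_eq_transpose_of_trivial] using hD.adm₁.posDef.1.eq
  · simpa [Matrix.conjTranspose_eq_transpose_of_trivial] using hD.adm₂.posDef.1.eq

/-- The inverse of the joint covariance is the weight of the memory variables in the energy. -/
lemma Standing.exists_memM_inv (hD : D.Standing) : ∃ Q, Q * D.memM = 1 ∧ Qᵀ = Q ∧ ∀ x, 0 ≤ x ⬝ᵥ (Q *ᵥ x) := by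
  have h1 := hD.adm₁.posDef
  have h2 := hD.adm₂.posDef
  refine ⟨Matrix.fromBlocks D.sys₁.M⁻¹ 0 0 D.sys₂.M⁻¹, ?_, ?_, fun x => ?_⟩
  · rw [memM, Matrix.fromBlocks_multiply]
    simp only [Matrix.mul_zero, Matrix.zero_mul, add_zero, zero_add]
    rw [Matrix.nonsing_inv_mul _ ((Matrix.isUnit_iff_isUnit_det _).1 h1.isUnit), Matrix.nonsing_inv_mul _ ((Matrix.isUnit_iff_isUnit_det _).1 h2.isUnit),
      Matrix.fromBlocks_one]
  · rw [Matrix.fromBlocks_transpose, Matrix.transpose_zero, Matrix.transpose_zero]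
    congr 1
    · simpa [Matrix.conjTranspose_eq_transpose_of_trivial] using h1.inv.1.eq
    · simpa [Matrix.conjTranspose_eq_transpose_of_trivial] using h2.inv.1.eq
  · have e : x ⬝ᵥ (Matrix.fromBlocks D.sys₁.M⁻¹ 0 0 D.sys₂.M⁻¹ *ᵥ x) =
        (x ∘ Sum.inl) ⬝ᵥ (D.sys₁.M⁻¹ *ᵥ (x ∘ Sum.inl)) + (x ∘ Sum.inr) ⬝ᵥ (D.sys₂.M⁻¹ *ᵥ (x ∘ Sum.inr)) := by
      rw [Matrix.fromBlocks_mulVec, dotProduct, Fintype.sum_sum_type]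
      simp [dotProduct]
    rw [e]
    exact add_nonneg (by simpa using h1.inv.posSemidef.dotProduct_mulVec_nonneg (x ∘ Sum.inl))
      (by simpa using h2.inv.posSemidef.dotProduct_mulVec_nonneg (x ∘ Sum.inr))

lemma Standing.mem_lyapunov (hD : D.Standing) : D.memΓ * D.memM + D.memM * D.memΓᵀ = D.memS * D.memSᵀ := by
  simp only [memΓ, memM, memS, Matrix.fromBlocks_transpose, Matrix.fromBlocks_multiply, Matrix.fromBlocks_add, Matrix.transpose_zero,
    Matrix.mul_zero, Matrix.zero_mul, add_zero, zero_add]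
  rw [hD.adm₁.lyapunov, hD.adm₂.lyapunov]

/-- The switches enter the joint output matrix, hence twice; they are idempotent. -/
lemma κ_eq_exp (hD : D.Standing) (t : ℝ) (ht : 0 ≤ t) : D.κ t = D.memC * NormedSpace.exp (t • -D.memΓ) * (D.memM * D.memCᵀ) := by
  have h : t • -D.memΓ = Matrix.fromBlocks (-(t • D.sys₁.Γ)) 0 0 (-(t • D.sys₂.Γ)) := by
    simp [memΓ, Matrix.fromBlocks_neg, Matrix.fromBlocks_smul]
  have a1 : D.α₁ * D.α₁ = D.α₁ := by rcases hD.switch₁ with h | h <;> simp [h]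
  have a2 : D.α₂ * D.α₂ = D.α₂ := by rcases hD.switch₂ with h | h <;> simp [h]
  rw [h, exp_fromBlocks_diagonal, κ, Realization.kernel, Realization.kernel, abs_of_nonneg ht, memC, memM, Matrix.transpose_fromCols,
    Matrix.fromBlocks_mul_fromRows, Matrix.fromCols_mul_fromBlocks, Matrix.fromCols_mul_fromRows]
  simp only [Matrix.mul_zero, Matrix.zero_mul, add_zero, zero_add, smul_zero, Matrix.transpose_smul, Matrix.smul_mul, Matrix.mul_smul, smul_smul, a1, a2, Matrix.mul_assoc]

lemma κ_abs (t : ℝ) : D.κ |t| = D.κ t := by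
  simp only [κ, Realization.kernel, abs_abs]

lemma κ_neg (t : ℝ) : D.κ (-t) = D.κ t := by
  rw [← κ_abs, abs_neg, κ_abs]

lemma continuous_κ (hD : D.Standing) : Continuous D.κ := by
  have h : D.κ = fun t => D.memC * NormedSpace.exp (|t| • -D.memΓ) * (D.memM * D.memCᵀ) := funext fun t => by
    rw [← κ_abs, κ_eq_exp hD _ (abs_nonneg t)]
  rw [h]
  have : Continuous fun t : ℝ => NormedSpace.exp (|t| • -D.memΓ) := continuous_matrix fun i j => (continuous_exp_smul_apply (-D.memΓ) i j).comp continuous_abs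
  exact (continuous_const.matrix_mul this).matrix_mul continuous_const

end Model

/-! ### The mean-squared displacement -/

section Displacement

variable {d q k : ℕ} {D : Model q q} {G : Coeff d q q k}

/-- The response function of the generalized Langevin equation. -/
noncomputable def modelResponse (D : Model q q) (G : Coeff d q q k) : ℝ → Matrix (Fin d) (Fin d) ℝ :=
  response G D.memΓ D.memC (D.memM * D.memCᵀ)

/-- The derivative of the response function of the generalized Langevin equation. -/
noncomputable def modelResponseDeriv (D : Model q q) (G : Coeff d q q k) : ℝ → Matrix (Fin d) (Fin d) ℝ :=
  responseDeriv G D.memΓ D.memC (D.memM * D.memCᵀ)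

lemma isResponse_modelResponse (hD : D.Standing) : IsResponse G D.κ (modelResponse D G) :=
  isResponse_response _ _ _ _ _ (D.κ_eq_exp hD)

lemma continuous_modelResponse : Continuous (modelResponse D G) := continuous_response_matrix _ _ _ _

lemma continuous_modelResponseDeriv : Continuous (modelResponseDeriv D G) := continuous_responseDeriv_matrix _ _ _ _

/-- By uniqueness of Laplace transforms every admissible `H`, together with its one-sided
derivative, agrees on `[0, ∞)` with the explicit response function. -/
lemma IsResponse.msdExpr_eq (hD : D.Standing) {H : ℝ → Matrix (Fin d) (Fin d) ℝ} (hH : IsResponse G D.κ H) (KE : Matrix (Fin d) (Fin d) ℝ)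
    {t : ℝ} (ht : 0 ≤ t) (i j) :
    msdExpr G H KE t i j = 2 * (∫ u in (0 : ℝ)..t, modelResponse D G u i j)
      + 2 * G.m * ((modelResponse D G t * KE * (modelResponse D G t)ᵀ) i j - ∫ u in (0 : ℝ)..t, (modelResponse D G u * (modelResponseDeriv D G u)ᵀ) i j)
      + ∫ u in (0 : ℝ)..t, (modelResponse D G u * (G.σ₀ * G.σ₀ᵀ - (2 : ℝ) • G.γ₀ᵀ) * (modelResponse D G u)ᵀ) i j := by
  have e1 : ∀ u, 0 ≤ u → H u = modelResponse D G u := hH.eqOn G (isResponse_modelResponse hD)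
  have e2 : ∀ u, 0 ≤ u → matDeriv H u = modelResponseDeriv D G u := matDeriv_of_eqOn_response _ _ _ _ e1
  have hI : ∀ {f g : ℝ → ℝ}, (∀ u, 0 ≤ u → f u = g u) → ∫ u in (0 : ℝ)..t, f u = ∫ u in (0 : ℝ)..t, g u := fun hfg =>
    intervalIntegral.integral_congr fun u hu => by
      rw [Set.uIcc_of_le ht] at hu
      exact hfg u hu.1
  simp only [msdExpr, matIntegral, Matrix.add_apply, Matrix.smul_apply, Matrix.sub_apply, Matrix.of_apply, smul_eq_mul]
  rw [e1 t ht, hI fun u hu => congrFun (congrFun (e1 u hu) i) j,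
    hI (f := fun u => (H u * (matDeriv H u)ᵀ) i j) (g := fun u => (modelResponse D G u * (modelResponseDeriv D G u)ᵀ) i j) fun u hu => by rw [e1 u hu, e2 u hu],
    hI (f := fun u => (H u * (G.σ₀ * G.σ₀ᵀ - (2 : ℝ) • G.γ₀ᵀ) * (H u)ᵀ) i j)
      (g := fun u => (modelResponse D G u * (G.σ₀ * G.σ₀ᵀ - (2 : ℝ) • G.γ₀ᵀ) * (modelResponse D G u)ᵀ) i j) fun u hu => by rw [e1 u hu]]

variable {Ω : Type*} [MeasurableSpace Ω] {P : Measure Ω} [IsProbabilityMeasure P]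
  {ξ : ℝ → Ω → Fin q → ℝ} {W : ℝ≥0 → Ω → Fin k → ℝ} {v : ℝ → Ω → Fin d → ℝ}

/-- Split the square along its diagonal. On one triangle the inner integral is the convolution in
the Volterra equation, hence equal to `I - m H' - H γ₀`; the other triangle is its transpose. -/
lemma memory_double_integral (hD : D.Standing) (hR : ∀ t, D.R t = D.κ t) (hFD : ∀ t, G.σ * D.κ t * G.σᵀ = G.hᵀ * (D.κ t)ᵀ * G.gᵀ)
    {t : ℝ} (ht : 0 ≤ t) (i j) :
    ∫ s in (0 : ℝ)..t, ∫ u in (0 : ℝ)..t, (modelResponse D G s * (G.σ * D.R (u - s) * G.σᵀ) * (modelResponse D G u)ᵀ) i j =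
      (∫ u in (0 : ℝ)..t, ((1 - G.m • modelResponseDeriv D G u - modelResponse D G u * G.γ₀) * (modelResponse D G u)ᵀ) j i) +
      ∫ u in (0 : ℝ)..t, ((1 - G.m • modelResponseDeriv D G u - modelResponse D G u * G.γ₀) * (modelResponse D G u)ᵀ) i j := by
  -- `R(-t) = R(t)*` and `κ` is even, so `R = κ` forces `κ` to be symmetric.
  have hκs : ∀ t, (D.κ t)ᵀ = D.κ t := fun t => by
    rw [← hR, ← D.R_neg hD, hR, hR, D.κ_neg]
  -- Transposing the hypothesis converts the noise coefficients into the memory coefficients of the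
  -- Volterra equation.
  have hK : ∀ t, G.g * D.κ t * G.h = G.σ * D.κ t * G.σᵀ := fun t => by
    have h1 := congrArg Matrix.transpose (hFD t)
    simp only [Matrix.transpose_mul, Matrix.transpose_transpose, hκs] at h1
    rw [Matrix.mul_assoc, ← h1, Matrix.mul_assoc]
  have hc := continuous_modelResponse (D := D) (G := G)
  have hφ : ∀ i j, Continuous fun p : ℝ × ℝ => (modelResponse D G p.1 * (G.σ * D.R (p.2 - p.1) * G.σᵀ) * (modelResponse D G p.2)ᵀ) i j := fun i j => by
    simp_rw [hR]
    have h1 : Continuous fun p : ℝ × ℝ => D.κ (p.2 - p.1) := (D.continuous_κ hD).comp (continuous_snd.sub continuous_fst)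
    exact (((hc.comp continuous_fst).matrix_mul ((continuous_const.matrix_mul h1).matrix_mul continuous_const)).matrix_mul
      (hc.comp continuous_snd).matrix_transpose).matrix_elem i j
  rw [intervalIntegral_square_eq_triangles (φ := fun s u => (modelResponse D G s * (G.σ * D.R (u - s) * G.σᵀ) * (modelResponse D G u)ᵀ) i j) (hφ i j) ht]
  have key : ∀ i j u, 0 ≤ u → ∫ s in (0 : ℝ)..u, (modelResponse D G s * (G.σ * D.R (u - s) * G.σᵀ) * (modelResponse D G u)ᵀ) i j =
      ((1 - G.m • modelResponseDeriv D G u - modelResponse D G u * G.γ₀) * (modelResponse D G u)ᵀ) i j := fun i j u hu => by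
    have e1 : ∀ l, (1 - G.m • modelResponseDeriv D G u - modelResponse D G u * G.γ₀) i l = ∫ s in (0 : ℝ)..u, (modelResponse D G s * (G.σ * D.R (u - s) * G.σᵀ)) i l := fun l => by
      have h1 := response_volterra G D.memΓ D.memC (D.memM * D.memCᵀ) u i l
      have h2 : ∫ s in (0 : ℝ)..u, (response G D.memΓ D.memC (D.memM * D.memCᵀ) s *
          (G.g * (D.memC * NormedSpace.exp ((u - s) • -D.memΓ) * (D.memM * D.memCᵀ)) * G.h)) i l =
          ∫ s in (0 : ℝ)..u, (modelResponse D G s * (G.σ * D.R (u - s) * G.σᵀ)) i l := by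
        refine intervalIntegral.integral_congr fun s hs => ?_
        rw [Set.uIcc_of_le hu] at hs
        rw [← D.κ_eq_exp hD _ (sub_nonneg.2 hs.2), hK, hR]
        rfl
      rw [h2] at h1
      rw [Matrix.sub_apply, Matrix.sub_apply, Matrix.smul_apply, smul_eq_mul, ← h1]
      simp only [modelResponse, modelResponseDeriv]
      ring
    have hci : ∀ l, Continuous fun s => (modelResponse D G s * (G.σ * D.R (u - s) * G.σᵀ)) i l := fun l => by
      simp_rw [hR]
      have h1 : Continuous fun s => D.κ (u - s) := (D.continuous_κ hD).comp (continuous_const.sub continuous_id)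
      exact (hc.matrix_mul ((continuous_const.matrix_mul h1).matrix_mul continuous_const)).matrix_elem i l
    have hci' : ∀ l, Continuous fun s => (modelResponse D G s * (G.σ * D.R (u - s) * G.σᵀ)) i l * (modelResponse D G u)ᵀ l j := fun l =>
      (hci l).mul continuous_const
    rw [Matrix.mul_apply]
    simp_rw [e1, ← intervalIntegral.integral_mul_const]
    rw [← intervalIntegral.integral_finsetSum fun l _ => (hci' l).intervalIntegrable _ _]
    exact intervalIntegral.integral_congr fun s _ => Matrix.mul_apply
  congr 1
  · refine intervalIntegral.integral_congr fun u hu => ?_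
    rw [Set.uIcc_of_le ht] at hu
    rw [← key j i u hu.1]
    refine intervalIntegral.integral_congr fun s _ => ?_
    rw [← Matrix.transpose_apply (modelResponse D G s * (G.σ * D.R (u - s) * G.σᵀ) * (modelResponse D G u)ᵀ)]
    simp only [Matrix.transpose_mul, Matrix.transpose_transpose, hR, hκs, Matrix.mul_assoc]
    rw [← D.κ_neg, neg_sub]
  · refine intervalIntegral.integral_congr fun u hu => ?_
    rw [Set.uIcc_of_le ht] at hu
    exact key i j u hu.1

/-- The moment formula, the evaluated double integral and the expression `A(t)` are compared term by
term: `2m 𝓔 = m² E[v v*]`, and `∫ (I - m H' - H γ₀) H*` plus its transpose supplies the remaining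
terms of the symmetrization. -/
theorem memLp_position_and_secondMoment (hD : D.Standing) (hR : ∀ t, D.R t = D.κ t) (hFD : ∀ t, G.σ * D.κ t * G.σᵀ = G.hᵀ * (D.κ t)ᵀ * G.gᵀ)
    {H : ℝ → Matrix (Fin d) (Fin d) ℝ} (hH : IsResponse G D.κ H) (hξ : IsNoise D P ξ) (hs : IsSolution G D.κ P ξ W v) (hv : MemLp (v 0) 2 P)
    {t : ℝ} (ht : 0 ≤ t) :
    MemLp (position v t) 2 P ∧ secondMoment P (position v t) =
      (1 / 2 : ℝ) • (msdExpr G H (kineticEnergy G P v) t + (msdExpr G H (kineticEnergy G P v) t)ᵀ) := by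
  have hL := hξ.isSecondOrder hD
  have hRc : Continuous D.R := by rw [show D.R = D.κ from funext hR]; exact D.continuous_κ hD
  obtain ⟨h1, h2⟩ := memLp_positionRep_and_integral_mul G D.memΓ D.memC (D.memM * D.memCᵀ) hs.wiener hv hL
    (fun t ht b => hξ.integral_eq_zero hD ht b) (fun s u hs hu b b' => hξ.integral_mul hD hs hu b b') hRc
    hs.indep_noise_wiener hs.indep_zero_noise hs.indep_zero_wiener ht
  have hae : ∀ᵐ ω ∂P, ∀ i, position v t ω i = positionRep G D.memΓ D.memC (D.memM * D.memCᵀ) ξ W v t i ω :=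
    (hs.eq_apply G D.memΓ D.memC (D.memM * D.memCᵀ) (D.κ_eq_exp hD) (ae_all_iff.2 fun i => (hL i).continuous)).mono fun ω h i => h t ht i
  refine ⟨memLp_pi_iff.2 fun i => (memLp_congr_ae (hae.mono fun ω h => h i)).2 (h1 i), ?_⟩
  ext i j
  have e1 : secondMoment P (position v t) i j = ∫ ω, positionRep G D.memΓ D.memC (D.memM * D.memCᵀ) ξ W v t i ω * positionRep G D.memΓ D.memC (D.memM * D.memCᵀ) ξ W v t j ω ∂P := by
    rw [secondMoment, Matrix.of_apply]
    exact integral_congr_ae (hae.mono fun ω h => by simp only [h i, h j])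
  have e2 := memory_double_integral hD hR hFD ht i j
  simp only [modelResponse] at e2
  rw [e1, h2 i j, e2]
  rw [Matrix.smul_apply, Matrix.add_apply, Matrix.transpose_apply, hH.msdExpr_eq hD _ ht, hH.msdExpr_eq hD _ ht, smul_eq_mul]
  change _ * (modelResponse D G t * secondMoment P (v 0) * (modelResponse D G t)ᵀ) i j + (∫ u in (0 : ℝ)..t, (modelResponse D G u * (G.σ₀ * G.σ₀ᵀ) * (modelResponse D G u)ᵀ) i j) +
    ((∫ u in (0 : ℝ)..t, ((1 - G.m • modelResponseDeriv D G u - modelResponse D G u * G.γ₀) * (modelResponse D G u)ᵀ) j i) +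
      ∫ u in (0 : ℝ)..t, ((1 - G.m • modelResponseDeriv D G u - modelResponse D G u * G.γ₀) * (modelResponse D G u)ᵀ) i j) = _
  have hc := continuous_modelResponse (D := D) (G := G)
  have hc' := continuous_modelResponseDeriv (D := D) (G := G)
  have i1 : ∀ i j, IntervalIntegrable (fun u => modelResponse D G u i j) volume 0 t := fun i j => (hc.matrix_elem i j).intervalIntegrable _ _
  have i2 : ∀ i j, IntervalIntegrable (fun u => (modelResponse D G u * (modelResponseDeriv D G u)ᵀ) i j) volume 0 t := fun i j =>
    ((hc.matrix_mul hc'.matrix_transpose).matrix_elem i j).intervalIntegrable _ _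
  have i3 : ∀ (A : Matrix (Fin d) (Fin d) ℝ) i j, IntervalIntegrable (fun u => (modelResponse D G u * A * (modelResponse D G u)ᵀ) i j) volume 0 t := fun A i j =>
    (((hc.matrix_mul continuous_const).matrix_mul hc.matrix_transpose).matrix_elem i j).intervalIntegrable _ _
  have p1 : ∀ i j, ∫ u in (0 : ℝ)..t, ((1 - G.m • modelResponseDeriv D G u - modelResponse D G u * G.γ₀) * (modelResponse D G u)ᵀ) i j =
      (∫ u in (0 : ℝ)..t, modelResponse D G u j i) - G.m * (∫ u in (0 : ℝ)..t, (modelResponse D G u * (modelResponseDeriv D G u)ᵀ) j i)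
        - ∫ u in (0 : ℝ)..t, (modelResponse D G u * G.γ₀ * (modelResponse D G u)ᵀ) i j := fun i j => by
    rw [← intervalIntegral.integral_const_mul, ← intervalIntegral.integral_sub (i1 j i) ((i2 j i).const_mul _),
      ← intervalIntegral.integral_sub ((i1 j i).sub ((i2 j i).const_mul _)) (i3 _ i j)]
    refine intervalIntegral.integral_congr fun u _ => ?_
    rw [← Matrix.transpose_apply (modelResponse D G u * (modelResponseDeriv D G u)ᵀ) i j, Matrix.transpose_mul, Matrix.transpose_transpose]
    simp only [Matrix.sub_mul, Matrix.one_mul, Matrix.smul_mul, Matrix.sub_apply, Matrix.smul_apply, smul_eq_mul, Matrix.transpose_apply]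
  have p2 : ∀ i j, ∫ u in (0 : ℝ)..t, (modelResponse D G u * (G.σ₀ * G.σ₀ᵀ - (2 : ℝ) • G.γ₀ᵀ) * (modelResponse D G u)ᵀ) i j =
      (∫ u in (0 : ℝ)..t, (modelResponse D G u * (G.σ₀ * G.σ₀ᵀ) * (modelResponse D G u)ᵀ) i j)
        - 2 * ∫ u in (0 : ℝ)..t, (modelResponse D G u * G.γ₀ * (modelResponse D G u)ᵀ) j i := fun i j => by
    rw [← intervalIntegral.integral_const_mul, ← intervalIntegral.integral_sub (i3 _ i j) ((i3 _ j i).const_mul _)]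
    refine intervalIntegral.integral_congr fun u _ => ?_
    rw [← Matrix.transpose_apply (modelResponse D G u * G.γ₀ * (modelResponse D G u)ᵀ) i j]
    simp only [Matrix.transpose_mul, Matrix.transpose_transpose, Matrix.mul_sub, Matrix.sub_mul, Matrix.mul_smul, Matrix.smul_mul, Matrix.sub_apply, Matrix.smul_apply, smul_eq_mul, Matrix.mul_assoc]
  have p3 : ∫ u in (0 : ℝ)..t, (modelResponse D G u * (G.σ₀ * G.σ₀ᵀ) * (modelResponse D G u)ᵀ) j i =
      ∫ u in (0 : ℝ)..t, (modelResponse D G u * (G.σ₀ * G.σ₀ᵀ) * (modelResponse D G u)ᵀ) i j := by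
    refine intervalIntegral.integral_congr fun u _ => ?_
    rw [← Matrix.transpose_apply (modelResponse D G u * (G.σ₀ * G.σ₀ᵀ) * (modelResponse D G u)ᵀ) i j]
    simp only [Matrix.transpose_mul, Matrix.transpose_transpose, Matrix.mul_assoc]
  have p4 : ∀ i j, (modelResponse D G t * kineticEnergy G P v * (modelResponse D G t)ᵀ) i j =
      1 / 2 * G.m * (modelResponse D G t * secondMoment P (v 0) * (modelResponse D G t)ᵀ) i j := fun i j => by
    rw [kineticEnergy, Matrix.mul_smul, Matrix.smul_mul, Matrix.smul_apply, smul_eq_mul]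
  have p5 : (modelResponse D G t * secondMoment P (v 0) * (modelResponse D G t)ᵀ) j i = (modelResponse D G t * secondMoment P (v 0) * (modelResponse D G t)ᵀ) i j := by
    have hsym : (secondMoment P (v 0))ᵀ = secondMoment P (v 0) := by
      ext a b
      exact integral_mul_comm' _ _
    rw [← Matrix.transpose_apply (modelResponse D G t * secondMoment P (v 0) * (modelResponse D G t)ᵀ) i j]
    simp only [Matrix.transpose_mul, Matrix.transpose_transpose, Matrix.mul_assoc, hsym]
  rw [p1, p1, p2, p2, p3, p4, p4, p5]
  ring

end Displacement

end GLE

lemma HasDerivAt.dotProduct_of_components {κ : Type*} [Fintype κ] {f g : ℝ → κ → ℝ} {f' g' : κ → ℝ} {t : ℝ}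
    (hf : ∀ i, HasDerivAt (fun t => f t i) (f' i) t) (hg : ∀ i, HasDerivAt (fun t => g t i) (g' i) t) :
    HasDerivAt (fun t => f t ⬝ᵥ g t) (f' ⬝ᵥ g t + f t ⬝ᵥ g') t := by
  simp only [dotProduct, ← Finset.sum_add_distrib]
  exact HasDerivAt.fun_sum fun i _ => (hf i).fun_mul (hg i)

lemma hasDerivAt_mulVec_apply {κ μ : Type*} [Fintype κ] (A : Matrix μ κ ℝ) {f : ℝ → κ → ℝ} {f' : κ → ℝ} {t : ℝ}
    (hf : ∀ i, HasDerivAt (fun t => f t i) (f' i) t) (i : μ) : HasDerivAt (fun t => (A *ᵥ f t) i) ((A *ᵥ f') i) t := by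
  simp only [Matrix.mulVec, dotProduct]
  exact HasDerivAt.fun_sum fun j _ => (hf j).const_mul _

/-- The quadratic form of `ΓM` in terms of the noise intensity. -/
lemma two_mul_dotProduct_lyapunov {ι μ : Type*} [Fintype ι] [Fintype μ] {Γ M : Matrix ι ι ℝ} {S : Matrix ι μ ℝ} (hM : Mᵀ = M)
    (hL : Γ * M + M * Γᵀ = S * Sᵀ) (p : ι → ℝ) : 2 * (p ⬝ᵥ ((Γ * M) *ᵥ p)) = (Sᵀ *ᵥ p) ⬝ᵥ (Sᵀ *ᵥ p) := by
  have h1 : p ⬝ᵥ ((M * Γᵀ) *ᵥ p) = p ⬝ᵥ ((Γ * M) *ᵥ p) := by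
    have : M * Γᵀ = (Γ * M)ᵀ := by rw [Matrix.transpose_mul, hM]
    rw [this, Matrix.mulVec_transpose, dotProduct_comm, ← Matrix.dotProduct_mulVec]
  have h2 : p ⬝ᵥ ((S * Sᵀ) *ᵥ p) = (Sᵀ *ᵥ p) ⬝ᵥ (Sᵀ *ᵥ p) := by
    rw [← Matrix.mulVec_mulVec, Matrix.dotProduct_mulVec, ← Matrix.mulVec_transpose]
  rw [← h2, ← hL, Matrix.add_mulVec, dotProduct_add, h1]
  ring

namespace GLE

/-! ### Energy decay and bounds for the response function -/

section Energy

variable {ι μ : Type*} [Fintype ι] [DecidableEq ι] [Fintype μ] {d q r k : ℕ}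
variable (G : Coeff d q r k) (Γ : Matrix ι ι ℝ) (C : Matrix (Fin q) ι ℝ) (N : Matrix ι (Fin q) ℝ)

lemma augGen_mulVec (z : Fin d ⊕ Fin d ⊕ ι → ℝ) :
    augGen G Γ C N *ᵥ z = Sum.elim (fun i => z (Sum.inr (Sum.inl i)))
      (Sum.elim (-(G.m⁻¹ • (G.γ₀ *ᵥ fun i => z (Sum.inr (Sum.inl i)))) - G.m⁻¹ • ((G.g * C) *ᵥ fun l => z (Sum.inr (Sum.inr l))))
        (((N * G.h) *ᵥ fun i => z (Sum.inr (Sum.inl i))) - Γ *ᵥ fun l => z (Sum.inr (Sum.inr l)))) := by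
  ext x
  rcases x with i | i | l
  · simp only [augGen, Matrix.mulVec, dotProduct, Fintype.sum_sum_type, Matrix.fromBlocks_apply₁₁, Matrix.fromBlocks_apply₁₂,
      Matrix.fromCols_apply_inl, Matrix.fromCols_apply_inr, Matrix.zero_apply, zero_mul, Finset.sum_const_zero, zero_add, add_zero, Sum.elim_inl]
    exact congrFun (Matrix.one_mulVec fun i => z (Sum.inr (Sum.inl i))) i
  · simp only [augGen, Matrix.mulVec, dotProduct, Fintype.sum_sum_type, Matrix.fromBlocks_apply₂₁, Matrix.fromBlocks_apply₂₂, Matrix.fromBlocks_apply₁₁, Matrix.fromBlocks_apply₁₂,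
      Matrix.zero_apply, zero_mul, Finset.sum_const_zero, zero_add, Sum.elim_inl, Sum.elim_inr, Matrix.neg_apply, Matrix.smul_apply, smul_eq_mul, neg_mul, Finset.sum_neg_distrib,
      mul_assoc, ← Finset.mul_sum, ← sub_eq_add_neg, Pi.sub_apply, Pi.neg_apply, Pi.smul_apply]
  · simp only [augGen, Matrix.mulVec, dotProduct, Fintype.sum_sum_type, Matrix.fromBlocks_apply₂₁, Matrix.fromBlocks_apply₂₂,
      Matrix.zero_apply, zero_mul, Finset.sum_const_zero, zero_add, Sum.elim_inr, Matrix.neg_apply, neg_mul, Finset.sum_neg_distrib, ← sub_eq_add_neg, Pi.sub_apply]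

lemma exp_smul_mul_comm {κ : Type*} [Fintype κ] [DecidableEq κ] (B : Matrix κ κ ℝ) (t : ℝ) :
    B * NormedSpace.exp (t • B) = NormedSpace.exp (t • B) * B := by
  ext i j
  exact (hasDerivAt_exp_smul_apply' B t i j).unique (hasDerivAt_exp_smul_apply B t i j)

/-- The velocity component of a solution of the Markovian system. -/
lemma exp_augGen_mulVec_inr_inl (z : Fin d ⊕ Fin d ⊕ ι → ℝ) (t : ℝ) (i : Fin d) :
    (NormedSpace.exp (t • augGen G Γ C N) *ᵥ z) (Sum.inr (Sum.inl i)) =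
      (NormedSpace.exp (t • augGen G Γ C N) *ᵥ (augGen G Γ C N *ᵥ z)) (Sum.inl i) := by
  rw [Matrix.mulVec_mulVec, ← exp_smul_mul_comm, ← Matrix.mulVec_mulVec, augGen_mulVec]
  rfl

variable {G Γ C}

/-- The energy of the Markovian system is nonincreasing, so the velocities stay bounded. -/
lemma exists_abs_velocity_le (hγ : ∀ x, 0 ≤ x ⬝ᵥ (G.γ₀ *ᵥ x)) (hh : G.h = G.gᵀ) {M Q : Matrix ι ι ℝ} {S : Matrix ι μ ℝ} (hM : Mᵀ = M)
    (hL : Γ * M + M * Γᵀ = S * Sᵀ) (hQM : Q * M = 1) (hQ : Qᵀ = Q) (hQ0 : ∀ x, 0 ≤ x ⬝ᵥ (Q *ᵥ x)) (z : Fin d ⊕ Fin d ⊕ ι → ℝ) :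
    ∃ b, ∀ t : ℝ, 0 ≤ t → ∀ i, |(NormedSpace.exp (t • augGen G Γ C (M * Cᵀ)) *ᵥ z) (Sum.inr (Sum.inl i))| ≤ b := by
  set A := augGen G Γ C (M * Cᵀ) with hA
  set w : ℝ → Fin d → ℝ := fun t i => (NormedSpace.exp (t • A) *ᵥ z) (Sum.inr (Sum.inl i)) with hw
  set y : ℝ → ι → ℝ := fun t l => (NormedSpace.exp (t • A) *ᵥ z) (Sum.inr (Sum.inr l)) with hy
  have hd : ∀ t x, HasDerivAt (fun t => (NormedSpace.exp (t • A) *ᵥ z) x) ((A *ᵥ (NormedSpace.exp (t • A) *ᵥ z)) x) t := fun t x => by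
    rw [Matrix.mulVec_mulVec]
    simp only [Matrix.mulVec, dotProduct]
    exact HasDerivAt.fun_sum fun j _ => (hasDerivAt_exp_smul_apply' A t x j).mul_const _
  have hwd : ∀ t i, HasDerivAt (fun t => w t i) ((-(G.m⁻¹ • (G.γ₀ *ᵥ w t)) - G.m⁻¹ • ((G.g * C) *ᵥ y t)) i) t := fun t i => by
    have := hd t (Sum.inr (Sum.inl i))
    rw [hA, augGen_mulVec] at this
    exact this
  have hyd : ∀ t l, HasDerivAt (fun t => y t l) (((M * Cᵀ * G.h) *ᵥ w t - Γ *ᵥ y t) l) t := fun t l => by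
    have := hd t (Sum.inr (Sum.inr l))
    rw [hA, augGen_mulVec] at this
    exact this
  -- Twice the energy: kinetic part plus the memory variables weighted by `M⁻¹`.
  set V : ℝ → ℝ := fun t => G.m * (w t ⬝ᵥ w t) + y t ⬝ᵥ (Q *ᵥ y t) with hV
  -- With `h = g*` and input matrix `M C*`, the work exchanged between velocity and memory cancels.
  -- What remains is the dissipation by `γ₀` and, through the Lyapunov equation, `-|Σ* M⁻¹ y|²`.
  have hVd : ∀ t, HasDerivAt V (-(2 * (w t ⬝ᵥ (G.γ₀ *ᵥ w t))) - (Sᵀ *ᵥ (Q *ᵥ y t)) ⬝ᵥ (Sᵀ *ᵥ (Q *ᵥ y t))) t := fun t => by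
    refine (((HasDerivAt.dotProduct_of_components (hwd t) (hwd t)).const_mul G.m).add
      (HasDerivAt.dotProduct_of_components (hyd t) (hasDerivAt_mulVec_apply Q (hyd t)))).congr_deriv ?_
    set p := Q *ᵥ y t with hp
    have hMQ : M * Q = 1 := mul_eq_one_comm.1 hQM
    have hyp : y t = M *ᵥ p := by rw [hp, Matrix.mulVec_mulVec, hMQ, Matrix.one_mulVec]
    have hsym : ∀ x, y t ⬝ᵥ (Q *ᵥ x) = p ⬝ᵥ x := fun x => by
      rw [Matrix.dotProduct_mulVec, ← Matrix.mulVec_transpose, hQ]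
    have e1 : p ⬝ᵥ ((M * Cᵀ * G.h) *ᵥ w t) = w t ⬝ᵥ ((G.g * C) *ᵥ y t) := by
      rw [hh, Matrix.mul_assoc, ← Matrix.transpose_mul, ← Matrix.mulVec_mulVec, Matrix.dotProduct_mulVec, ← Matrix.mulVec_transpose, hM, ← hyp,
        Matrix.mulVec_transpose, dotProduct_comm, ← Matrix.dotProduct_mulVec]
    have e2 : 2 * (p ⬝ᵥ (Γ *ᵥ y t)) = (Sᵀ *ᵥ p) ⬝ᵥ (Sᵀ *ᵥ p) := by
      rw [hyp, Matrix.mulVec_mulVec, two_mul_dotProduct_lyapunov hM hL]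
    rw [hsym, dotProduct_comm (_ - _) p, dotProduct_comm (_ - _) (w t)]
    simp only [dotProduct_sub, dotProduct_neg, dotProduct_smul, smul_eq_mul]
    rw [e1, ← e2]
    have hm := G.m_pos.ne'
    field_simp
    ring
  have hanti : Antitone V := antitone_of_deriv_nonpos (fun t => (hVd t).differentiableAt) fun t => by
    rw [(hVd t).deriv]
    have h1 := hγ (w t)
    have h2 : 0 ≤ (Sᵀ *ᵥ (Q *ᵥ y t)) ⬝ᵥ (Sᵀ *ᵥ (Q *ᵥ y t)) := Finset.sum_nonneg fun _ _ => mul_self_nonneg _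
    linarith
  refine ⟨Real.sqrt (V 0 / G.m), fun t ht i => Real.abs_le_sqrt ?_⟩
  rw [le_div_iff₀ G.m_pos]
  have h1 : V t ≤ V 0 := hanti ht
  have h2 := hQ0 (y t)
  have h3 : w t i * w t i ≤ w t ⬝ᵥ w t := Finset.single_le_sum (f := fun i => w t i * w t i) (fun _ _ => mul_self_nonneg _) (Finset.mem_univ i)
  have h4 := mul_le_mul_of_nonneg_left h3 G.m_pos.le
  change w t i ^ 2 * G.m ≤ V 0
  simp only [hV] at h1 ⊢
  nlinarith

/-- For a unit initial velocity, the velocity at time `t` is the corresponding column of `m H'`, so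
the energy bound applies. -/
lemma exists_abs_responseDeriv_le (hγ : ∀ x, 0 ≤ x ⬝ᵥ (G.γ₀ *ᵥ x)) (hh : G.h = G.gᵀ) {M Q : Matrix ι ι ℝ} {S : Matrix ι μ ℝ} (hM : Mᵀ = M)
    (hL : Γ * M + M * Γᵀ = S * Sᵀ) (hQM : Q * M = 1) (hQ : Qᵀ = Q) (hQ0 : ∀ x, 0 ≤ x ⬝ᵥ (Q *ᵥ x)) :
    ∃ b, ∀ t : ℝ, 0 ≤ t → ∀ i j, |responseDeriv G Γ C (M * Cᵀ) t i j| ≤ b := by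
  have h := fun j => exists_abs_velocity_le (C := C) hγ hh hM hL hQM hQ hQ0 (Pi.single (Sum.inr (Sum.inl j)) 1)
  choose b hb using h
  refine ⟨G.m⁻¹ * ∑ j, |b j|, fun t ht i j => ?_⟩
  have h1 := hb j t ht i
  rw [exp_augGen_mulVec_inr_inl, Matrix.mulVec_mulVec, Matrix.mulVec_single_one, Matrix.col_apply, exp_augGen_mul_inr_inl, abs_mul, abs_of_pos G.m_pos] at h1
  rw [← div_eq_inv_mul, le_div_iff₀' G.m_pos]
  exact h1.trans ((le_abs_self _).trans (Finset.single_le_sum (f := fun j => |b j|) (fun _ _ => abs_nonneg _) (Finset.mem_univ j)))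

/-- If the generator maps `z` to `(w, 0, 0)` minus a unit velocity, then the velocity started from
`z` is the constant `w` minus a column of `m H`. Velocities are bounded, hence so is `H`. Such a `z`
exists because `γ₀ + g C Γ⁻¹ M C* g*` is invertible. -/
lemma exists_abs_response_le (hγ : ∀ x, 0 ≤ x ⬝ᵥ (G.γ₀ *ᵥ x)) (hh : G.h = G.gᵀ) {M Q : Matrix ι ι ℝ} {S : Matrix ι μ ℝ} (hM : Mᵀ = M)
    (hL : Γ * M + M * Γᵀ = S * Sᵀ) (hQM : Q * M = 1) (hQ : Qᵀ = Q) (hQ0 : ∀ x, 0 ≤ x ⬝ᵥ (Q *ᵥ x)) {Γ' : Matrix ι ι ℝ} (hΓ : Γ * Γ' = 1)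
    {X : Matrix (Fin d) (Fin d) ℝ} (hX : (G.γ₀ + G.g * (C * Γ' * (M * Cᵀ)) * G.gᵀ) * X = 1) :
    ∃ b, ∀ t : ℝ, 0 ≤ t → ∀ i j, |response G Γ C (M * Cᵀ) t i j| ≤ b := by
  -- The choice of `y` makes the memory row vanish; the velocity row is then `-m⁻¹ (γ₀ + g K g*) w`
  -- with `K = C Γ⁻¹ M C*`, which this `w` turns into minus a unit vector.
  set w : Fin d → Fin d → ℝ := fun j => G.m • (X *ᵥ Pi.single j 1) with hw
  set y : Fin d → ι → ℝ := fun j => Γ' *ᵥ ((M * Cᵀ * G.h) *ᵥ w j) with hy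
  have hz : ∀ j, augGen G Γ C (M * Cᵀ) *ᵥ Sum.elim 0 (Sum.elim (w j) (y j)) = Sum.elim (w j) 0 - Pi.single (Sum.inr (Sum.inl j)) 1 := by
    intro j
    rw [augGen_mulVec]
    have e1 : G.γ₀ *ᵥ w j + (G.g * C) *ᵥ y j = G.m • Pi.single j 1 := by
      rw [hy, Matrix.mulVec_mulVec, Matrix.mulVec_mulVec, ← Matrix.add_mulVec]
      have : G.γ₀ + G.g * C * Γ' * (M * Cᵀ * G.h) = G.γ₀ + G.g * (C * Γ' * (M * Cᵀ)) * G.gᵀ := by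
        rw [hh]; simp only [Matrix.mul_assoc]
      rw [this, hw, Matrix.mulVec_smul, Matrix.mulVec_mulVec, hX, Matrix.one_mulVec]
    have e2 : Γ *ᵥ y j = (M * Cᵀ * G.h) *ᵥ w j := by
      rw [hy, Matrix.mulVec_mulVec, hΓ, Matrix.one_mulVec]
    ext x
    rcases x with i | i | l
    · simp
    · have e3 := congrFun e1 i
      simp only [Pi.add_apply, Pi.smul_apply, smul_eq_mul] at e3
      simp only [Sum.elim_inl, Sum.elim_inr, Pi.sub_apply, Pi.neg_apply, Pi.smul_apply, smul_eq_mul, Pi.zero_apply]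
      have hm := G.m_pos.ne'
      have e4 : (Pi.single (Sum.inr (Sum.inl j)) (1 : ℝ) : Fin d ⊕ Fin d ⊕ ι → ℝ) (Sum.inr (Sum.inl i)) = (Pi.single j (1 : ℝ) : Fin d → ℝ) i := by
        simp [Pi.single_apply]
      rw [e4, ← mul_right_inj' hm, mul_sub, mul_neg, mul_inv_cancel_left₀ hm, mul_inv_cancel_left₀ hm]
      linarith
    · have e3 := congrFun e2 l
      simp only [Sum.elim_inl, Sum.elim_inr, Pi.sub_apply, Pi.zero_apply]
      rw [e3]
      simp
  have h := fun j => exists_abs_velocity_le (C := C) hγ hh hM hL hQM hQ hQ0 (Sum.elim 0 (Sum.elim (w j) (y j)))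
  choose b hb using h
  refine ⟨G.m⁻¹ * ∑ j, ∑ i, (|b j| + |w j i|), fun t ht i j => ?_⟩
  have h1 := hb j t ht i
  have e5 : (NormedSpace.exp (t • augGen G Γ C (M * Cᵀ)) *ᵥ Sum.elim (w j) 0) (Sum.inl i) = w j i := by
    rw [Matrix.mulVec, dotProduct]
    simp only [Fintype.sum_sum_type, Sum.elim_inl, Sum.elim_inr, exp_augGen_inl_inl, Pi.zero_apply, mul_zero, Finset.sum_const_zero, add_zero]
    exact congrFun (Matrix.one_mulVec (w j)) i
  have e6 : NormedSpace.exp (t • augGen G Γ C (M * Cᵀ)) (Sum.inl i) (Sum.inr (Sum.inl j)) = G.m * response G Γ C (M * Cᵀ) t i j := by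
    rw [response, Matrix.of_apply, mul_inv_cancel_left₀ G.m_pos.ne']
  rw [exp_augGen_mulVec_inr_inl, hz, Matrix.mulVec_sub, Matrix.mulVec_single_one, Pi.sub_apply, Matrix.col_apply, e5, e6] at h1
  have h2 : |G.m * response G Γ C (M * Cᵀ) t i j| ≤ |b j| + |w j i| := by
    have h3 := abs_sub_abs_le_abs_sub (G.m * response G Γ C (M * Cᵀ) t i j) (w j i)
    rw [abs_sub_comm] at h3
    linarith [le_abs_self (b j)]
  rw [abs_mul, abs_of_pos G.m_pos] at h2
  rw [← div_eq_inv_mul, le_div_iff₀' G.m_pos]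
  exact h2.trans ((Finset.single_le_sum (f := fun i => |b j| + |w j i|) (fun _ _ => by positivity) (Finset.mem_univ i)).trans
    (Finset.single_le_sum (f := fun j => ∑ i, (|b j| + |w j i|)) (fun _ _ => Finset.sum_nonneg fun _ _ => by positivity) (Finset.mem_univ j)))

end Energy

end GLE

namespace GLE

/-! ### The static friction matrix -/

section Relaxation

variable {q : ℕ} {D : Model q q}

/-- The inverse of the rate matrix of the joint realization of the memory function. -/
noncomputable def Model.memΓinv (D : Model q q) : Matrix (Fin D.d₁ ⊕ Fin D.d₂) (Fin D.d₁ ⊕ Fin D.d₂) ℝ :=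
  Matrix.fromBlocks D.sys₁.Γ⁻¹ 0 0 D.sys₂.Γ⁻¹

lemma Model.Standing.memΓ_mul_inv (hD : D.Standing) : D.memΓ * D.memΓinv = 1 := by
  rw [Model.memΓ, Model.memΓinv, Matrix.fromBlocks_multiply]
  simp only [Matrix.mul_zero, Matrix.zero_mul, add_zero, zero_add]
  rw [Matrix.mul_nonsing_inv _ hD.adm₁.isUnit_det, Matrix.mul_nonsing_inv _ hD.adm₂.isUnit_det, Matrix.fromBlocks_one]

/-- The second system contributes nothing, since its first effective constant is zero. -/
lemma Model.Standing.memC_mul_inv (hD : D.Standing) (h1 : D.α₁ = 1) : D.memC * D.memΓinv * (D.memM * D.memCᵀ) = D.sys₁.effConst 1 := by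
  have e1 : D.sys₁.effConst 1 = D.sys₁.C * D.sys₁.Γ⁻¹ * D.sys₁.M * D.sys₁.Cᵀ := by
    simpa using D.sys₁.effConst_natCast 1
  have e2 : D.sys₂.C * D.sys₂.Γ⁻¹ * D.sys₂.M * D.sys₂.Cᵀ = 0 := by
    rw [← hD.damping₂]; simpa using (D.sys₂.effConst_natCast 1).symm
  simp only [Matrix.mul_assoc] at e1 e2
  rw [Model.memΓinv, Model.memC, Model.memM, Matrix.transpose_fromCols,
    Matrix.fromBlocks_mul_fromRows, Matrix.fromCols_mul_fromBlocks, Matrix.fromCols_mul_fromRows]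
  simp only [Matrix.mul_zero, Matrix.zero_mul, add_zero, zero_add, smul_zero, Matrix.transpose_smul, Matrix.smul_mul, Matrix.mul_smul, Matrix.mul_assoc, h1, e1, e2, one_smul]

lemma Model.Standing.tendsto_exp (hD : D.Standing) (a b) : Tendsto (fun t : ℝ => NormedSpace.exp (t • -D.memΓ) a b) atTop (𝓝 0) := by
  have hdecay : ∀ {n : ℕ} (Γ : Matrix (Fin n) (Fin n) ℝ), (∀ μ ∈ spectrum ℂ (toC Γ), 0 < μ.re) → ∀ i j,
      Tendsto (fun t : ℝ => NormedSpace.exp (t • -Γ) i j) atTop (𝓝 0) := fun Γ hΓ i j => by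
    obtain ⟨c, K, hc, hK⟩ := exists_abs_exp_neg_smul_apply_le Γ hΓ
    have h0 : Tendsto (fun t : ℝ => K * Real.exp (c * t)) atTop (𝓝 0) := by
      rw [← mul_zero K]
      exact (Real.tendsto_exp_atBot.comp (tendsto_id.const_mul_atTop_of_neg hc)).const_mul K
    refine squeeze_zero_norm' ?_ h0
    filter_upwards [eventually_ge_atTop 0] with t ht using hK t ht i j
  have h : ∀ t : ℝ, NormedSpace.exp (t • -D.memΓ) = Matrix.fromBlocks (NormedSpace.exp (t • -D.sys₁.Γ)) 0 0 (NormedSpace.exp (t • -D.sys₂.Γ)) := fun t => by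
    rw [← exp_fromBlocks_diagonal]
    simp [Model.memΓ, Matrix.fromBlocks_neg, Matrix.fromBlocks_smul]
  simp_rw [h]
  rcases a with a | a <;> rcases b with b | b
  · exact hdecay _ hD.adm₁.posStable a b
  · exact tendsto_const_nhds
  · exact tendsto_const_nhds
  · exact hdecay _ hD.adm₂.posStable a b

/-- The total friction matrix is symmetric if the memory function is. -/
lemma Model.Standing.friction_transpose (hD : D.Standing) (hs : ∀ t, (D.κ t)ᵀ = D.κ t) :
    (D.memC * D.memΓinv * (D.memM * D.memCᵀ))ᵀ = D.memC * D.memΓinv * (D.memM * D.memCᵀ) := by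
  set X := D.memΓinv * (D.memM * D.memCᵀ) with hX
  have hΓX : D.memΓ * X = D.memM * D.memCᵀ := by rw [hX, ← Matrix.mul_assoc, hD.memΓ_mul_inv, Matrix.one_mul]
  -- `F(t)` is the tail `∫_t^∞ κ`: its derivative is `-κ` and it tends to `0`. Its antisymmetric
  -- part is therefore constant with limit `0`, and `F(0)` is the friction matrix.
  set F : ℝ → Matrix (Fin q) (Fin q) ℝ := fun t => D.memC * (NormedSpace.exp (t • -D.memΓ) * X) with hF
  have hFe : ∀ t i j, F t i j = ∑ a, ∑ b, D.memC i a * (NormedSpace.exp (t • -D.memΓ) a b * X b j) := fun t i j => by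
    simp only [hF, Matrix.mul_apply, Finset.mul_sum]
  have hFd : ∀ t, 0 ≤ t → ∀ i j, HasDerivAt (fun t => F t i j) (-(D.κ t i j)) t := fun t ht i j => by
    simp_rw [hFe]
    refine (HasDerivAt.fun_sum fun a _ => HasDerivAt.fun_sum fun b _ =>
      ((hasDerivAt_exp_smul_apply (-D.memΓ) t a b).mul_const (X b j)).const_mul (D.memC i a)).congr_deriv ?_
    rw [D.κ_eq_exp hD t ht, ← hΓX, ← Matrix.neg_apply]
    have : -(D.memC * NormedSpace.exp (t • -D.memΓ) * (D.memΓ * X)) = D.memC * (NormedSpace.exp (t • -D.memΓ) * -D.memΓ * X) := by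
      simp only [Matrix.mul_neg, Matrix.neg_mul, Matrix.mul_assoc]
    rw [this]
    simp only [Matrix.mul_apply (M := D.memC), Matrix.mul_apply (N := X), Finset.mul_sum]
  have hF0 : ∀ i j, Tendsto (fun t => F t i j) atTop (𝓝 0) := fun i j => by
    simp_rw [hFe]
    have : Tendsto (fun t : ℝ => ∑ a, ∑ b, D.memC i a * (NormedSpace.exp (t • -D.memΓ) a b * X b j)) atTop (𝓝 (∑ a, ∑ b, D.memC i a * (0 * X b j))) :=
      tendsto_finsetSum _ fun a _ => tendsto_finsetSum _ fun b _ => ((hD.tendsto_exp a b).mul_const _).const_mul _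
    simpa using this
  ext i j
  have hconst : ∀ t, 0 ≤ t → F t j i - F t i j = F 0 j i - F 0 i j := fun t ht => by
    have h1 := intervalIntegral.integral_eq_sub_of_hasDerivAt (a := 0) (b := t) (f := fun t => F t j i - F t i j) (f' := fun _ => 0)
      (fun s hst => by
        rw [Set.uIcc_of_le ht] at hst
        refine ((hFd s hst.1 j i).fun_sub (hFd s hst.1 i j)).congr_deriv ?_
        have := congrFun (congrFun (hs s) i) j
        rw [Matrix.transpose_apply] at this
        rw [this]
        ring) (by simp)
    simp only [intervalIntegral.integral_zero] at h1
    linarith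
  have hlim : Tendsto (fun t => F t j i - F t i j) atTop (𝓝 (F 0 j i - F 0 i j)) := by
    refine tendsto_const_nhds.congr' ?_
    filter_upwards [eventually_ge_atTop 0] with t ht using (hconst t ht).symm
  have h2 := tendsto_nhds_unique hlim ((hF0 j i).sub (hF0 i j))
  have h3 : F 0 = D.memC * D.memΓinv * (D.memM * D.memCᵀ) := by
    simp only [hF, zero_smul, NormedSpace.exp_zero, Matrix.one_mul, hX, Matrix.mul_assoc]
  rw [Matrix.transpose_apply, ← h3]
  linarith

/-- With `p = (Γ*)⁻¹ C* x` the quadratic form becomes `p · M Γ* p`, which the Lyapunov equation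
identifies with `½ |Σ* p|²`. -/
lemma Model.Standing.friction_nonneg (hD : D.Standing) (x : Fin q → ℝ) :
    0 ≤ x ⬝ᵥ ((D.memC * D.memΓinv * (D.memM * D.memCᵀ)) *ᵥ x) := by
  have hΓ := hD.memΓ_mul_inv
  set p := D.memΓinvᵀ *ᵥ (D.memCᵀ *ᵥ x) with hp
  have ha : D.memCᵀ *ᵥ x = D.memΓᵀ *ᵥ p := by
    rw [hp, Matrix.mulVec_mulVec, ← Matrix.transpose_mul, mul_eq_one_comm.1 hΓ, Matrix.transpose_one, Matrix.one_mulVec]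
  have e1 : x ⬝ᵥ ((D.memC * D.memΓinv * (D.memM * D.memCᵀ)) *ᵥ x) = p ⬝ᵥ ((D.memM * D.memΓᵀ) *ᵥ p) := by
    rw [Matrix.mul_assoc, ← Matrix.mulVec_mulVec, Matrix.dotProduct_mulVec, ← Matrix.mulVec_transpose, ← Matrix.mulVec_mulVec, Matrix.dotProduct_mulVec,
      ← Matrix.mulVec_transpose, ← hp, ← Matrix.mulVec_mulVec, ha, Matrix.mulVec_mulVec]
  have e2 := two_mul_dotProduct_lyapunov hD.memM_transpose hD.mem_lyapunov p
  have e3 : D.memM * D.memΓᵀ = (D.memΓ * D.memM)ᵀ := by rw [Matrix.transpose_mul, hD.memM_transpose]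
  have e4 : 0 ≤ (D.memSᵀ *ᵥ p) ⬝ᵥ (D.memSᵀ *ᵥ p) := Finset.sum_nonneg fun _ _ => mul_self_nonneg _
  rw [e1, e3, Matrix.mulVec_transpose, dotProduct_comm, ← Matrix.dotProduct_mulVec]
  linarith

end Relaxation

/-! ### Growth of the mean-squared displacement -/

section Growth

variable {d k : ℕ} {D : Model d d} {G : Coeff d d d k}

lemma FluctuationDissipation.damping_nonneg (hF : FluctuationDissipation D G) (x : Fin d → ℝ) : 0 ≤ x ⬝ᵥ (G.γ₀ *ᵥ x) := by
  rw [hF.damping, Matrix.smul_mulVec, dotProduct_smul, ← Matrix.mulVec_mulVec, Matrix.dotProduct_mulVec, ← Matrix.mulVec_transpose]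
  exact smul_nonneg (by norm_num) (Finset.sum_nonneg fun _ _ => mul_self_nonneg _)

lemma FluctuationDissipation.h_eq_transpose (hF : FluctuationDissipation D G) : G.h = G.gᵀ := by
  rw [hF.g_eq, ← hF.h_eq, Matrix.transpose_transpose]

lemma FluctuationDissipation.kernel_eq (hF : FluctuationDissipation D G) (t : ℝ) : G.σ * D.κ t * G.σᵀ = G.hᵀ * (D.κ t)ᵀ * G.gᵀ := by
  rw [hF.h_eq, hF.g_eq, hF.symm]

lemma FluctuationDissipation.exists_abs_modelResponseDeriv_le (hD : D.Standing) (hF : FluctuationDissipation D G) :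
    ∃ b, ∀ t : ℝ, 0 ≤ t → ∀ i j, |modelResponseDeriv D G t i j| ≤ b := by
  obtain ⟨Q, hQM, hQ, hQ0⟩ := hD.exists_memM_inv
  exact exists_abs_responseDeriv_le hF.damping_nonneg hF.h_eq_transpose hD.memM_transpose hD.mem_lyapunov hQM hQ hQ0

/-- For `α₁ = 1` the friction matrix is `K₁⁽¹⁾`, which is invertible. Being symmetric and positive
semidefinite, it kills no nonzero vector in its quadratic form, so adding `γ₀` cannot create a
kernel. -/
lemma FluctuationDissipation.exists_abs_modelResponse_le (hD : D.Standing) (hF : FluctuationDissipation D G) (h1 : D.α₁ = 1) :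
    ∃ b, ∀ t : ℝ, 0 ≤ t → ∀ i j, |modelResponse D G t i j| ≤ b := by
  obtain ⟨Q, hQM, hQ, hQ0⟩ := hD.exists_memM_inv
  set K := D.memC * D.memΓinv * (D.memM * D.memCᵀ) with hK
  have hKpsd : K.PosSemidef := Matrix.PosSemidef.of_dotProduct_mulVec_nonneg
    (by rw [Matrix.IsHermitian, Matrix.conjTranspose_eq_transpose_of_trivial]; exact hD.friction_transpose hF.symm)
    fun x => by simpa using hD.friction_nonneg x
  have hKu : IsUnit K := by rw [hK, hD.memC_mul_inv h1]; exact hD.damping₁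
  have hgu : IsUnit G.gᵀ := by
    rw [Matrix.isUnit_transpose, hF.g_eq]
    exact hF.posDef.isUnit
  have hdet : (G.γ₀ + G.g * K * G.gᵀ).det ≠ 0 := by
    intro h0
    obtain ⟨x, hx, hx0⟩ := Matrix.exists_mulVec_eq_zero_iff.2 h0
    have e1 : x ⬝ᵥ (G.γ₀ *ᵥ x) + (G.gᵀ *ᵥ x) ⬝ᵥ (K *ᵥ (G.gᵀ *ᵥ x)) = 0 := by
      have : x ⬝ᵥ ((G.γ₀ + G.g * K * G.gᵀ) *ᵥ x) = 0 := by rw [hx0, dotProduct_zero]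
      rw [Matrix.add_mulVec, dotProduct_add, Matrix.mul_assoc, ← Matrix.mulVec_mulVec, Matrix.dotProduct_mulVec x G.g, ← Matrix.mulVec_transpose,
        ← Matrix.mulVec_mulVec] at this
      exact this
    have e2 : (G.gᵀ *ᵥ x) ⬝ᵥ (K *ᵥ (G.gᵀ *ᵥ x)) = 0 := by
      have := hD.friction_nonneg (G.gᵀ *ᵥ x)
      have := hF.damping_nonneg x
      linarith
    have e3 : K *ᵥ (G.gᵀ *ᵥ x) = 0 := (hKpsd.dotProduct_mulVec_zero_iff _).1 (by simpa using e2)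
    have e4 := Matrix.mulVec_injective_of_isUnit hgu (a₁ := x) (a₂ := 0)
      (by rw [Matrix.mulVec_zero]; exact Matrix.mulVec_injective_of_isUnit hKu (by rw [e3, Matrix.mulVec_zero]))
    exact hx e4
  exact exists_abs_response_le hF.damping_nonneg hF.h_eq_transpose hD.memM_transpose hD.mem_lyapunov hQM hQ hQ0 hD.memΓ_mul_inv
    (Matrix.mul_nonsing_inv _ (isUnit_iff_ne_zero.2 hdet))

/-- The growth of the mean-squared displacement in terms of the growth of the response function. -/
lemma FluctuationDissipation.msdExpr_isBigO (hD : D.Standing) (hF : FluctuationDissipation D G) (τ : ℝ → ℝ) (b : ℝ) (hτ0 : ∀ t, 0 ≤ t → 0 ≤ τ t)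
    (hτm : MonotoneOn τ (Set.Ici 0)) (hτ : ∀ t, 1 ≤ t → τ t ≤ t) (hb : ∀ t : ℝ, 0 ≤ t → ∀ i j, |modelResponse D G t i j| ≤ b * τ t)
    (KE : Matrix (Fin d) (Fin d) ℝ) (i j) : (fun t => msdExpr G (modelResponse D G) KE t i j) =O[atTop] fun t => t * τ t := by
  obtain ⟨b', hb'⟩ := hF.exists_abs_modelResponseDeriv_le hD
  have hb0 : ∀ t, 0 ≤ t → 0 ≤ b * τ t := fun t ht => (abs_nonneg _).trans (hb t ht i j)
  have hb'0 : 0 ≤ b' := (abs_nonneg _).trans (hb' 0 le_rfl i j)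
  set S := ∑ l, ∑ l', |KE l l'| with hS
  have hS0 : 0 ≤ S := Finset.sum_nonneg fun _ _ => Finset.sum_nonneg fun _ _ => abs_nonneg _
  -- The summands bound `∫ H`, the kinetic term and `∫ H Ḣ*` in this order. The kinetic term is
  -- quadratic in `τ`, and `τ t ≤ t` for `t ≥ 1` reduces it to `t τ`.
  refine IsBigO.of_bound (2 * |b| + 2 * G.m * (b ^ 2 * S + d * |b| * b')) ?_
  filter_upwards [eventually_ge_atTop 1] with t ht
  have ht0 : 0 ≤ t := zero_le_one.trans ht
  have hτt := hτ0 t ht0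
  have hle : ∀ u, 0 ≤ u → u ≤ t → ∀ i j, |modelResponse D G u i j| ≤ |b| * τ t := fun u hu hut i j =>
    (hb u hu i j).trans (mul_le_mul (le_abs_self b) (hτm hu ht0 hut) (hτ0 u hu) (abs_nonneg b))
  -- The last integral in `A(t)` vanishes by the fluctuation-dissipation relation for `γ₀`.
  have hzero : G.σ₀ * G.σ₀ᵀ - (2 : ℝ) • G.γ₀ᵀ = 0 := by
    rw [hF.damping, Matrix.transpose_smul, Matrix.transpose_mul, Matrix.transpose_transpose, smul_smul]
    norm_num
  rw [(isResponse_modelResponse hD).msdExpr_eq hD _ ht0, hzero]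
  simp only [Matrix.mul_zero, Matrix.zero_mul, Matrix.zero_apply, intervalIntegral.integral_zero, add_zero]
  have h1 : |∫ u in (0 : ℝ)..t, modelResponse D G u i j| ≤ |b| * (t * τ t) := by
    have := intervalIntegral.norm_integral_le_of_norm_le_const (a := 0) (b := t) (f := fun u => modelResponse D G u i j) (C := |b| * τ t) fun u hu => by
      rw [Set.uIoc_of_le ht0] at hu
      exact hle u hu.1.le hu.2 i j
    rw [sub_zero, abs_of_nonneg ht0, Real.norm_eq_abs] at this
    linarith
  have h2 : |∫ u in (0 : ℝ)..t, (modelResponse D G u * (modelResponseDeriv D G u)ᵀ) i j| ≤ d * |b| * b' * (t * τ t) := by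
    have := intervalIntegral.norm_integral_le_of_norm_le_const (a := 0) (b := t) (f := fun u => (modelResponse D G u * (modelResponseDeriv D G u)ᵀ) i j)
      (C := d * (|b| * τ t * b')) fun u hu => by
      rw [Set.uIoc_of_le ht0] at hu
      rw [Matrix.mul_apply, Real.norm_eq_abs]
      refine (Finset.abs_sum_le_sum_abs _ _).trans ((Finset.sum_le_card_nsmul _ _ (|b| * τ t * b') fun l _ => ?_).trans ?_)
      · rw [abs_mul]
        exact mul_le_mul (hle u hu.1.le hu.2 i l) (hb' u hu.1.le j l) (abs_nonneg _) (by positivity)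
      · simp
    rw [sub_zero, abs_of_nonneg ht0, Real.norm_eq_abs] at this
    linarith
  have h3 : |(modelResponse D G t * KE * (modelResponse D G t)ᵀ) i j| ≤ b ^ 2 * S * (t * τ t) := by
    have e1 : |(modelResponse D G t * KE * (modelResponse D G t)ᵀ) i j| ≤ ∑ l', ∑ l, (|b| * τ t) * |KE l l'| * (|b| * τ t) := by
      rw [Matrix.mul_apply]
      refine (Finset.abs_sum_le_sum_abs _ _).trans (Finset.sum_le_sum fun l' _ => ?_)
      rw [Matrix.mul_apply, Finset.sum_mul]
      refine (Finset.abs_sum_le_sum_abs _ _).trans (Finset.sum_le_sum fun l _ => ?_)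
      rw [abs_mul, abs_mul]
      exact mul_le_mul (mul_le_mul_of_nonneg_right (hle t ht0 le_rfl i l) (abs_nonneg _)) (hle t ht0 le_rfl j l') (abs_nonneg _) (by positivity)
    have e2 : ∑ l', ∑ l, (|b| * τ t) * |KE l l'| * (|b| * τ t) = b ^ 2 * S * (τ t * τ t) := by
      rw [Finset.sum_comm, hS, Finset.mul_sum, Finset.sum_mul]
      refine Finset.sum_congr rfl fun l _ => ?_
      rw [Finset.mul_sum, Finset.sum_mul]
      refine Finset.sum_congr rfl fun l' _ => ?_
      rw [← sq_abs b]
      ring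
    rw [e2] at e1
    exact e1.trans (mul_le_mul_of_nonneg_left (mul_le_mul_of_nonneg_right (hτ t ht) hτt) (by positivity))
  have hm := G.m_pos
  rw [Real.norm_eq_abs, Real.norm_eq_abs, abs_of_nonneg (mul_nonneg ht0 hτt)]
  refine (abs_add_le _ _).trans ?_
  rw [abs_mul, abs_mul, abs_of_pos (show (0 : ℝ) < 2 by norm_num), abs_of_pos (show (0 : ℝ) < 2 * G.m by positivity)]
  have h4 := abs_sub ((modelResponse D G t * KE * (modelResponse D G t)ᵀ) i j) (∫ u in (0 : ℝ)..t, (modelResponse D G u * (modelResponseDeriv D G u)ᵀ) i j)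
  have h5 := mul_le_mul_of_nonneg_left (h4.trans (add_le_add h3 h2)) (show (0 : ℝ) ≤ 2 * G.m by positivity)
  linarith

/-- The velocity response bounds the position response linearly. -/
lemma FluctuationDissipation.exists_abs_modelResponse_le_mul (hD : D.Standing) (hF : FluctuationDissipation D G) :
    ∃ b, ∀ t : ℝ, 0 ≤ t → ∀ i j, |modelResponse D G t i j| ≤ b * t := by
  obtain ⟨b, hb⟩ := hF.exists_abs_modelResponseDeriv_le hD
  refine ⟨b, fun t ht i j => ?_⟩
  have h1 := intervalIntegral.integral_eq_sub_of_hasDerivAt (a := 0) (b := t) (f := fun t => modelResponse D G t i j) (f' := fun t => modelResponseDeriv D G t i j)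
    (fun s _ => hasDerivAt_response _ _ _ _ s i j) ((continuous_modelResponseDeriv.matrix_elem i j).intervalIntegrable _ _)
  have h0 : modelResponse D G 0 i j = 0 := by rw [modelResponse, response_zero]; rfl
  simp only [h0, sub_zero] at h1
  rw [← h1]
  have h2 := intervalIntegral.norm_integral_le_of_norm_le_const (a := 0) (b := t) (f := fun t => modelResponseDeriv D G t i j) (C := b) fun u hu => by
    rw [Set.uIoc_of_le ht] at hu
    exact hb u hu.1.le i j
  rwa [sub_zero, abs_of_nonneg ht, Real.norm_eq_abs] at h2

variable {Ω : Type*} [MeasurableSpace Ω] {P : Measure Ω} [IsProbabilityMeasure P]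
  {ξ : ℝ → Ω → Fin d → ℝ} {W : ℝ≥0 → Ω → Fin k → ℝ} {v : ℝ → Ω → Fin d → ℝ}

lemma FluctuationDissipation.secondMoment_isBigO (hD : D.Standing) (hF : FluctuationDissipation D G) (hξ : IsNoise D P ξ) (hs : IsSolution G D.κ P ξ W v)
    (hv : MemLp (v 0) 2 P) {ρ : ℝ → ℝ} (h : ∀ KE i j, (fun t => msdExpr G (modelResponse D G) KE t i j) =O[atTop] ρ) (i j) :
    (fun t : ℝ => secondMoment P (position v t) i j) =O[atTop] ρ := by
  refine (((h (kineticEnergy G P v) i j).add (h (kineticEnergy G P v) j i)).const_mul_left (1 / 2)).congr' ?_ EventuallyEq.rfl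
  filter_upwards [eventually_ge_atTop 0] with t ht
  rw [(memLp_position_and_secondMoment hD hF.cov_eq hF.kernel_eq (isResponse_modelResponse hD) hξ hs hv ht).2]
  rfl

end Growth

end GLE

theorem proposition3p1 {Ω : Type*} [MeasurableSpace Ω] (P : Measure Ω) [IsProbabilityMeasure P] :
    -- (i) spectral densities near zero, and mean-square regularity of the noise
    (∀ (q r : ℕ) (D : GLE.Model q r), D.Standing →
      (∀ i j, (fun w : ℝ => D.spec₃ w i j) =O[𝓝 0] (fun _ => (1 : ℝ))) ∧
      (∀ k : ℕ, 3 ≤ k → Odd k →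
        (∀ n : ℕ, 0 < n → n < k → Odd n → D.sys₄.effConst n = 0) → D.sys₄.effConst k ≠ 0 →
        ∀ i j, (fun w : ℝ => D.spec₄ w i j) =O[𝓝 0] (fun w : ℝ => w ^ (k - 1))) ∧
      (∀ h : ℝ, 0 < h →
        (∀ i j, (fun w : ℝ => D.spec w i j) =O[atTop] (fun w : ℝ => 1 / w ^ (2 * h + 1))) →
        ∀ ξ : ℝ → Ω → Fin r → ℝ, GLE.IsNoise D P ξ →
        ∀ n : ℕ, (n : ℝ) < h → GLE.IsMSDifferentiable P n ξ)) ∧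
    -- (ii) the mean-squared displacement
    (∀ (d q k : ℕ) (D : GLE.Model q q) (G : GLE.Coeff d q q k), D.Standing →
      (∀ t, D.R t = D.κ t) →
      (∀ t, G.σ * D.κ t * G.σᵀ = G.hᵀ * (D.κ t)ᵀ * G.gᵀ) →
      (∃ H, GLE.IsResponse G D.κ H) ∧
      ∀ H, GLE.IsResponse G D.κ H →
        ∀ (ξ : ℝ → Ω → Fin q → ℝ) (W : ℝ≥0 → Ω → Fin k → ℝ) (v : ℝ → Ω → Fin d → ℝ),
        GLE.IsNoise D P ξ → GLE.IsSolution G D.κ P ξ W v → MemLp (v 0) 2 P →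
        ∀ t, 0 ≤ t → MemLp (GLE.position v t) 2 P ∧
          GLE.secondMoment P (GLE.position v t) =
            (1 / 2 : ℝ) • (GLE.msdExpr G H (GLE.kineticEnergy G P v) t +
              (GLE.msdExpr G H (GLE.kineticEnergy G P v) t)ᵀ)) ∧
    -- (iii) normal diffusion
    (∀ (d k : ℕ) (D : GLE.Model d d) (G : GLE.Coeff d d d k), D.Standing →
      GLE.FluctuationDissipation D G → D.α₁ = 1 → D.α₃ = 1 →
      ∀ (ξ : ℝ → Ω → Fin d → ℝ) (W : ℝ≥0 → Ω → Fin k → ℝ) (v : ℝ → Ω → Fin d → ℝ),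
      GLE.IsNoise D P ξ → GLE.IsSolution G D.κ P ξ W v → MemLp (v 0) 2 P →
      (∀ t, 0 ≤ t → MemLp (GLE.position v t) 2 P) ∧
      ∀ i j, (fun t : ℝ => GLE.secondMoment P (GLE.position v t) i j) =O[atTop]
        (fun t : ℝ => t)) ∧
    -- (iv) ballistic diffusion
    (∀ (d k : ℕ) (D : GLE.Model d d) (G : GLE.Coeff d d d k), D.Standing →
      GLE.FluctuationDissipation D G → D.α₁ = 0 → D.α₂ = 1 → G.γ₀ = 0 → G.σ₀ = 0 →
      ∀ (ξ : ℝ → Ω → Fin d → ℝ) (W : ℝ≥0 → Ω → Fin k → ℝ) (v : ℝ → Ω → Fin d → ℝ),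
      GLE.IsNoise D P ξ → GLE.IsSolution G D.κ P ξ W v → MemLp (v 0) 2 P →
      (∀ t, 0 ≤ t → MemLp (GLE.position v t) 2 P) ∧
      ∀ i j, (fun t : ℝ => GLE.secondMoment P (GLE.position v t) i j) =O[atTop]
        (fun t : ℝ => t ^ 2)) := by
  refine ⟨fun q r D hD => ⟨fun i j => GLE.fourierMat_isBigO_one _ i j _, fun k hk3 hk hL hLk => ?_, fun h hh hS ξ hξ n hn => ?_⟩, ?_, ?_, ?_⟩
  · exact hD.adm₄.fourier_cov_isBigO_pow k hk hL
  · exact hξ.isMSDifferentiable_of_spec hD h hS n hn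
  · intro d q k D G hD hR hFD
    exact ⟨⟨_, GLE.isResponse_modelResponse hD⟩, fun H hH ξ W v hξ hs hv t ht => GLE.memLp_position_and_secondMoment hD hR hFD hH hξ hs hv ht⟩
  · intro d k D G hD hF h1 h3 ξ W v hξ hs hv
    refine ⟨fun t ht => (GLE.memLp_position_and_secondMoment hD hF.cov_eq hF.kernel_eq (GLE.isResponse_modelResponse hD) hξ hs hv ht).1, ?_⟩
    obtain ⟨b, hb⟩ := hF.exists_abs_modelResponse_le hD h1
    refine hF.secondMoment_isBigO hD hξ hs hv fun KE i j => ?_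
    -- Bounded response: `τ = 1`, so the displacement is of order `t`.
    simpa using hF.msdExpr_isBigO hD (fun _ => 1) b (fun _ _ => zero_le_one) monotoneOn_const (fun t ht => ht) (by simpa using hb) KE i j
  · intro d k D G hD hF h1 h2 h0 h0' ξ W v hξ hs hv
    refine ⟨fun t ht => (GLE.memLp_position_and_secondMoment hD hF.cov_eq hF.kernel_eq (GLE.isResponse_modelResponse hD) hξ hs hv ht).1, ?_⟩
    obtain ⟨b, hb⟩ := hF.exists_abs_modelResponse_le_mul hD
    refine hF.secondMoment_isBigO hD hξ hs hv fun KE i j => ?_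
    -- Linearly bounded response: `τ(t) = t`, so the displacement is of order `t²`.
    simpa only [sq, id] using hF.msdExpr_isBigO hD id b (fun _ ht => ht) monotoneOn_id (fun t _ => le_rfl) hb KE i j
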